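/- **Setting.** Let $N,I,P\ge 1$ and let $R$ be a multiple of $P$. Client $i\in[N]$ has the objective $f_i(x)=\mathbb E_{\xi\sim\mathcal D_i}[F_i(x;\xi)]$ on $\mathbb R^d$, with $F_i(\cdot;\xi)$ differentiable, and $f=\frac1N\sum_{i=1}^N f_i$. The samples $\xi^i_{r,k}\sim\mathcal D_i$ ($-P\le r<R$, $0\le k<I$, $i\in[N]$) are independent. The participation weights are random variables $q_r^i\ge 0$ ($0\le r<R$). For $r_0\in\{0,P,\dots,R-P\}$ put $\bar q_{r_0}^i=\frac1P\sum_{r=r_0}^{r_0+P-1}q_r^i$, and let $\mathcal Q_{:r_0}$ be the $\sigma$-algebra generated by the $q_r^i$ with $r<r_0$. **Algorithm (Amplified SCAFFOLD, step sizes $\eta,\gamma>0$).** Start from $\bar x_0=x_0$ and $G_0^i=\frac1{IP}\sum_{s=-P}^{-1}\sum_{k=0}^{I-1}\nabla F_i(x_0;\xi^i_{s,k})$. In a round $r$ of the window starting at $r_0$, every client sets $x^i_{r,0}=\bar x_r$ and $x^i_{r,k+1}=x^i_{r,k}-\eta\,(\nabla F_i(x^i_{r,k};\xi^i_{r,k})-G^i_{r_0}+G_{r_0})$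 for $0\le k<I$, where $G_{r_0}=\frac1N\sum_j G^j_{r_0}$; let $\delta_r=\sum_i q_r^i(x^i_{r,I}-\bar x_r)$. Inside the window $\bar x_{r+1}=\bar x_r+\delta_r$. At its end, $\bar x_{r_0+P}=\bar x_{r_0}+\gamma\sum_{r=r_0}^{r_0+P-1}\delta_r$, and $G^i_{r_0+P}=\frac1{P\bar q^i_{r_0}I}\sum_{s=r_0}^{r_0+P-1}q_s^i\sum_{k=0}^{I-1}\nabla F_i(x^i_{s,k};\xi^i_{s,k})$ if $\bar q^i_{r_0}>0$, while $G^i_{r_0+P}=G^i_{r_0}$ otherwise. **Hypotheses.** Let $\Delta,L,\sigma,\epsilon>0$ and $\rho,p_{\text{sample}}\in(0,1]$, and suppose: 1. $f(x_0)-\inf f\le\Delta$; every $f_i$ is differentiable with $\|\nabla f_i(x)-\nabla f_i(y)\|\le L\|x-y\|$; and $\mathbb E_{\xi\sim\mathcal D_i}\|\nabla F_i(x;\xi)-\nabla f_i(x)\|^2\le\sigma^2$ for all $x$ and $i$. 2. Almost surely $\sum_i q_r^i=1$ and $\sum_i(q_r^i)^2\le\rho^2$ for all $r$. For every window start $r_0$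 and every $i$, almost surely $\mathbb E[\bar q^i_{r_0}\mid\mathcal Q_{:r_0}]=\frac1N$ and $\mathbb P(\bar q^i_{r_0}>0\mid\mathcal Q_{:r_0})\ge p_{\text{sample}}$. The weights are independent of the samples. 3. For every window start $r_0$ and every $i$, $$\mathbb E\Big[\frac1N\sum_{j}\frac{\mathbf 1\{\bar q^j_{r_0}>0\}}{P\bar q^j_{r_0}}\sum_{s=r_0}^{r_0+P-1}q_s^iq_s^j\Big]\le\frac{P^2}{N},\qquad \mathbb E\Big[\sum_i\big(\bar q^i_{r_0}-\tfrac1N\big)^2\Lambda^i_{r_0}\Big]\le\rho^2,$$ where $\Lambda^i_{r_0}=\frac1P\sum_s z_s^2\big/\big(\frac1P\sum_s z_s\big)^2$, and $z_1,\dots,z_P$ are the weights of client $i$ in the last window before $r_0$ in which it participated ($z_s=1$ for all $s$ if there is none). **Claim.** Let $$0<\eta\le\frac1{264\sqrt P}\min\Big\{\frac{\Delta^{1/4}\rho^{1/2}}{L^{3/4}I^{3/4}R^{1/4}P^{1/2}\sigma^{1/2}},\ \frac{\rho\sqrt{p_{\text{sample}}}}{LIP}\Big\},\qquad \gamma=\frac1\eta\min\Big\{\frac{\sqrt\Delta}{60\sqrt{LIR}\,\rho\sigma},\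 \frac{p_{\text{sample}}}{60LIP}\Big\}.$$ If $$R\ge\frac{\Delta L\rho^2\sigma^2}{I\epsilon^4}+\frac{300\,\Delta LP}{p_{\text{sample}}\epsilon^2},$$ then the random variables $\|\nabla f(\bar x_{r_0})\|^2$ are integrable and $$\frac PR\sum_{r_0\in\{0,P,\dots,R-P\}}\mathbb E\,\|\nabla f(\bar x_{r_0})\|^2\le 302\,\epsilon^2 .$$ In particular, if $I\ge\rho^2\sigma^2p_{\text{sample}}/(P\epsilon^2)$, then the same conclusion holds as soon as $R\ge 301\,\Delta LP/(p_{\text{sample}}\epsilon^2)$; this number of rounds is of order $\epsilon^{-2}$ and involves no measure of data heterogeneity. -/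

import Mathlib

open MeasureTheory ProbabilityTheory

noncomputable section

namespace AmplifiedScaffold

/-- The model space `ℝ^d` with the Euclidean norm. -/
abbrev Vec (d : ℕ) : Type := EuclideanSpace ℝ (Fin d)

/-! ### Objectives -/

/-- `f_i(x) = 𝔼_{ξ ∼ D_i} F_i(x; ξ)`. -/
def localObj {d N : ℕ} {Ξ : Type*} [MeasurableSpace Ξ]
    (F : Fin N → Vec d → Ξ → ℝ) (D : Fin N → Measure Ξ) (i : Fin N) (x : Vec d) : ℝ :=
  ∫ ξ, F i x ξ ∂(D i)

/-- `f(x) = (1/N) ∑_i f_i(x)`. -/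
def globalObj {d N : ℕ} {Ξ : Type*} [MeasurableSpace Ξ]
    (F : Fin N → Vec d → Ξ → ℝ) (D : Fin N → Measure Ξ) (x : Vec d) : ℝ :=
  (1 / (N : ℝ)) * ∑ i, localObj F D i x

/-- The stochastic gradient `∇F_i(x; ξ)` (gradient in `x`). -/
def stochGrad {d N : ℕ} {Ξ : Type*}
    (F : Fin N → Vec d → Ξ → ℝ) (i : Fin N) (x : Vec d) (ξ : Ξ) : Vec d :=
  gradient (fun y => F i y ξ) x

/-- Assumptions on the objectives. The first three fields only make `f_i = 𝔼 F_i` and `∇F_i`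
meaningful; the other ones are the bounded initial gap, the `L`-smoothness of every `f_i`, and the
bounded variance of the stochastic gradients. -/
structure ObjAssumption {d N : ℕ} {Ξ : Type*} [MeasurableSpace Ξ]
    (F : Fin N → Vec d → Ξ → ℝ) (D : Fin N → Measure Ξ) (x₀ : Vec d) (Δ L σ : ℝ) : Prop where
  integrable : ∀ i x, Integrable (fun ξ => F i x ξ) (D i)
  differentiable : ∀ i ξ, Differentiable ℝ (fun x => F i x ξ)
  measurable_grad : ∀ i, Measurable (fun a : Vec d × Ξ => stochGrad F i a.1 a.2)
  gap : ∀ x, globalObj F D x₀ - globalObj F D x ≤ Δ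
  differentiable_local : ∀ i, Differentiable ℝ (localObj F D i)
  smooth : ∀ i x y,
    ‖gradient (localObj F D i) x - gradient (localObj F D i) y‖ ≤ L * ‖x - y‖
  variance : ∀ i x,
    Integrable (fun ξ => ‖stochGrad F i x ξ - gradient (localObj F D i) x‖ ^ 2) (D i) ∧
      ∫ ξ, ‖stochGrad F i x ξ - gradient (localObj F D i) x‖ ^ 2 ∂(D i) ≤ σ ^ 2

/-! ### The algorithm (for a fixed realisation of weights and stochastic gradients) -/

/-- Memory of Amplified SCAFFOLD at the beginning of a round. -/
structure State (d N : ℕ) where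
  /-- current server model `x̄_r` -/
  x : Vec d
  /-- server model `x̄_{r₀}` at the beginning of the current window -/
  anchor : Vec d
  /-- accumulated weighted local updates of the current window -/
  u : Vec d
  /-- control variates `G^i_{r₀}` -/
  G : Fin N → Vec d
  /-- `∑_s q_s^i ∑_k ∇F_i(x_{s,k}^i; ξ_{s,k}^i)` over the past rounds of the current window -/
  acc : Fin N → Vec d
  /-- `∑_s q_s^i` over the past rounds of the current window -/
  wt : Fin N → ℝ

/-- `k` local steps `x ← x - η (∇F_i(x; ξ_k) - G^i + G)`; here `g k = ∇F_i(·; ξ_k)`. -/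
def localIter {d : ℕ} (η : ℝ) (g : ℕ → Vec d → Vec d) (Gi Gbar x : Vec d) : ℕ → Vec d
  | 0 => x
  | k + 1 =>
    localIter η g Gi Gbar x k - η • (g k (localIter η g Gi Gbar x k) - Gi + Gbar)

/-- One communication round `r`, with weights `q i = q_r^i` and `g i k = ∇F_i(·; ξ_{r,k}^i)`.
Every client starts from the current server model and the server averages the local updates. At the
end of every window of `P` rounds the update of the window is amplified by `γ`, and the control
variate of every client that participated in the window is replaced by the weighted average of its
stochastic gradients in that window. -/
def roundStep {d N : ℕ} (I P : ℕ) (η γ : ℝ) (q : Fin N → ℝ) (g : Fin N → ℕ → Vec d → Vec d)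
    (r : ℕ) (st : State d N) : State d N :=
  let Gbar : Vec d := (1 / (N : ℝ)) • ∑ j, st.G j
  let y : Fin N → ℕ → Vec d := fun i => localIter η (g i) (st.G i) Gbar st.x
  let step : Vec d := ∑ i, q i • (y i I - st.x)
  let u' : Vec d := st.u + step
  let acc' : Fin N → Vec d := fun i => st.acc i + q i • ∑ k ∈ Finset.range I, g i k (y i k)
  let wt' : Fin N → ℝ := fun i => st.wt i + q i
  if P ∣ r + 1 then
    { x := st.anchor + γ • u'
      anchor := st.anchor + γ • u'
      u := 0
      G := fun i => if 0 < wt' i then (1 / (wt' i * I)) • acc' i else st.G i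
      acc := fun _ => 0
      wt := fun _ => 0 }
  else
    { x := st.x + step
      anchor := st.anchor
      u := u'
      G := st.G
      acc := acc'
      wt := wt' }

/-- State at the beginning of round `r`, from the model `x₀` and control variates `G₀`. -/
def run {d N : ℕ} (I P : ℕ) (η γ : ℝ) (x₀ : Vec d) (G₀ : Fin N → Vec d)
    (q : ℕ → Fin N → ℝ) (g : ℕ → Fin N → ℕ → Vec d → Vec d) : ℕ → State d N
  | 0 => ⟨x₀, x₀, 0, G₀, fun _ => 0, fun _ => 0⟩
  | r + 1 => roundStep I P η γ (q r) (g r) r (run I P η γ x₀ G₀ q g r)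

/-- Initial control variates: the average of the `I * P` stochastic gradients of a preliminary
window, all of them taken at the initial model `x₀`. -/
def initControl {d N : ℕ} {Ω Ξ : Type*} (F : Fin N → Vec d → Ξ → ℝ) (I P : ℕ) (x₀ : Vec d)
    (ξ₀ : ℕ → ℕ → Fin N → Ω → Ξ) (ω : Ω) (i : Fin N) : Vec d :=
  (1 / ((I : ℝ) * P)) •
    ∑ s ∈ Finset.range P, ∑ k ∈ Finset.range I, stochGrad F i x₀ (ξ₀ s k i ω)

/-- The random server model `x̄_r` produced by Amplified SCAFFOLD. -/
def model {d N : ℕ} {Ω Ξ : Type*} (F : Fin N → Vec d → Ξ → ℝ) (I P : ℕ) (η γ : ℝ) (x₀ : Vec d)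
    (q : ℕ → Fin N → Ω → ℝ) (ξ₀ ξ : ℕ → ℕ → Fin N → Ω → Ξ) (r : ℕ) (ω : Ω) : Vec d :=
  (run I P η γ x₀ (initControl F I P x₀ ξ₀ ω) (fun s i => q s i ω)
    (fun s i k x => stochGrad F i x (ξ s k i ω)) r).x

/-! ### Participation -/

/-- `q̄^i`, the average weight of client `i` over window `m`, i.e. rounds `mP, …, (m+1)P - 1`. -/
def qbar {N : ℕ} {Ω : Type*} (q : ℕ → Fin N → Ω → ℝ) (P m : ℕ) (i : Fin N) (ω : Ω) : ℝ :=
  (1 / (P : ℝ)) * ∑ s ∈ Finset.range P, q (m * P + s) i ω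

/-- `z^i` at position `s` of the window preceding window `m`: the weight with which the control
variate used in window `m` was formed, i.e. the weight of client `i` at position `s` of its last
window of participation before window `m`; constant if there is none (the initial control variate
is a uniform average). -/
def zWeight {N : ℕ} {Ω : Type*} (q : ℕ → Fin N → Ω → ℝ) (P : ℕ) :
    ℕ → Fin N → Ω → ℕ → ℝ
  | 0, _, _, _ => 1
  | m + 1, i, ω, s =>
    if 0 < qbar q P m i ω then q (m * P + s) i ω else zWeight q P m i ω s

/-- `Λ^i` for window `m`. -/
def Lam {N : ℕ} {Ω : Type*} (q : ℕ → Fin N → Ω → ℝ) (P m : ℕ) (i : Fin N) (ω : Ω) : ℝ :=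
  ((1 / (P : ℝ)) * ∑ s ∈ Finset.range P, zWeight q P m i ω s ^ 2) /
    ((1 / (P : ℝ)) * ∑ s ∈ Finset.range P, zWeight q P m i ω s) ^ 2

/-- `v^i = q̄^i - 1/N` for window `m`. -/
def vDev {N : ℕ} {Ω : Type*} (q : ℕ → Fin N → Ω → ℝ) (P m : ℕ) (i : Fin N) (ω : Ω) : ℝ :=
  qbar q P m i ω - 1 / (N : ℝ)

/-- `w^i = (1/N) ∑_j 1{q̄^j > 0} / (P q̄^j) ∑_s q_s^i q_s^j` for window `m`. -/
def wNonunif {N : ℕ} {Ω : Type*} (q : ℕ → Fin N → Ω → ℝ) (P m : ℕ) (i : Fin N) (ω : Ω) : ℝ :=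
  (1 / (N : ℝ)) * ∑ j, if 0 < qbar q P m j ω then
    (1 / ((P : ℝ) * qbar q P m j ω)) *
      ∑ s ∈ Finset.range P, q (m * P + s) i ω * q (m * P + s) j ω
  else 0

/-- The σ-algebra generated by the participation weights of the rounds before round `r`. -/
abbrev pastQ {N : ℕ} {Ω : Type*} (q : ℕ → Fin N → Ω → ℝ) (r : ℕ) : MeasurableSpace Ω :=
  ⨆ s : Fin r, ⨆ i : Fin N, MeasurableSpace.comap (q s i) inferInstance

/-- All data samples that are drawn: those of the preliminary window and those of the `R` rounds. -/
def samples {N : ℕ} {Ω Ξ : Type*} (R I P : ℕ) (ξ₀ ξ : ℕ → ℕ → Fin N → Ω → Ξ)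
    (j : (Fin P ⊕ Fin R) × Fin I × Fin N) (ω : Ω) : Ξ :=
  Sum.elim (fun s : Fin P => ξ₀ s j.2.1 j.2.2 ω) (fun r : Fin R => ξ r j.2.1 j.2.2 ω) j.1

/-- The data samples are independent, and every sample of client `i` has law `D_i`. -/
structure SampleAssumption {N : ℕ} {Ω Ξ : Type*} [MeasurableSpace Ω] [MeasurableSpace Ξ]
    (μ : Measure Ω) (D : Fin N → Measure Ξ) (R I P : ℕ)
    (ξ₀ ξ : ℕ → ℕ → Fin N → Ω → Ξ) : Prop where
  measurable : ∀ j, Measurable (samples R I P ξ₀ ξ j)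
  law : ∀ j, μ.map (samples R I P ξ₀ ξ j) = D j.2.2
  indep : iIndepFun (samples R I P ξ₀ ξ) μ

/-- Assumptions on client participation: normalised nonnegative weights with
`∑_i (q_r^i)² ≤ ρ²`; conditionally on the earlier windows, participation in every window is
unbiased across clients, and every client participates with probability at least `p`; the weights
are independent of the data samples. -/
structure ParticipationAssumption {N : ℕ} {Ω Ξ : Type*} [MeasurableSpace Ω] [MeasurableSpace Ξ]
    (μ : Measure Ω) (R I P : ℕ) (ρ p : ℝ) (q : ℕ → Fin N → Ω → ℝ)
    (ξ₀ ξ : ℕ → ℕ → Fin N → Ω → Ξ) : Prop where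
  measurable : ∀ r < R, ∀ i, Measurable (q r i)
  nonneg : ∀ r < R, ∀ᵐ ω ∂μ, ∀ i, 0 ≤ q r i ω
  sum_eq_one : ∀ r < R, ∀ᵐ ω ∂μ, ∑ i, q r i ω = 1
  sum_sq_le : ∀ r < R, ∀ᵐ ω ∂μ, ∑ i, q r i ω ^ 2 ≤ ρ ^ 2
  unbiased : ∀ m < R / P, ∀ i,
    μ[qbar q P m i | pastQ q (m * P)] =ᵐ[μ] fun _ => 1 / (N : ℝ)
  sampled : ∀ m < R / P, ∀ i,
    ∀ᵐ ω ∂μ, p ≤ (μ⟦{ω | 0 < qbar q P m i ω} | pastQ q (m * P)⟧) ω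
  indep : IndepFun (fun ω (j : Fin R × Fin N) => q j.1 j.2 ω)
    (fun ω j => samples R I P ξ₀ ξ j ω) μ

/-- `𝔼[w^i] ≤ P²/N` and `𝔼[∑_i (v^i)² Λ^i] ≤ ρ²` for every window. -/
structure RegularityCondition {N : ℕ} {Ω : Type*} [MeasurableSpace Ω]
    (μ : Measure Ω) (R P : ℕ) (ρ : ℝ) (q : ℕ → Fin N → Ω → ℝ) : Prop where
  w_le : ∀ m < R / P, ∀ i, ∫ ω, wNonunif q P m i ω ∂μ ≤ (P : ℝ) ^ 2 / N
  v_le : ∀ m < R / P, ∫ ω, ∑ i, vDev q P m i ω ^ 2 * Lam q P m i ω ∂μ ≤ ρ ^ 2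

/-- The squared gradient norms `‖∇f(x̄_{r₀})‖²`, `r₀ ∈ {0, P, …, R - P}`, are integrable and
`(P/R) ∑_{r₀} 𝔼 ‖∇f(x̄_{r₀})‖² ≤ B`. -/
def AvgGradBound {d : ℕ} {Ω : Type*} [MeasurableSpace Ω] (μ : Measure Ω) (f : Vec d → ℝ)
    (x : ℕ → Ω → Vec d) (R P : ℕ) (B : ℝ) : Prop :=
  (∀ m < R / P, Integrable (fun ω => ‖gradient f (x (m * P) ω)‖ ^ 2) μ) ∧
    (P : ℝ) / R * ∑ m ∈ Finset.range (R / P), ∫ ω, ‖gradient f (x (m * P) ω)‖ ^ 2 ∂μ ≤ B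

end AmplifiedScaffold

end

open AmplifiedScaffold

section

set_option linter.unusedSectionVars false

open Filter Topology
open scoped ENNReal RealInnerProductSpace

namespace AmplifiedScaffold

/-! Put α = γηPI. Over one window the server model at the window start, X, moves by -α times a
direction equal to ∇f(X), plus the averaged gradient noise, plus the change of the local gradients
while the models drift, minus the bias ∑_i (q̄^i - 1/N)(G^i - ∇f_i(X)) (`X_succ_eq`). Since G^i is
only ever compared with ∇f_i, the differences ∇f_i - ∇f never occur, and data heterogeneity drops
out.

Noise and bias are orthogonal in mean to ∇f(X), by two different conditionings. Given all weights
and all samples but one, the remaining sample is still fresh, so its gradient noise is centred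
(`otherAlg`). Given the earlier weights and all samples, the weights of the window are still
unbiased, because weights and samples are independent (`windowAlg`). Hence the descent lemma, summed
over the windows, bounds the total squared gradient by Δ/α, the drift, and Lα times the second
moment of the direction.

Three estimates close the argument. Noise: a combination of gradient noises whose coefficients
depend on the weights only has second moment at most σ² times the mean sum of squared coefficients
(`integral_sq_sum_gradNoise_le`). This gives ρ²σ²/(PI) for the noise of the current window and,
through Λ, for the noise stored in the control variates, which `G_eq_add` separates from their
noiseless part. Drift: on every path the distance of the local models from X obeys a linear
inequality in itself, which a small η makes contractive (`WindowDynamics`). Staleness: the noiseless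
control variate of a client is refreshed with conditional probability at least p, up to drift;
otherwise it only ages by the motion of X. Its mean squared error contracts by 1 - p/2 per window
(`meanStale_succ_le`), and it starts at zero because all initial gradients are taken at x₀.

Summed over the windows, these are linear inequalities with small feedback coefficients.
`resolve_bounds` solves them: the average squared gradient is at most 135(A + B), with A = √(ΔL)
ρσ/√(IR) and B = ΔLP/(pR). The lower bound on R makes A ≤ ε² and B ≤ ε²/300.

Unbiasedness of the stochastic gradients is not assumed: it follows from the variance bound, because
that bound holds at every point (`unbiased_of_variance`). -/

/-! ### Smooth objectives: the descent lemma and unbiased stochastic gradients -/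

lemma hasDerivAt_line {d : ℕ} {f : Vec d → ℝ} (hf : Differentiable ℝ f) (x v : Vec d) (t : ℝ) :
    HasDerivAt (fun s : ℝ => f (x + s • v)) ⟪gradient f (x + t • v), v⟫ t := by
  have h1 : HasFDerivAt f (fderiv ℝ f (x + t • v)) (x + t • v) := (hf _).hasFDerivAt
  have h2 : HasDerivAt (fun s : ℝ => x + s • v) v t := by
    simpa using ((hasDerivAt_id t).smul_const v).const_add x
  have := h1.comp_hasDerivAt t h2
  rw [inner_gradient_left]
  exact this

/-- The descent lemma. -/
lemma descent {d : ℕ} {f : Vec d → ℝ} {L : ℝ} (hf : Differentiable ℝ f)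
    (hL : ∀ x y, ‖gradient f x - gradient f y‖ ≤ L * ‖x - y‖) (x v : Vec d) :
    f (x + v) ≤ f x + ⟪gradient f x, v⟫ + L / 2 * ‖v‖ ^ 2 := by
  have hd : ∀ t : ℝ, HasDerivAt
      (fun s : ℝ => f (x + s • v) - s * ⟪gradient f x, v⟫ - s ^ 2 * (L / 2 * ‖v‖ ^ 2))
      (⟪gradient f (x + t • v), v⟫ - ⟪gradient f x, v⟫ - 2 * t * (L / 2 * ‖v‖ ^ 2)) t := by
    intro t
    have h := ((hasDerivAt_line hf x v t).sub
      ((hasDerivAt_id t).mul_const ⟪gradient f x, v⟫)).sub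
        ((hasDerivAt_pow 2 t).mul_const (L / 2 * ‖v‖ ^ 2))
    refine h.congr_deriv ?_
    simp
  have hanti := antitoneOn_of_deriv_nonpos (convex_Icc (0 : ℝ) 1)
    (fun t _ => (hd t).continuousAt.continuousWithinAt)
    (fun t _ => (hd t).differentiableAt.differentiableWithinAt)
    (fun t ht => by
      rw [interior_Icc] at ht
      rw [(hd t).deriv, ← inner_sub_left]
      have h1 := real_inner_le_norm (gradient f (x + t • v) - gradient f x) v
      have h2 := hL (x + t • v) x
      rw [add_sub_cancel_left, norm_smul, Real.norm_eq_abs, abs_of_pos ht.1] at h2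
      nlinarith [norm_nonneg v])
  have := hanti (Set.left_mem_Icc.2 zero_le_one) (Set.right_mem_Icc.2 zero_le_one) zero_le_one
  simp only [one_smul, zero_smul, add_zero] at this
  linarith

/-- Cauchy–Schwarz after the fundamental theorem of calculus. Working in `ℝ≥0∞` avoids any
integrability hypothesis: if φ' is not square integrable the right side is infinite, and otherwise
φ' is integrable, which suffices for an everywhere differentiable function. -/
lemma sq_enorm_sub_le_lintegral {φ φ' : ℝ → ℝ} (h : ∀ t, HasDerivAt φ (φ' t) t) :
    ‖φ 1 - φ 0‖ₑ ^ 2 ≤ ∫⁻ t in Set.Ioc (0 : ℝ) 1, ‖φ' t‖ₑ ^ 2 := by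
  have hφ' : φ' = deriv φ := funext fun t => (h t).deriv.symm
  have hm : Measurable φ' := hφ' ▸ measurable_deriv φ
  set ν : Measure ℝ := volume.restrict (Set.Ioc (0 : ℝ) 1)
  have : IsProbabilityMeasure ν := ⟨by simp [ν]⟩
  by_cases htop : ∫⁻ t, ‖φ' t‖ₑ ^ 2 ∂ν = ⊤
  · rw [htop]; exact le_top
  have e2 : ∫⁻ t, ‖φ' t‖ₑ ^ 2 ∂ν = eLpNorm φ' 2 ν ^ 2 := by
    rw [eLpNorm_eq_lintegral_rpow_enorm_toReal (by norm_num) (by norm_num)]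
    simp only [ENNReal.toReal_ofNat, ENNReal.rpow_ofNat, one_div]
    rw [← ENNReal.rpow_natCast, ← ENNReal.rpow_mul]
    simp
  have hmem : MemLp φ' 2 ν := by
    refine ⟨hm.aestronglyMeasurable, ?_⟩
    rw [lt_top_iff_ne_top]
    intro h0
    rw [e2, h0] at htop
    simp at htop
  have hint : Integrable φ' ν := hmem.integrable (by norm_num)
  have hftc : ∫ t in (0 : ℝ)..1, φ' t = φ 1 - φ 0 :=
    intervalIntegral.integral_eq_sub_of_hasDerivAt (fun t _ => h t)
      ((intervalIntegrable_iff_integrableOn_Ioc_of_le zero_le_one).2 hint)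
  rw [intervalIntegral.integral_of_le zero_le_one] at hftc
  have h1 : ‖φ 1 - φ 0‖ₑ ≤ eLpNorm φ' 1 ν := by
    rw [← hftc, eLpNorm_one_eq_lintegral_enorm]
    exact enorm_integral_le_lintegral_enorm _
  have h2 : eLpNorm φ' 1 ν ≤ eLpNorm φ' 2 ν :=
    eLpNorm_le_eLpNorm_of_exponent_le (by norm_num) hm.aestronglyMeasurable
  calc ‖φ 1 - φ 0‖ₑ ^ 2 ≤ (eLpNorm φ' 2 ν) ^ 2 := by gcongr; exact h1.trans h2
    _ = _ := e2.symm

/-- A sequence that is bounded in `L²` and tends to `0` almost everywhere has vanishing means. -/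
lemma tendsto_integral_zero_of_sq_bounded {Ξ : Type*} [MeasurableSpace Ξ] {D : Measure Ξ}
    [IsProbabilityMeasure D] {z : ℕ → Ξ → ℝ} {K : ℝ} (hz : ∀ n, MemLp (z n) 2 D)
    (hK : ∀ n, ∫ ξ, z n ξ ^ 2 ∂D ≤ K) (h0 : ∀ᵐ ξ ∂D, Tendsto (fun n => z n ξ) atTop (𝓝 0)) :
    Tendsto (fun n => ∫ ξ, z n ξ ∂D) atTop (𝓝 0) := by
  have hK0 : 0 ≤ K := (integral_nonneg fun _ => sq_nonneg _).trans (hK 0)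
  have hi : ∀ n, Integrable (z n) D := fun n => (hz n).integrable (by norm_num)
  rw [Metric.tendsto_atTop]
  intro ε hε
  -- Truncation level: the part of |z| above M costs at most z²/M, whose mean is at most K/M ≤ ε/2;
  -- the truncated part is handled by dominated convergence.
  set M : ℝ := 2 * K / ε + 1 with hM
  have hM0 : 0 < M := by positivity
  have ht : Tendsto (fun n => ∫ ξ, min |z n ξ| M ∂D) atTop (𝓝 (∫ _, (0 : ℝ) ∂D)) := by
    refine tendsto_integral_of_dominated_convergence (fun _ => M) (fun n => ?_)
      (integrable_const _) (fun n => ?_) ?_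
    · exact ((hi n).abs.aestronglyMeasurable).inf aestronglyMeasurable_const
    · refine Eventually.of_forall fun ξ => ?_
      rw [Real.norm_eq_abs, abs_of_nonneg (le_min (abs_nonneg _) hM0.le)]
      exact min_le_right _ _
    · filter_upwards [h0] with ξ hξ
      have := (hξ.abs).min (tendsto_const_nhds (x := M))
      simpa [min_eq_left hM0.le] using this
  rw [integral_zero, Metric.tendsto_atTop] at ht
  obtain ⟨n0, hn0⟩ := ht (ε / 2) (by positivity)
  refine ⟨n0, fun n hn => ?_⟩
  have h1 := hn0 n hn
  rw [Real.dist_eq, sub_zero] at h1 ⊢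
  have hmin : Integrable (fun ξ => min |z n ξ| M) D := (hi n).abs.inf (integrable_const _)
  calc |∫ ξ, z n ξ ∂D| ≤ ∫ ξ, |z n ξ| ∂D := abs_integral_le_integral_abs
    _ ≤ ∫ ξ, (min |z n ξ| M + z n ξ ^ 2 / M) ∂D := by
        refine integral_mono (hi n).abs (hmin.add ((hz n).integrable_sq.div_const M)) fun ξ => ?_
        dsimp only
        rcases le_total |z n ξ| M with h | h
        · rw [min_eq_left h]; have : 0 ≤ z n ξ ^ 2 / M := by positivity
          linarith
        · have : |z n ξ| ≤ z n ξ ^ 2 / M := by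
            rw [le_div_iff₀ hM0, ← sq_abs]; nlinarith [abs_nonneg (z n ξ)]
          have : 0 ≤ min |z n ξ| M := le_min (abs_nonneg _) hM0.le
          linarith
    _ = ∫ ξ, min |z n ξ| M ∂D + (∫ ξ, z n ξ ^ 2 ∂D) / M := by
        rw [integral_add hmin ((hz n).integrable_sq.div_const M), integral_div]
    _ < ε := by
        have h2 : (∫ ξ, z n ξ ^ 2 ∂D) / M ≤ ε / 2 := by
          rw [div_le_iff₀ hM0]
          refine (hK n).trans ?_
          rw [hM]; field_simp; nlinarith
        have := abs_lt.1 h1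
        linarith

/-- Stochastic gradients of bounded variance around `∇f` are unbiased. -/
lemma unbiased_of_variance {d : ℕ} {Ξ : Type*} [MeasurableSpace Ξ] {D : Measure Ξ}
    [IsProbabilityMeasure D] {F : Vec d → Ξ → ℝ} {f : Vec d → ℝ} {σ : ℝ}
    (hf : ∀ x, f x = ∫ ξ, F x ξ ∂D)
    (hint : ∀ x, Integrable (F x) D) (hF : ∀ ξ, Differentiable ℝ fun x => F x ξ)
    (hm : Measurable fun a : Vec d × Ξ => gradient (fun y => F y a.2) a.1)
    (hfd : Differentiable ℝ f) (hfc : Continuous (gradient f))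
    (hvar : ∀ x, Integrable (fun ξ => ‖gradient (fun y => F y ξ) x - gradient f x‖ ^ 2) D ∧
      ∫ ξ, ‖gradient (fun y => F y ξ) x - gradient f x‖ ^ 2 ∂D ≤ σ ^ 2) (x : Vec d) :
    MemLp (fun ξ => gradient (fun y => F y ξ) x) 2 D ∧
      ∫ ξ, gradient (fun y => F y ξ) x ∂D = gradient f x := by
  set G : Vec d → Ξ → Vec d := fun x ξ => gradient (fun y => F y ξ) x with hG
  have hGm : ∀ x, Measurable (G x) := fun x => hm.comp measurable_prodMk_left
  have hGc : ∀ x, MemLp (fun ξ => G x ξ - gradient f x) 2 D := fun x =>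
    (memLp_two_iff_integrable_sq_norm ((hGm x).sub_const _).aestronglyMeasurable).2 (hvar x).1
  have hG2 : ∀ x, MemLp (G x) 2 D := fun x => by
    have h := (hGc x).add (memLp_const (gradient f x))
    have e : (fun ξ => G x ξ - gradient f x) + (fun _ => gradient f x) = G x := by
      funext ξ; simp
    rwa [e] at h
  refine ⟨hG2 x, ?_⟩
  refine ext_inner_right ℝ fun v => ?_
  have hGi : ∀ x, Integrable (G x) D := fun x => (hG2 x).integrable (by norm_num)
  have hswap : ⟪∫ ξ, G x ξ ∂D, v⟫ = ∫ ξ, ⟪G x ξ, v⟫ ∂D := by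
    rw [real_inner_comm, ← integral_inner (hGi x)]
    simp_rw [real_inner_comm]
  rw [hswap]
  -- bound on `∇f` on the segment
  obtain ⟨B, hB⟩ : ∃ B, ∀ t ∈ Set.Icc (0 : ℝ) 1, ‖gradient f (x + t • v)‖ ≤ B := by
    have hc : ContinuousOn (fun t : ℝ => ‖gradient f (x + t • v)‖) (Set.Icc 0 1) := by
      fun_prop
    obtain ⟨B, hB⟩ := isCompact_Icc.bddAbove_image hc
    exact ⟨B, fun t ht => hB ⟨t, ht, rfl⟩⟩
  have hB0 : 0 ≤ B := (norm_nonneg _).trans (hB 0 (by simp))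
  -- Bound on the second moment of the directional derivative along the whole segment: variance plus
  -- squared mean gradient, with the factor 2 from splitting the square.
  set K : ℝ := 2 * (σ ^ 2 + B ^ 2) * ‖v‖ ^ 2 with hKdef
  have hK0 : 0 ≤ K := by positivity
  have hsec : ∀ t ∈ Set.Icc (0 : ℝ) 1,
      ∫⁻ ξ, ‖⟪G (x + t • v) ξ, v⟫‖ₑ ^ 2 ∂D ≤ ENNReal.ofReal K := by
    intro t ht
    have hl : MemLp (fun ξ => ⟪G (x + t • v) ξ, v⟫) 2 D := (hG2 _).inner_const v
    have e : ∀ ξ, ‖⟪G (x + t • v) ξ, v⟫‖ₑ ^ 2 = ENNReal.ofReal (⟪G (x + t • v) ξ, v⟫ ^ 2) := by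
      intro ξ
      rw [← ofReal_norm, ← ENNReal.ofReal_pow (norm_nonneg _), Real.norm_eq_abs, sq_abs]
    simp_rw [e]
    rw [← ofReal_integral_eq_lintegral_ofReal hl.integrable_sq
      (Eventually.of_forall fun _ => sq_nonneg _)]
    refine ENNReal.ofReal_le_ofReal ?_
    calc ∫ ξ, ⟪G (x + t • v) ξ, v⟫ ^ 2 ∂D
        ≤ ∫ ξ, (2 * ‖G (x + t • v) ξ - gradient f (x + t • v)‖ ^ 2 + 2 * B ^ 2) * ‖v‖ ^ 2 ∂D := by
          refine integral_mono hl.integrable_sq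
            (((((hvar _).1.const_mul 2).add (integrable_const _))).mul_const _) fun ξ => ?_
          have h1 := abs_real_inner_le_norm (G (x + t • v) ξ) v
          have h2 : ‖G (x + t • v) ξ‖ ≤ ‖G (x + t • v) ξ - gradient f (x + t • v)‖ + B := by
            have := norm_add_le (G (x + t • v) ξ - gradient f (x + t • v))
              (gradient f (x + t • v))
            rw [sub_add_cancel] at this
            linarith [hB t ht]
          dsimp only
          have h3 : ‖G (x + t • v) ξ‖ ^ 2 ≤
              2 * ‖G (x + t • v) ξ - gradient f (x + t • v)‖ ^ 2 + 2 * B ^ 2 := by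
            refine (pow_le_pow_left₀ (norm_nonneg _) h2 2).trans ?_
            nlinarith [sq_nonneg (‖G (x + t • v) ξ - gradient f (x + t • v)‖ - B)]
          calc ⟪G (x + t • v) ξ, v⟫ ^ 2 ≤ (‖G (x + t • v) ξ‖ * ‖v‖) ^ 2 := by
                rw [← sq_abs]; exact pow_le_pow_left₀ (abs_nonneg _) h1 2
            _ ≤ _ := by rw [mul_pow]; gcongr
      _ = (2 * ∫ ξ, ‖G (x + t • v) ξ - gradient f (x + t • v)‖ ^ 2 ∂D + 2 * B ^ 2) * ‖v‖ ^ 2 := by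
          rw [integral_mul_const, integral_add ((hvar _).1.const_mul 2) (integrable_const _),
            integral_const_mul]
          simp [hG]
      _ ≤ K := by
          rw [hKdef]
          have := (hvar (x + t • v)).2
          have hv : 0 ≤ ‖v‖ ^ 2 := by positivity
          nlinarith
  -- difference quotients
  set h : ℕ → ℝ := fun n => 1 / ((n : ℝ) + 1) with hh
  have hpos : ∀ n, 0 < h n := fun n => by simp only [hh]; positivity
  have hle : ∀ n, h n ≤ 1 := fun n => by
    simp only [hh]; rw [div_le_one (by positivity)]; linarith [(Nat.cast_nonneg n : (0 : ℝ) ≤ n)]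
  have hlim : Tendsto h atTop (𝓝[≠] 0) :=
    tendsto_nhdsWithin_iff.2 ⟨tendsto_one_div_add_atTop_nhds_zero_nat,
      Eventually.of_forall fun n => (hpos n).ne'⟩
  set ψ : ℕ → Ξ → ℝ := fun n ξ => (h n)⁻¹ * (F (x + h n • v) ξ - F x ξ) with hψ
  have hψi : ∀ n, Integrable (ψ n) D := fun n => ((hint _).sub (hint _)).const_mul _
  have hψ2 : ∀ n, ∫⁻ ξ, ‖ψ n ξ‖ₑ ^ 2 ∂D ≤ ENNReal.ofReal K := by
    intro n
    -- The difference quotient is the increment over [0,1] of t ↦ F(x + t h v)/h, whose derivative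
    -- is the directional derivative without a factor h. Its square is thus at most an average of
    -- squares, and Tonelli transfers the bound K.
    have hpt : ∀ ξ, ‖ψ n ξ‖ₑ ^ 2 ≤
        ∫⁻ t in Set.Ioc (0 : ℝ) 1, ‖⟪G (x + (t * h n) • v) ξ, v⟫‖ₑ ^ 2 := by
      intro ξ
      have hd : ∀ t : ℝ, HasDerivAt (fun t : ℝ => (h n)⁻¹ * F (x + (t * h n) • v) ξ)
          ⟪G (x + (t * h n) • v) ξ, v⟫ t := by
        intro t
        have h1 := hasDerivAt_line (hF ξ) x v (t * h n)
        have h2 : HasDerivAt (fun t : ℝ => t * h n) (h n) t := by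
          simpa using (hasDerivAt_id t).mul_const (h n)
        have h3 := (HasDerivAt.comp t h1 h2).const_mul (h n)⁻¹
        refine h3.congr_deriv ?_
        have := (hpos n).ne'
        simp only [hG]
        field_simp
      have := sq_enorm_sub_le_lintegral hd
      simp only [one_mul, zero_mul, zero_smul, add_zero, ← mul_sub] at this
      exact this
    calc ∫⁻ ξ, ‖ψ n ξ‖ₑ ^ 2 ∂D
        ≤ ∫⁻ ξ, (∫⁻ t in Set.Ioc (0 : ℝ) 1, ‖⟪G (x + (t * h n) • v) ξ, v⟫‖ₑ ^ 2) ∂D :=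
          lintegral_mono hpt
      _ = ∫⁻ t in Set.Ioc (0 : ℝ) 1, (∫⁻ ξ, ‖⟪G (x + (t * h n) • v) ξ, v⟫‖ₑ ^ 2 ∂D) := by
          refine lintegral_lintegral_swap (Measurable.aemeasurable ?_)
          have : Measurable fun a : Ξ × ℝ => G (x + (a.2 * h n) • v) a.1 := by
            refine hm.comp (Measurable.prodMk ?_ measurable_fst)
            fun_prop
          exact ((this.inner_const (c := v)).enorm).pow_const 2
      _ ≤ ∫⁻ t in Set.Ioc (0 : ℝ) 1, ENNReal.ofReal K := by
          refine setLIntegral_mono measurable_const fun t ht => hsec _ ⟨?_, ?_⟩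
          · exact mul_nonneg ht.1.le (hpos n).le
          · exact mul_le_one₀ ht.2 (hpos n).le (hle n)
      _ = ENNReal.ofReal K := by simp
  have hψL : ∀ n, MemLp (ψ n) 2 D := by
    intro n
    refine (memLp_two_iff_integrable_sq (hψi n).aestronglyMeasurable).2
      ⟨(hψi n).aestronglyMeasurable.pow 2, ?_⟩
    refine lt_of_le_of_lt (le_of_eq ?_) ((hψ2 n).trans_lt ENNReal.ofReal_lt_top)
    simp_rw [enorm_pow]
  have hψK : ∀ n, ∫ ξ, ψ n ξ ^ 2 ∂D ≤ K := by
    intro n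
    rw [← ENNReal.ofReal_le_ofReal_iff hK0, ofReal_integral_eq_lintegral_ofReal (hψL n).integrable_sq
      (Eventually.of_forall fun _ => sq_nonneg _)]
    refine le_trans (le_of_eq ?_) (hψ2 n)
    refine lintegral_congr fun ξ => ?_
    rw [← ofReal_norm, ← ENNReal.ofReal_pow (norm_nonneg _), Real.norm_eq_abs, sq_abs]
  have hx2 : MemLp (fun ξ => ⟪G x ξ, v⟫) 2 D := (hG2 _).inner_const v
  -- The difference quotients converge for every ξ and are bounded in L², so their means converge
  -- although no dominating function is available. The means are difference quotients of f.
  have hz := tendsto_integral_zero_of_sq_bounded (D := D) (z := fun n ξ => ψ n ξ - ⟪G x ξ, v⟫)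
    (K := 2 * K + 2 * ∫ ξ, ⟪G x ξ, v⟫ ^ 2 ∂D) (fun n => (hψL n).sub hx2) (fun n => by
      calc ∫ ξ, (ψ n ξ - ⟪G x ξ, v⟫) ^ 2 ∂D
          ≤ ∫ ξ, (2 * ψ n ξ ^ 2 + 2 * ⟪G x ξ, v⟫ ^ 2) ∂D := by
            refine integral_mono ((hψL n).sub hx2).integrable_sq
              (((hψL n).integrable_sq.const_mul 2).add (hx2.integrable_sq.const_mul 2)) fun ξ => ?_
            dsimp only
            nlinarith [sq_nonneg (ψ n ξ + ⟪G x ξ, v⟫)]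
        _ ≤ _ := by
            rw [integral_add ((hψL n).integrable_sq.const_mul 2) (hx2.integrable_sq.const_mul 2),
              integral_const_mul, integral_const_mul]
            linarith [hψK n])
    (Eventually.of_forall fun ξ => by
      have h1 := (hasDerivAt_line (hF ξ) x v 0).tendsto_slope_zero.comp hlim
      simp only [Function.comp_def, zero_add, zero_smul, add_zero, smul_eq_mul] at h1
      rw [← sub_self (⟪G x ξ, v⟫)]
      exact h1.sub_const _)
  have h1 := (hasDerivAt_line hfd x v 0).tendsto_slope_zero.comp hlim
  simp only [Function.comp_def, zero_add, zero_smul, add_zero, smul_eq_mul] at h1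
  have h2 : (fun n => ∫ ξ, (ψ n ξ - ⟪G x ξ, v⟫) ∂D) =
      fun n => (h n)⁻¹ * (f (x + h n • v) - f x) - ∫ ξ, ⟪G x ξ, v⟫ ∂D := by
    funext n
    rw [integral_sub (hψi n) (hx2.integrable (by norm_num)), hψ, integral_const_mul,
      integral_sub (hint _) (hint _), hf, hf]
  rw [h2] at hz
  have h3 := tendsto_nhds_unique hz (h1.sub_const _)
  linarith

lemma integrable_inner_of_memLp {Ω E : Type*} {m0 : MeasurableSpace Ω} {μ : Measure Ω}
    [NormedAddCommGroup E] [InnerProductSpace ℝ E] {f g : Ω → E}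
    (hf : MemLp f 2 μ) (hg : MemLp g 2 μ) : Integrable (fun ω => ⟪f ω, g ω⟫) μ :=
  (hf.norm.integrable_mul hg.norm).mono' (hf.1.inner hg.1)
    (Eventually.of_forall fun ω => norm_inner_le_norm (𝕜 := ℝ) (f ω) (g ω))

/-! ### Independence and conditional expectation over joins of σ-algebras -/

section SigmaAlgebras

variable {Ω : Type*} {m0 : MeasurableSpace Ω} {μ : Measure Ω}

lemma sup_eq_generateFrom_inter (m₁ m₂ : MeasurableSpace Ω) :
    m₁ ⊔ m₂ = MeasurableSpace.generateFrom
      (Set.image2 (· ∩ ·) {s | MeasurableSet[m₁] s} {s | MeasurableSet[m₂] s}) := by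
  apply le_antisymm
  · refine sup_le (fun s hs => ?_) (fun s hs => ?_)
    · exact MeasurableSpace.measurableSet_generateFrom
        ⟨s, hs, Set.univ, MeasurableSet.univ, Set.inter_univ s⟩
    · exact MeasurableSpace.measurableSet_generateFrom
        ⟨Set.univ, MeasurableSet.univ, s, hs, Set.univ_inter s⟩
  · refine MeasurableSpace.generateFrom_le ?_
    rintro _ ⟨a, ha, b, hb, rfl⟩
    exact MeasurableSet.inter (le_sup_left (a := m₁) (b := m₂) _ ha)
      (le_sup_right (a := m₁) (b := m₂) _ hb)

lemma isPiSystem_inter (m₁ m₂ : MeasurableSpace Ω) :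
    IsPiSystem (Set.image2 (· ∩ ·) {s | MeasurableSet[m₁] s} {s | MeasurableSet[m₂] s}) := by
  rintro _ ⟨a, ha, b, hb, rfl⟩ _ ⟨a', ha', b', hb', rfl⟩ _
  refine ⟨a ∩ a', MeasurableSet.inter ha ha', b ∩ b', MeasurableSet.inter hb hb', ?_⟩
  exact Set.inter_inter_inter_comm _ _ _ _

/-- The two hypotheses together say that A, B, C are independent as far as needed: on the π-system
of sets a ∩ b, the first splits off a and the second splits b from c. -/
lemma indep_sup_left {A B C : MeasurableSpace Ω} [IsProbabilityMeasure μ]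
    (hA : A ≤ m0) (hB : B ≤ m0) (hC : C ≤ m0) (h1 : Indep A (B ⊔ C) μ) (h2 : Indep B C μ) :
    Indep (A ⊔ B) C μ := by
  refine IndepSets.indep (sup_le hA hB) hC (isPiSystem_inter A B) C.isPiSystem_measurableSet
    (sup_eq_generateFrom_inter A B) C.generateFrom_measurableSet.symm ?_
  rw [IndepSets_iff]
  rintro _ c ⟨a, ha, b, hb, rfl⟩ hc
  rw [Indep_iff] at h1 h2
  have hb' : MeasurableSet[B ⊔ C] b := le_sup_left (a := B) (b := C) _ hb
  have hc' : MeasurableSet[B ⊔ C] c := le_sup_right (a := B) (b := C) _ hc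
  dsimp only
  rw [Set.inter_assoc, h1 a (b ∩ c) ha (MeasurableSet.inter hb' hc'), h2 b c hb hc, h1 a b ha hb',
    mul_assoc]

/-- The function 1_a Y is independent of S, so its conditional expectation given S is its mean,
which is then integrated over b. -/
lemma setIntegral_inter_of_indep [IsProbabilityMeasure μ] {Q S : MeasurableSpace Ω} (hQ : Q ≤ m0)
    (hS : S ≤ m0) (h : Indep Q S μ) {Y : Ω → ℝ} (hY : StronglyMeasurable[Q] Y)
    (hYi : Integrable Y μ) {a b : Set Ω} (ha : MeasurableSet[Q] a) (hb : MeasurableSet[S] b) :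
    ∫ ω in a ∩ b, Y ω ∂μ = μ.real b * ∫ ω in a, Y ω ∂μ := by
  have hYa : StronglyMeasurable[Q] (a.indicator Y) := hY.indicator ha
  have hi : Integrable (a.indicator Y) μ := hYi.indicator (hQ _ ha)
  have h1 := setIntegral_condExp hS hi hb
  have h2 := condExp_indep_eq hQ hS hYa h
  rw [setIntegral_congr_ae (hS _ hb) (h2.mono fun ω hω _ => hω), setIntegral_const,
    integral_indicator (hQ _ ha), setIntegral_indicator (hQ _ ha), Set.inter_comm] at h1
  rw [← h1, smul_eq_mul]

/-- Enlarging the conditioning by an independent σ-algebra does not change the conditional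
expectation. -/
lemma condExp_sup_of_indep [IsProbabilityMeasure μ] {A Q S : MeasurableSpace Ω} (hAQ : A ≤ Q)
    (hQ : Q ≤ m0) (hS : S ≤ m0) (h : Indep Q S μ) {X : Ω → ℝ} (hX : StronglyMeasurable[Q] X)
    (hXi : Integrable X μ) : μ[X | A ⊔ S] =ᵐ[μ] μ[X | A] := by
  have hA : A ≤ m0 := hAQ.trans hQ
  have hAS : A ⊔ S ≤ m0 := sup_le hA hS
  symm
  refine ae_eq_condExp_of_forall_setIntegral_eq hAS hXi
    (fun s _ _ => integrable_condExp.integrableOn) (fun s hs _ => ?_)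
    (stronglyMeasurable_condExp.mono (le_sup_left : A ≤ A ⊔ S)).aestronglyMeasurable
  clear * - hs hX hXi h hS hQ hAQ hA hAS
  have hci : Integrable (μ[X | A]) μ := integrable_condExp
  -- It suffices to compare integrals over rectangles a ∩ b with a in A and b in S; there both sides
  -- carry the same factor, the probability of b.
  refine MeasurableSpace.induction_on_inter
    (C := fun s _ => ∫ ω in s, (μ[X | A]) ω ∂μ = ∫ ω in s, X ω ∂μ)
    (sup_eq_generateFrom_inter A S) (isPiSystem_inter A S) ?_ ?_ ?_ ?_ s hs
  · simp
  · rintro _ ⟨a, ha, b, hb, rfl⟩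
    dsimp only
    rw [setIntegral_inter_of_indep hQ hS h (stronglyMeasurable_condExp.mono hAQ) hci (hAQ _ ha) hb,
      setIntegral_inter_of_indep hQ hS h hX hXi (hAQ _ ha) hb, setIntegral_condExp hA hXi ha]
  · intro t ht ih
    rw [setIntegral_compl (hAS _ ht) hci, setIntegral_compl (hAS _ ht) hXi, ih,
      integral_condExp hA]
  · intro f hd hf ih
    have h1 := hasSum_integral_iUnion (fun i => hAS _ (hf i)) hd hci.integrableOn
    have h2 := hasSum_integral_iUnion (fun i => hAS _ (hf i)) hd hXi.integrableOn
    simp_rw [ih] at h1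
    exact h1.unique h2

lemma integral_mul_of_condExp_eq_const [IsProbabilityMeasure μ] {G : MeasurableSpace Ω}
    (hG : G ≤ m0) {X h : Ω → ℝ} {c : ℝ} (hc : μ[X | G] =ᵐ[μ] fun _ => c) (hXi : Integrable X μ)
    (hh : StronglyMeasurable[G] h) (hXh : Integrable (fun ω => X ω * h ω) μ) :
    ∫ ω, X ω * h ω ∂μ = c * ∫ ω, h ω ∂μ := by
  have h1 : μ[fun ω => X ω * h ω | G] =ᵐ[μ] fun ω => (μ[X | G]) ω * h ω :=
    condExp_mul_of_stronglyMeasurable_right hh hXh hXi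
  rw [← integral_condExp hG, integral_congr_ae h1, ← integral_const_mul]
  refine integral_congr_ae ?_
  filter_upwards [hc] with ω hω
  rw [hω]

/-- Source of the contraction of the staleness: h is the old error, known before the window, and A
is the event that the client participates. -/
lemma integral_indicator_mul_le_of_le_condExp [IsProbabilityMeasure μ] {G : MeasurableSpace Ω}
    (hG : G ≤ m0) {A : Set Ω} (hA : MeasurableSet[m0] A) {h : Ω → ℝ} {p : ℝ}
    (hp : ∀ᵐ ω ∂μ, p ≤ (μ⟦A | G⟧) ω) (hh : StronglyMeasurable[G] h) (hhi : Integrable h μ)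
    (h0 : ∀ ω, 0 ≤ h ω) :
    ∫ ω, Aᶜ.indicator h ω ∂μ ≤ (1 - p) * ∫ ω, h ω ∂μ := by
  have hAi : Integrable (A.indicator fun _ => (1 : ℝ)) μ := (integrable_const 1).indicator hA
  have e : ∀ ω, A.indicator (fun _ => (1 : ℝ)) ω * h ω = A.indicator h ω := by
    intro ω
    by_cases hω : ω ∈ A <;> simp [hω]
  have hXh : Integrable (fun ω => A.indicator (fun _ => (1 : ℝ)) ω * h ω) μ := by
    simp_rw [e]; exact hhi.indicator hA
  have h1 : μ[fun ω => A.indicator (fun _ => (1 : ℝ)) ω * h ω | G] =ᵐ[μ]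
      fun ω => (μ[A.indicator fun _ => (1 : ℝ) | G]) ω * h ω :=
    condExp_mul_of_stronglyMeasurable_right hh hXh hAi
  have h2 : p * ∫ ω, h ω ∂μ ≤ ∫ ω, A.indicator h ω ∂μ := by
    simp_rw [← e]
    rw [← integral_condExp hG (f := fun ω => A.indicator (fun _ => (1 : ℝ)) ω * h ω),
      ← integral_const_mul]
    refine integral_mono_ae (hhi.const_mul p) integrable_condExp ?_
    filter_upwards [hp, h1] with ω hω h1ω
    rw [h1ω]
    exact mul_le_mul_of_nonneg_right hω (h0 ω)
  have h3 : ∫ ω, Aᶜ.indicator h ω ∂μ = ∫ ω, h ω ∂μ - ∫ ω, A.indicator h ω ∂μ := by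
    rw [← integral_sub hhi (hhi.indicator hA)]
    refine integral_congr_ae (Eventually.of_forall fun ω => ?_)
    by_cases hω : ω ∈ A <;> simp [hω]
  linarith

end SigmaAlgebras

/-! ### Moments of a function of the past and a fresh sample -/

section CentredSample


variable {Ω Ξ E : Type*} {H m0 : MeasurableSpace Ω} {μ : Measure Ω} [IsProbabilityMeasure μ]
  [MeasurableSpace Ξ] {D : Measure Ξ} [IsProbabilityMeasure D]
  [NormedAddCommGroup E] [InnerProductSpace ℝ E] [MeasurableSpace E] [BorelSpace E]
  [SecondCountableTopology E] [CompleteSpace E]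

/-- Freezing lemma: with a product law, Fubini allows everything that is H-measurable to be held
fixed while the sample is averaged out. -/
lemma map_prod_of_indep {α : Type*} [MeasurableSpace α] (hH : H ≤ m0)
    {S : Ω → Ξ} (hS : Measurable S)
    (hind : Indep H (MeasurableSpace.comap S inferInstance) μ) (hlaw : μ.map S = D)
    {U : Ω → α} (hU : Measurable[H] U) :
    μ.map (fun ω => (U ω, S ω)) = (μ.map U).prod D := by
  have hi : IndepFun U S μ := by
    rw [IndepFun_iff_Indep]
    exact indep_of_indep_of_le_left hind (Measurable.comap_le hU)
  rw [(indepFun_iff_map_prod_eq_prod_map_map (hU.mono hH le_rfl).aemeasurable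
    hS.aemeasurable).1 hi, hlaw]

variable {S : Ω → Ξ} {X : Ω → E} {Ψ : E × Ξ → E} {σ : ℝ}

/-- Stated for lower integrals so that integrability need not be known; the case c = 1 then yields
square integrability, and the weighted case the bound on Bochner integrals. -/
lemma lintegral_sq_centred_le (hH : H ≤ m0) (hS : Measurable S)
    (hind : Indep H (MeasurableSpace.comap S inferInstance) μ) (hlaw : μ.map S = D)
    (hX : Measurable[H] X) (hΨ : Measurable Ψ)
    (hvar : ∀ x, Integrable (fun ξ => ‖Ψ (x, ξ)‖ ^ 2) D ∧ ∫ ξ, ‖Ψ (x, ξ)‖ ^ 2 ∂D ≤ σ ^ 2)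
    {c : Ω → ℝ} (hc : Measurable[H] c) :
    ∫⁻ ω, ENNReal.ofReal (c ω * ‖Ψ (X ω, S ω)‖ ^ 2) ∂μ ≤
      ∫⁻ ω, ENNReal.ofReal (c ω * σ ^ 2) ∂μ := by
  -- The weight is frozen together with the evaluation point, so it may be any function of the past.
  have hXc : Measurable[H] fun ω => (X ω, c ω) := hX.prodMk hc
  have hXc0 : Measurable fun ω => (X ω, c ω) := hXc.mono hH le_rfl
  have hmap := map_prod_of_indep hH hS hind hlaw hXc
  have hm : Measurable fun a : (E × ℝ) × Ξ =>
      ENNReal.ofReal (a.1.2 * ‖Ψ (a.1.1, a.2)‖ ^ 2) := by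
    have : Measurable fun a : (E × ℝ) × Ξ => Ψ (a.1.1, a.2) := hΨ.comp (by fun_prop)
    fun_prop
  calc ∫⁻ ω, ENNReal.ofReal (c ω * ‖Ψ (X ω, S ω)‖ ^ 2) ∂μ
      = ∫⁻ a, ENNReal.ofReal (a.1.2 * ‖Ψ (a.1.1, a.2)‖ ^ 2)
          ∂(μ.map (fun ω => ((X ω, c ω), S ω))) := by
        rw [lintegral_map hm (hXc0.prodMk hS)]
    _ = ∫⁻ u, ∫⁻ ξ, ENNReal.ofReal (u.2 * ‖Ψ (u.1, ξ)‖ ^ 2) ∂D ∂(μ.map fun ω => (X ω, c ω)) := by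
        rw [hmap, lintegral_prod _ hm.aemeasurable]
    _ ≤ ∫⁻ u, ENNReal.ofReal (u.2 * σ ^ 2) ∂(μ.map fun ω => (X ω, c ω)) := by
        refine lintegral_mono fun u => ?_
        rcases le_total 0 u.2 with hu | hu
        · simp_rw [ENNReal.ofReal_mul hu]
          have hmu : Measurable fun ξ => ENNReal.ofReal (‖Ψ (u.1, ξ)‖ ^ 2) := by
            have : Measurable fun ξ => Ψ (u.1, ξ) := hΨ.comp measurable_prodMk_left
            fun_prop
          rw [lintegral_const_mul _ hmu]
          gcongr
          rw [← ofReal_integral_eq_lintegral_ofReal (hvar u.1).1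
            (Eventually.of_forall fun _ => sq_nonneg _)]
          exact ENNReal.ofReal_le_ofReal (hvar u.1).2
        · have : ∀ ξ, ENNReal.ofReal (u.2 * ‖Ψ (u.1, ξ)‖ ^ 2) = 0 := fun ξ =>
            ENNReal.ofReal_of_nonpos (mul_nonpos_of_nonpos_of_nonneg hu (sq_nonneg _))
          simp [this]
    _ = _ := by
        rw [lintegral_map (by fun_prop) hXc0]

lemma memLp_two_centred (hH : H ≤ m0) (hS : Measurable S)
    (hind : Indep H (MeasurableSpace.comap S inferInstance) μ) (hlaw : μ.map S = D)
    (hX : Measurable[H] X) (hΨ : Measurable Ψ)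
    (hvar : ∀ x, Integrable (fun ξ => ‖Ψ (x, ξ)‖ ^ 2) D ∧ ∫ ξ, ‖Ψ (x, ξ)‖ ^ 2 ∂D ≤ σ ^ 2) :
    MemLp (fun ω => Ψ (X ω, S ω)) 2 μ := by
  have hm : Measurable fun ω => Ψ (X ω, S ω) := hΨ.comp ((hX.mono hH le_rfl).prodMk hS)
  rw [memLp_two_iff_integrable_sq_norm hm.aestronglyMeasurable]
  refine ⟨(hm.norm.pow_const 2).aestronglyMeasurable, ?_⟩
  rw [hasFiniteIntegral_iff_ofReal (Eventually.of_forall fun _ => sq_nonneg _)]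
  have h := lintegral_sq_centred_le hH hS hind hlaw hX hΨ hvar (c := fun _ => 1) measurable_const
  simp only [one_mul, lintegral_const, measure_univ, mul_one] at h
  exact h.trans_lt ENNReal.ofReal_lt_top

lemma integral_mul_sq_centred_le (hH : H ≤ m0) (hS : Measurable S)
    (hind : Indep H (MeasurableSpace.comap S inferInstance) μ) (hlaw : μ.map S = D)
    (hX : Measurable[H] X) (hΨ : Measurable Ψ)
    (hvar : ∀ x, Integrable (fun ξ => ‖Ψ (x, ξ)‖ ^ 2) D ∧ ∫ ξ, ‖Ψ (x, ξ)‖ ^ 2 ∂D ≤ σ ^ 2)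
    {c : Ω → ℝ} (hc : Measurable[H] c) (hc0 : ∀ ω, 0 ≤ c ω) (hci : Integrable c μ) :
    ∫ ω, c ω * ‖Ψ (X ω, S ω)‖ ^ 2 ∂μ ≤ σ ^ 2 * ∫ ω, c ω ∂μ := by
  have hm : Measurable fun ω => Ψ (X ω, S ω) := hΨ.comp ((hX.mono hH le_rfl).prodMk hS)
  have hc' : Measurable c := hc.mono hH le_rfl
  rw [← integral_const_mul]
  simp_rw [mul_comm (σ ^ 2)]
  rw [integral_eq_lintegral_of_nonneg_ae
    (Eventually.of_forall fun ω => mul_nonneg (hc0 ω) (sq_nonneg _))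
    (hc'.mul (hm.norm.pow_const 2)).aestronglyMeasurable,
    integral_eq_lintegral_of_nonneg_ae
    (Eventually.of_forall fun ω => mul_nonneg (hc0 ω) (sq_nonneg _))
    (hc'.mul_const _).aestronglyMeasurable]
  refine ENNReal.toReal_mono ?_ (lintegral_sq_centred_le hH hS hind hlaw hX hΨ hvar hc)
  rw [← lt_top_iff_ne_top, ← hasFiniteIntegral_iff_ofReal
    (Eventually.of_forall fun ω => mul_nonneg (hc0 ω) (sq_nonneg _))]
  exact (hci.mul_const _).2

lemma integral_inner_centred (hH : H ≤ m0) (hS : Measurable S)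
    (hind : Indep H (MeasurableSpace.comap S inferInstance) μ) (hlaw : μ.map S = D)
    (hX : Measurable[H] X) (hΨ : Measurable Ψ)
    (hvar : ∀ x, Integrable (fun ξ => ‖Ψ (x, ξ)‖ ^ 2) D ∧ ∫ ξ, ‖Ψ (x, ξ)‖ ^ 2 ∂D ≤ σ ^ 2)
    (hmean : ∀ x, ∫ ξ, Ψ (x, ξ) ∂D = 0)
    {h : Ω → E} (hh : Measurable[H] h) (hh2 : MemLp h 2 μ) :
    ∫ ω, ⟪h ω, Ψ (X ω, S ω)⟫ ∂μ = 0 := by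
  have hΨ2 := memLp_two_centred hH hS hind hlaw hX hΨ hvar
  have hi : Integrable (fun ω => ⟪h ω, Ψ (X ω, S ω)⟫) μ := integrable_inner_of_memLp hh2 hΨ2
  have hXh : Measurable[H] fun ω => (X ω, h ω) := hX.prodMk hh
  have hXh0 : Measurable fun ω => (X ω, h ω) := hXh.mono hH le_rfl
  have hmap := map_prod_of_indep hH hS hind hlaw hXh
  have hm : Measurable fun a : (E × E) × Ξ => ⟪a.1.2, Ψ (a.1.1, a.2)⟫ := by
    have : Measurable fun a : (E × E) × Ξ => Ψ (a.1.1, a.2) := hΨ.comp (by fun_prop)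
    fun_prop
  have hpair : Measurable fun ω => ((X ω, h ω), S ω) := hXh0.prodMk hS
  have e1 : ∫ ω, ⟪h ω, Ψ (X ω, S ω)⟫ ∂μ =
      ∫ a, ⟪a.1.2, Ψ (a.1.1, a.2)⟫ ∂(μ.map (fun ω => ((X ω, h ω), S ω))) := by
    rw [integral_map hpair.aemeasurable hm.aestronglyMeasurable]
  have hi' : Integrable (fun a : (E × E) × Ξ => ⟪a.1.2, Ψ (a.1.1, a.2)⟫)
      (μ.map (fun ω => ((X ω, h ω), S ω))) := by
    rw [integrable_map_measure hm.aestronglyMeasurable hpair.aemeasurable]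
    exact hi
  rw [e1]
  rw [hmap] at hi' ⊢
  rw [integral_prod _ hi']
  refine integral_eq_zero_of_ae (Eventually.of_forall fun u => ?_)
  have hu : Integrable (fun ξ => Ψ (u.1, ξ)) D := by
    have : Measurable fun ξ => Ψ (u.1, ξ) := hΨ.comp measurable_prodMk_left
    exact ((memLp_two_iff_integrable_sq_norm this.aestronglyMeasurable).2 (hvar u.1).1).integrable
      (by norm_num)
  simp only [Pi.zero_apply]
  rw [integral_inner hu, hmean, inner_zero_right]

end CentredSample

/-! ### Closed forms for the rounds of one window -/

section Unrolling

variable {d N : ℕ} (I P : ℕ) (η γ : ℝ) (x₀ : Vec d) (G₀ : Fin N → Vec d)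
    (q : ℕ → Fin N → ℝ) (g : ℕ → Fin N → ℕ → Vec d → Vec d)

/-- The local iterates of client `i` in round `r`. -/
noncomputable def localModel (r : ℕ) (i : Fin N) (k : ℕ) : Vec d :=
  localIter η (g r i) ((run I P η γ x₀ G₀ q g r).G i)
    ((1 / (N : ℝ)) • ∑ j, (run I P η γ x₀ G₀ q g r).G j) (run I P η γ x₀ G₀ q g r).x k

/-- The weighted average of the local updates of round `r`. -/
noncomputable def roundUpdate (r : ℕ) : Vec d :=
  ∑ i, q r i • (localModel I P η γ x₀ G₀ q g r i I - (run I P η γ x₀ G₀ q g r).x)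

lemma run_window_start (hP : 0 < P) (m : ℕ) :
    (run I P η γ x₀ G₀ q g (m * P)).anchor = (run I P η γ x₀ G₀ q g (m * P)).x ∧
    (run I P η γ x₀ G₀ q g (m * P)).u = 0 ∧
    (∀ i, (run I P η γ x₀ G₀ q g (m * P)).acc i = 0) ∧
    (∀ i, (run I P η γ x₀ G₀ q g (m * P)).wt i = 0) := by
  cases m with
  | zero => simp [run]
  | succ m =>
    have e : (m + 1) * P = (m * P + (P - 1)) + 1 := by
      rw [Nat.succ_mul]; omega
    have hd : P ∣ (m * P + (P - 1)) + 1 := e ▸ Dvd.intro_left _ rfl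
    rw [e]
    simp [run, roundStep, hd]

/-- Inside a window P does not divide the next round index, so the closing branch of `roundStep` is
never taken: anchor and control variates stay frozen and the accumulators are plain sums. -/
lemma run_window (hP : 0 < P) (m s : ℕ) (hs : s < P) :
    (∀ i, (run I P η γ x₀ G₀ q g (m * P + s)).G i = (run I P η γ x₀ G₀ q g (m * P)).G i) ∧
    (run I P η γ x₀ G₀ q g (m * P + s)).anchor = (run I P η γ x₀ G₀ q g (m * P)).x ∧
    (run I P η γ x₀ G₀ q g (m * P + s)).x = (run I P η γ x₀ G₀ q g (m * P)).x +
      ∑ t ∈ Finset.range s, roundUpdate I P η γ x₀ G₀ q g (m * P + t) ∧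
    (run I P η γ x₀ G₀ q g (m * P + s)).u =
      ∑ t ∈ Finset.range s, roundUpdate I P η γ x₀ G₀ q g (m * P + t) ∧
    (∀ i, (run I P η γ x₀ G₀ q g (m * P + s)).acc i = ∑ t ∈ Finset.range s, q (m * P + t) i •
      ∑ k ∈ Finset.range I,
        g (m * P + t) i k (localModel I P η γ x₀ G₀ q g (m * P + t) i k)) ∧
    (∀ i, (run I P η γ x₀ G₀ q g (m * P + s)).wt i =
      ∑ t ∈ Finset.range s, q (m * P + t) i) := by
  induction s with
  | zero =>
    obtain ⟨h1, h2, h3, h4⟩ := run_window_start I P η γ x₀ G₀ q g hP m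
    refine ⟨fun i => rfl, h1, by simp, by simpa using h2, fun i => by simpa using h3 i,
      fun i => by simpa using h4 i⟩
  | succ s ih =>
    obtain ⟨h1, h2, h3, h4, h5, h6⟩ := ih (by omega)
    have hd : ¬ P ∣ (m * P + s) + 1 := by
      rw [add_assoc, Nat.dvd_add_right (Dvd.intro_left _ rfl)]
      exact fun h => absurd (Nat.le_of_dvd (by omega) h) (by omega)
    have e : m * P + (s + 1) = (m * P + s) + 1 := rfl
    rw [e]
    refine ⟨fun i => ?_, ?_, ?_, ?_, fun i => ?_, fun i => ?_⟩
    · rw [← h1 i]; simp [run, roundStep, hd]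
    · rw [← h2]; simp [run, roundStep, hd]
    · rw [Finset.sum_range_succ, ← add_assoc, ← h3]
      simp only [run, roundStep, hd, if_false, roundUpdate, localModel]
    · rw [Finset.sum_range_succ, ← h4]
      simp only [run, roundStep, hd, if_false, roundUpdate, localModel]
    · rw [Finset.sum_range_succ, ← h5]
      simp only [run, roundStep, hd, if_false, localModel]
    · rw [Finset.sum_range_succ, ← h6]
      simp only [run, roundStep, hd, if_false]

lemma run_window_succ (hP : 0 < P) (m : ℕ) :
    (run I P η γ x₀ G₀ q g ((m + 1) * P)).x = (run I P η γ x₀ G₀ q g (m * P)).x +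
      γ • ∑ t ∈ Finset.range P, roundUpdate I P η γ x₀ G₀ q g (m * P + t) ∧
    ∀ i, (run I P η γ x₀ G₀ q g ((m + 1) * P)).G i =
      if 0 < ∑ t ∈ Finset.range P, q (m * P + t) i then
        (1 / ((∑ t ∈ Finset.range P, q (m * P + t) i) * I)) •
          ∑ t ∈ Finset.range P, q (m * P + t) i • ∑ k ∈ Finset.range I,
            g (m * P + t) i k (localModel I P η γ x₀ G₀ q g (m * P + t) i k)
      else (run I P η γ x₀ G₀ q g (m * P)).G i := by
  -- The last round of the window has offset Q = P - 1; it is the only one that takes the closing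
  -- branch.
  obtain ⟨Q, rfl⟩ : ∃ Q, P = Q + 1 := ⟨P - 1, by omega⟩
  obtain ⟨h1, h2, h3, h4, h5, h6⟩ := run_window I (Q + 1) η γ x₀ G₀ q g hP m Q (by omega)
  have e : (m + 1) * (Q + 1) = (m * (Q + 1) + Q) + 1 := by ring
  have hd : (Q + 1) ∣ (m * (Q + 1) + Q) + 1 := e ▸ Dvd.intro_left _ rfl
  constructor
  · rw [e, Finset.sum_range_succ, ← h2, ← h4]
    simp only [run, roundStep, hd, if_true, roundUpdate, localModel]
  · intro i
    rw [e, Finset.sum_range_succ, ← h6, Finset.sum_range_succ, ← h5, ← h1]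
    simp only [run, roundStep, hd, if_true, localModel]

lemma localModel_zero (r : ℕ) (i : Fin N) :
    localModel I P η γ x₀ G₀ q g r i 0 = (run I P η γ x₀ G₀ q g r).x := rfl

lemma localModel_eq_sum (hP : 0 < P) (m s : ℕ) (hs : s < P) (i : Fin N) (k : ℕ) :
    localModel I P η γ x₀ G₀ q g (m * P + s) i k = (run I P η γ x₀ G₀ q g (m * P + s)).x -
      η • ∑ l ∈ Finset.range k,
        (g (m * P + s) i l (localModel I P η γ x₀ G₀ q g (m * P + s) i l) -
          (run I P η γ x₀ G₀ q g (m * P)).G i +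
          (1 / (N : ℝ)) • ∑ j, (run I P η γ x₀ G₀ q g (m * P)).G j) := by
  have hG := (run_window I P η γ x₀ G₀ q g hP m s hs).1
  have hG' : ∑ j, (run I P η γ x₀ G₀ q g (m * P + s)).G j =
    ∑ j, (run I P η γ x₀ G₀ q g (m * P)).G j := Finset.sum_congr rfl fun j _ => hG j
  induction k with
  | zero => simp [localModel_zero]
  | succ k ih =>
    rw [Finset.sum_range_succ, smul_add, ← sub_sub, ← ih, ← hG' , ← hG i]
    rfl

end Unrolling

/-! ### Measurability of the algorithm -/

section MeasurableRun

variable {d N : ℕ} {Ω Ξ : Type*} {_ : MeasurableSpace Ω} [MeasurableSpace Ξ]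
  {F : Fin N → Vec d → Ξ → ℝ}

lemma measurable_localIter (hF : ∀ i, Measurable fun a : Vec d × Ξ => stochGrad F i a.1 a.2)
    (η : ℝ) (i : Fin N) {ζ : ℕ → Ω → Ξ} {Gi Gb x : Ω → Vec d} (hGi : Measurable Gi)
    (hGb : Measurable Gb) (hx : Measurable x) {k : ℕ} (hζ : ∀ l < k, Measurable (ζ l)) :
    Measurable fun ω =>
      localIter η (fun l y => stochGrad F i y (ζ l ω)) (Gi ω) (Gb ω) (x ω) k := by
  induction k with
  | zero => exact hx
  | succ k ih =>
    have h1 := ih fun l hl => hζ l (by omega)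
    have h2 := (hF i).comp (h1.prodMk (hζ k (by omega)))
    exact h1.sub (((h2.sub hGi).add hGb).const_smul η)

/-- The σ-algebra on Ω is arbitrary, not the ambient one: inserting sub-σ-algebras turns this one
induction into every adaptedness statement used later. -/
lemma measurable_run (hF : ∀ i, Measurable fun a : Vec d × Ξ => stochGrad F i a.1 a.2)
    (I P : ℕ) (η γ : ℝ) (x₀ : Vec d) {G₀ : Ω → Fin N → Vec d} {q : ℕ → Fin N → Ω → ℝ}
    {ξ : ℕ → ℕ → Fin N → Ω → Ξ} (hG₀ : ∀ i, Measurable fun ω => G₀ ω i) {r : ℕ}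
    (hq : ∀ s < r, ∀ i, Measurable (q s i))
    (hξ : ∀ s < r, ∀ k < I, ∀ i, Measurable (ξ s k i)) :
    let st : Ω → State d N := fun ω => run I P η γ x₀ (G₀ ω) (fun s i => q s i ω)
      (fun s i k x => stochGrad F i x (ξ s k i ω)) r
    Measurable (fun ω => (st ω).x) ∧ Measurable (fun ω => (st ω).anchor) ∧
      Measurable (fun ω => (st ω).u) ∧ (∀ i, Measurable fun ω => (st ω).G i) ∧
      (∀ i, Measurable fun ω => (st ω).acc i) ∧ ∀ i, Measurable fun ω => (st ω).wt i := by
  induction r with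
  | zero =>
    exact ⟨measurable_const, measurable_const, measurable_const, hG₀, fun _ => measurable_const,
      fun _ => measurable_const⟩
  | succ r ih =>
    obtain ⟨h1, h2, h3, h4, h5, h6⟩ := ih (fun s hs => hq s (by omega))
      fun s hs => hξ s (by omega)
    have hGb : Measurable fun ω => (1 / (N : ℝ)) • ∑ j, (run I P η γ x₀ (G₀ ω) (fun s i => q s i ω)
        (fun s i k x => stochGrad F i x (ξ s k i ω)) r).G j :=
      (Finset.measurable_sum Finset.univ fun j _ => h4 j).const_smul (1 / (N : ℝ))
    have hY : ∀ i, ∀ k ≤ I, Measurable fun ω => localIter η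
        (fun l y => stochGrad F i y (ξ r l i ω)) ((run I P η γ x₀ (G₀ ω) (fun s i => q s i ω)
        (fun s i k x => stochGrad F i x (ξ s k i ω)) r).G i)
        ((1 / (N : ℝ)) • ∑ j, (run I P η γ x₀ (G₀ ω) (fun s i => q s i ω)
        (fun s i k x => stochGrad F i x (ξ s k i ω)) r).G j)
        (run I P η γ x₀ (G₀ ω) (fun s i => q s i ω)
        (fun s i k x => stochGrad F i x (ξ s k i ω)) r).x k := fun i k hk =>
      measurable_localIter hF η i (h4 i) hGb h1 fun l hl => hξ r (by omega) l (by omega) i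
    have hq' := hq r (by omega)
    have hstep := Finset.measurable_sum Finset.univ fun i _ =>
      (hq' i).smul ((hY i I le_rfl).sub h1)
    have hacc := fun i => (h5 i).add ((hq' i).smul (Finset.measurable_sum (Finset.range I)
      fun k hk => (hF i).comp ((hY i k (Finset.mem_range.1 hk).le).prodMk
        (hξ r (by omega) k (Finset.mem_range.1 hk) i))))
    have hwt := fun i => (h6 i).add (hq' i)
    simp only [run, roundStep]
    by_cases hd : P ∣ r + 1
    · simp only [hd, if_true]
      refine ⟨h2.add ((h3.add hstep).const_smul γ), h2.add ((h3.add hstep).const_smul γ),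
        measurable_const, fun i => ?_, fun _ => measurable_const, fun _ => measurable_const⟩
      exact Measurable.ite (measurableSet_lt measurable_const (hwt i))
        ((((hwt i).mul_const _).const_div 1).smul (hacc i)) (h4 i)
    · simp only [hd, if_false]
      exact ⟨h1.add hstep, h2, h3.add hstep, h4, hacc, hwt⟩

end MeasurableRun

/-! ### Gradient noises and the information available when a sample is drawn -/

/-- The data of one execution of Amplified SCAFFOLD, together with the problem constants. -/
structure Experiment (d N : ℕ) (Ω Ξ : Type*) [MeasurableSpace Ξ] where
  D : Fin N → Measure Ξ
  F : Fin N → Vec d → Ξ → ℝ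
  x₀ : Vec d
  q : ℕ → Fin N → Ω → ℝ
  ξ₀ : ℕ → ℕ → Fin N → Ω → Ξ
  ξ : ℕ → ℕ → Fin N → Ω → Ξ
  (R I P : ℕ)
  (Δ L σ ρ p η γ : ℝ)

namespace Experiment

variable {d N : ℕ} {Ω Ξ : Type*} [MeasurableSpace Ξ] (c : Experiment d N Ω Ξ)

/-- The standing assumptions. -/
structure Valid [MeasurableSpace Ω] (μ : Measure Ω) : Prop where
  prob : ∀ i, IsProbabilityMeasure (c.D i)
  N_pos : 0 < N
  I_pos : 0 < c.I
  P_pos : 0 < c.P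
  dvd : c.P ∣ c.R
  L_pos : 0 < c.L
  p_pos : 0 < c.p
  p_le : c.p ≤ 1
  obj : ObjAssumption c.F c.D c.x₀ c.Δ c.L c.σ
  samp : SampleAssumption μ c.D c.R c.I c.P c.ξ₀ c.ξ
  part : ParticipationAssumption μ c.R c.I c.P c.ρ c.p c.q c.ξ₀ c.ξ
  reg : ∀ m < c.R / c.P,
    ∫ ω, ∑ i, vDev c.q c.P m i ω ^ 2 * Lam c.q c.P m i ω ∂μ ≤ c.ρ ^ 2

noncomputable section

/-- The state at the beginning of round `r`. -/
def state (r : ℕ) (ω : Ω) : State d N :=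
  run c.I c.P c.η c.γ c.x₀ (initControl c.F c.I c.P c.x₀ c.ξ₀ ω) (fun s i => c.q s i ω)
    (fun s i k x => stochGrad c.F i x (c.ξ s k i ω)) r

/-- The local model of client `i` in round `r` after `k` steps. -/
def Y (r : ℕ) (i : Fin N) (k : ℕ) (ω : Ω) : Vec d :=
  localModel c.I c.P c.η c.γ c.x₀ (initControl c.F c.I c.P c.x₀ c.ξ₀ ω) (fun s i => c.q s i ω)
    (fun s i k x => stochGrad c.F i x (c.ξ s k i ω)) r i k

/-- The server model at the beginning of window `m`. -/
def X (m : ℕ) (ω : Ω) : Vec d := (c.state (m * c.P) ω).x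

/-- The control variates of window `m`. -/
def G (m : ℕ) (i : Fin N) (ω : Ω) : Vec d := (c.state (m * c.P) ω).G i

/-- `∇f_i`. -/
def df (i : Fin N) (x : Vec d) : Vec d := gradient (localObj c.F c.D i) x

/-- `∇f`. -/
def dF (x : Vec d) : Vec d := gradient (globalObj c.F c.D) x

/-- The noise of the stochastic gradient of client `i` in step `k` of round `r`. -/
def noise (r k : ℕ) (i : Fin N) (ω : Ω) : Vec d :=
  stochGrad c.F i (c.Y r i k ω) (c.ξ r k i ω) - c.df i (c.Y r i k ω)

/-- Index set of all the samples. -/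
abbrev Idx : Type := (Fin c.P ⊕ Fin c.R) × Fin c.I × Fin N

/-- The sample with index `j`. -/
def S (j : c.Idx) : Ω → Ξ := samples c.R c.I c.P c.ξ₀ c.ξ j

/-- The point at which the stochastic gradient with index `j` is taken. -/
def pt (j : c.Idx) (ω : Ω) : Vec d :=
  Sum.elim (fun _ => c.x₀) (fun r : Fin c.R => c.Y r j.2.2 j.2.1 ω) j.1

/-- The noise of the stochastic gradient with index `j`. -/
def gradNoise (j : c.Idx) (ω : Ω) : Vec d :=
  stochGrad c.F j.2.2 (c.pt j ω) (c.S j ω) - c.df j.2.2 (c.pt j ω)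

/-- The time at which a sample is drawn. -/
def time (j : c.Idx) : ℕ := Sum.elim (fun _ => 0) (fun r : Fin c.R => r * c.I + j.2.1 + 1) j.1

/-- The σ-algebra of all the participation weights. -/
@[reducible] def weightAlg : MeasurableSpace Ω :=
  MeasurableSpace.comap (fun ω (j : Fin c.R × Fin N) => c.q j.1 j.2 ω) inferInstance

/-- The σ-algebra of all the samples. -/
@[reducible] def sampleAlg : MeasurableSpace Ω :=
  MeasurableSpace.comap (fun ω j => samples c.R c.I c.P c.ξ₀ c.ξ j ω) inferInstance

/-- The σ-algebra of all the weights and of all the samples but one. -/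
@[reducible] def otherAlg (j : c.Idx) : MeasurableSpace Ω :=
  c.weightAlg ⊔ ⨆ j' ∈ ({j}ᶜ : Set c.Idx), MeasurableSpace.comap (c.S j') inferInstance

lemma measurable_q_weightAlg {r : ℕ} (hr : r < c.R) (i : Fin N) :
    Measurable[c.weightAlg] (c.q r i) := by
  have h : Measurable[c.weightAlg] (fun ω (j : Fin c.R × Fin N) => c.q j.1 j.2 ω) :=
    comap_measurable _
  exact (measurable_pi_apply ((⟨r, hr⟩, i) : Fin c.R × Fin N)).comp h

lemma weightAlg_le_otherAlg (j : c.Idx) : c.weightAlg ≤ c.otherAlg j := le_sup_left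

lemma measurable_S_otherAlg {j j' : c.Idx} (h : j' ≠ j) : Measurable[c.otherAlg j] (c.S j') := by
  have h1 : MeasurableSpace.comap (c.S j') inferInstance ≤ c.otherAlg j :=
    le_trans (le_iSup₂ (f := fun j' (_ : j' ∈ ({j}ᶜ : Set c.Idx)) =>
      MeasurableSpace.comap (c.S j') inferInstance) j' h) le_sup_right
  exact (comap_measurable (c.S j')).mono h1 le_rfl

lemma measurable_S_sampleAlg (j : c.Idx) : Measurable[c.sampleAlg] (c.S j) := by
  have h : Measurable[c.sampleAlg] (fun ω j => samples c.R c.I c.P c.ξ₀ c.ξ j ω) :=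
    comap_measurable _
  exact (measurable_pi_apply j).comp h

variable {c}

section Gradients

variable {H : MeasurableSpace Ω} [MeasurableSpace Ω] {μ : Measure Ω} (h : c.Valid μ)
include h

namespace Valid

lemma lipschitz_df (i : Fin N) (x y : Vec d) : ‖c.df i x - c.df i y‖ ≤ c.L * ‖x - y‖ :=
  h.obj.smooth i x y

lemma continuous_df (i : Fin N) : Continuous (c.df i) := by
  refine (LipschitzWith.of_dist_le_mul (K := c.L.toNNReal) fun x y => ?_).continuous
  rw [dist_eq_norm, dist_eq_norm, Real.coe_toNNReal _ h.L_pos.le]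
  exact h.lipschitz_df i x y

lemma differentiable_globalObj : Differentiable ℝ (globalObj c.F c.D) := by
  have : globalObj c.F c.D = fun x => (1 / (N : ℝ)) * ∑ i, localObj c.F c.D i x := rfl
  rw [this]
  exact (Differentiable.fun_sum fun i _ => h.obj.differentiable_local i).const_mul _

lemma dF_eq (x : Vec d) : c.dF x = (1 / (N : ℝ)) • ∑ i, c.df i x := by
  have h1 : HasFDerivAt (globalObj c.F c.D)
      ((1 / (N : ℝ)) • ∑ i, fderiv ℝ (localObj c.F c.D i) x) x :=
    (HasFDerivAt.fun_sum fun i _ => (h.obj.differentiable_local i x).hasFDerivAt).const_mul _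
  rw [dF, gradient, h1.fderiv]
  simp [df, gradient]

lemma lipschitz_dF (x y : Vec d) : ‖c.dF x - c.dF y‖ ≤ c.L * ‖x - y‖ := by
  have hN : (0 : ℝ) < N := Nat.cast_pos.2 h.N_pos
  rw [h.dF_eq, h.dF_eq, ← smul_sub, ← Finset.sum_sub_distrib, norm_smul, Real.norm_eq_abs,
    abs_of_pos (by positivity)]
  calc 1 / (N : ℝ) * ‖∑ i, (c.df i x - c.df i y)‖
      ≤ 1 / (N : ℝ) * ∑ _i : Fin N, c.L * ‖x - y‖ := by
        gcongr
        exact (norm_sum_le _ _).trans (Finset.sum_le_sum fun i _ => h.lipschitz_df i x y)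
    _ = c.L * ‖x - y‖ := by
        rw [Finset.sum_const, Finset.card_univ, Fintype.card_fin, nsmul_eq_mul]; field_simp

lemma continuous_dF : Continuous c.dF := by
  have : c.dF = fun x => (1 / (N : ℝ)) • ∑ i, c.df i x := funext h.dF_eq
  rw [this]
  exact Continuous.const_smul (continuous_finsetSum _ fun i _ => h.continuous_df i) (1 / (N : ℝ))

lemma memLp_stochGrad (i : Fin N) (x : Vec d) :
    MemLp (fun ξ => stochGrad c.F i x ξ) 2 (c.D i) ∧
      ∫ ξ, stochGrad c.F i x ξ ∂(c.D i) = c.df i x := by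
  have := h.prob i
  exact unbiased_of_variance (fun _ => rfl) (h.obj.integrable i) (h.obj.differentiable i)
    (h.obj.measurable_grad i) (h.obj.differentiable_local i) (h.continuous_df i)
    (h.obj.variance i) x

lemma measurable_centredGrad (i : Fin N) :
    Measurable fun a : Vec d × Ξ => stochGrad c.F i a.1 a.2 - c.df i a.1 :=
  (h.obj.measurable_grad i).sub ((h.continuous_df i).measurable.comp measurable_fst)

lemma integral_centredGrad (i : Fin N) (x : Vec d) :
    ∫ ξ, (stochGrad c.F i x ξ - c.df i x) ∂(c.D i) = 0 := by
  have := h.prob i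
  rw [integral_sub ((h.memLp_stochGrad i x).1.integrable (by norm_num)) (integrable_const _),
    (h.memLp_stochGrad i x).2]
  simp

lemma measurable_S (j : c.Idx) : Measurable (c.S j) := h.samp.measurable j

lemma weightAlg_le : c.weightAlg ≤ ‹MeasurableSpace Ω› :=
  Measurable.comap_le (measurable_pi_lambda _ fun j => h.part.measurable j.1 j.1.2 j.2)

lemma sampleAlg_le : c.sampleAlg ≤ ‹MeasurableSpace Ω› :=
  Measurable.comap_le (measurable_pi_lambda _ fun j => h.samp.measurable j)

lemma otherAlg_le (j : c.Idx) : c.otherAlg j ≤ ‹MeasurableSpace Ω› :=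
  sup_le h.weightAlg_le (iSup₂_le fun j' _ => Measurable.comap_le (h.measurable_S j'))

lemma indep_weightAlg_sampleAlg : Indep c.weightAlg c.sampleAlg μ :=
  (IndepFun_iff_Indep _ _ _).1 h.part.indep

/-- The weights are independent of the whole family of samples and the samples are mutually
independent; `indep_sup_left` combines the two facts. -/
lemma indep_otherAlg [IsProbabilityMeasure μ] (j : c.Idx) :
    Indep (c.otherAlg j) (MeasurableSpace.comap (c.S j) inferInstance) μ := by
  have hle : ∀ j', MeasurableSpace.comap (c.S j') inferInstance ≤ c.sampleAlg := fun j' =>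
    Measurable.comap_le (c.measurable_S_sampleAlg j')
  refine indep_sup_left h.weightAlg_le
    (iSup₂_le fun j' _ => Measurable.comap_le (h.measurable_S j'))
    (Measurable.comap_le (h.measurable_S j)) ?_ ?_
  · exact indep_of_indep_of_le_right h.indep_weightAlg_sampleAlg
      (sup_le (iSup₂_le fun j' _ => hle j') (hle j))
  · have hi : iIndep (fun j => MeasurableSpace.comap (c.S j) inferInstance) μ :=
      (iIndepFun_iff_iIndep _ _ _).1 h.samp.indep
    have := indep_iSup_of_disjoint (fun j => Measurable.comap_le (h.measurable_S j)) hi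
      (S := {j}ᶜ) (T := {j}) (Set.disjoint_singleton_right.2 (by simp))
    simpa using this

/-- Measurability of the algorithm with respect to an arbitrary σ-algebra. -/
lemma measurable_state {r : ℕ} (hr : r ≤ c.R)
    (hq : ∀ s < r, ∀ i, Measurable[H] (c.q s i))
    (hS : ∀ j : c.Idx, c.time j ≤ r * c.I → Measurable[H] (c.S j)) :
    Measurable[H] (fun ω => (c.state r ω).x) ∧ ∀ i, Measurable[H] fun ω => (c.state r ω).G i := by
  have hξ : ∀ s < r, ∀ k < c.I, ∀ i, Measurable[H] (c.ξ s k i) := by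
    intro s hs k hk i
    refine hS (Sum.inr ⟨s, by omega⟩, ⟨k, hk⟩, i) ?_
    simp only [time, Sum.elim_inr]
    nlinarith
  have hξ₀ : ∀ s < c.P, ∀ k < c.I, ∀ i, Measurable[H] (c.ξ₀ s k i) := fun s hs k hk i =>
    hS (Sum.inl ⟨s, hs⟩, ⟨k, hk⟩, i) (Nat.zero_le _)
  have hG₀ : ∀ i, Measurable[H] fun ω => initControl c.F c.I c.P c.x₀ c.ξ₀ ω i := by
    intro i
    refine Measurable.const_smul (Finset.measurable_sum (Finset.range c.P) fun s hs =>
      Finset.measurable_sum (Finset.range c.I) fun k hk => ?_) (1 / ((c.I : ℝ) * c.P))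
    exact (h.obj.measurable_grad i).comp (measurable_const.prodMk
      (hξ₀ s (Finset.mem_range.1 hs) k (Finset.mem_range.1 hk) i))
  have := measurable_run h.obj.measurable_grad c.I c.P c.η c.γ c.x₀ hG₀ hq hξ
  exact ⟨this.1, this.2.2.2.1⟩

/-- The shift by one in `time` puts the preliminary samples at time 0, before all others. Step l of
round r has time rI + l + 1, so an iterate after k steps sees exactly the times below rI + k + 1,
which is the time of the sample used next. -/
lemma measurable_Y {r : ℕ} (hr : r < c.R) (i : Fin N) {k : ℕ}
    (hk : k ≤ c.I) (hq : ∀ s < r, ∀ i, Measurable[H] (c.q s i))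
    (hS : ∀ j : c.Idx, c.time j < r * c.I + k + 1 → Measurable[H] (c.S j)) :
    Measurable[H] (c.Y r i k) := by
  obtain ⟨h1, h2⟩ := h.measurable_state hr.le hq fun j hj => hS j (by omega)
  refine measurable_localIter h.obj.measurable_grad c.η i (h2 i)
    ((Finset.measurable_sum Finset.univ fun j _ => h2 j).const_smul (1 / (N : ℝ))) h1
    fun l hl => ?_
  refine hS (Sum.inr ⟨r, hr⟩, ⟨l, by omega⟩, i) ?_
  simp only [time, Sum.elim_inr]
  omega

lemma measurable_pt (j : c.Idx)
    (hq : ∀ s < c.R, ∀ i, Measurable[H] (c.q s i))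
    (hS : ∀ j' : c.Idx, c.time j' < c.time j → Measurable[H] (c.S j')) :
    Measurable[H] (c.pt j) := by
  obtain ⟨s | r, k, i⟩ := j
  · exact measurable_const
  · exact h.measurable_Y r.2 i k.2.le (fun s hs => hq s (hs.trans r.2)) hS

lemma measurable_gradNoise (j : c.Idx)
    (hq : ∀ s < c.R, ∀ i, Measurable[H] (c.q s i))
    (hS : ∀ j' : c.Idx, c.time j' < c.time j ∨ j' = j → Measurable[H] (c.S j')) :
    Measurable[H] (c.gradNoise j) := by
  have h1 : Measurable[H] (c.pt j) := h.measurable_pt j hq fun j' hj' => hS j' (Or.inl hj')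
  have h2 : Measurable[H] (c.S j) := hS j (Or.inr rfl)
  have h3 : Measurable[H] fun ω => (c.pt j ω, c.S j ω) := h1.prodMk h2
  have h4 := (h.measurable_centredGrad j.2.2).comp h3
  unfold gradNoise
  exact h4

lemma measurable_pt_otherAlg (j : c.Idx) : Measurable[c.otherAlg j] (c.pt j) :=
  h.measurable_pt j
    (fun _ hs i => (c.measurable_q_weightAlg hs i).mono (c.weightAlg_le_otherAlg j) le_rfl)
    fun _ hj' => c.measurable_S_otherAlg fun e => (e ▸ hj').false

/-- A noise depends on its own sample and on strictly earlier ones, so ties in time are harmless: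
simultaneous noises of different clients do not see each other. -/
lemma measurable_gradNoise_otherAlg {a j : c.Idx} (hne : a ≠ j) (ht : c.time a ≤ c.time j) :
    Measurable[c.otherAlg j] (c.gradNoise a) := by
  refine h.measurable_gradNoise a
    (fun _ hs i => (c.measurable_q_weightAlg hs i).mono (c.weightAlg_le_otherAlg j) le_rfl)
    fun j' hj' => c.measurable_S_otherAlg fun e => ?_
  rcases hj' with hj' | hj'
  · subst e; omega
  · exact hne (hj'.symm.trans e)

variable [IsProbabilityMeasure μ]

lemma memLp_gradNoise (j : c.Idx) : MemLp (c.gradNoise j) 2 μ := by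
  have := h.prob j.2.2
  exact memLp_two_centred (h.otherAlg_le j) (h.measurable_S j) (h.indep_otherAlg j)
    (h.samp.law j) (h.measurable_pt_otherAlg j) (h.measurable_centredGrad j.2.2)
    (h.obj.variance j.2.2)

lemma integral_inner_gradNoise (j : c.Idx) {v : Ω → Vec d} (hv : Measurable[c.otherAlg j] v)
    (hv2 : MemLp v 2 μ) : ∫ ω, ⟪v ω, c.gradNoise j ω⟫ ∂μ = 0 := by
  have := h.prob j.2.2
  exact integral_inner_centred (h.otherAlg_le j) (h.measurable_S j) (h.indep_otherAlg j)
    (h.samp.law j) (h.measurable_pt_otherAlg j) (h.measurable_centredGrad j.2.2)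
    (h.obj.variance j.2.2) (h.integral_centredGrad j.2.2) hv hv2

lemma integral_mul_sq_gradNoise_le (j : c.Idx) {a : Ω → ℝ} (ha : Measurable[c.weightAlg] a)
    (ha0 : ∀ ω, 0 ≤ a ω) (hai : Integrable a μ) :
    ∫ ω, a ω * ‖c.gradNoise j ω‖ ^ 2 ∂μ ≤ c.σ ^ 2 * ∫ ω, a ω ∂μ := by
  have := h.prob j.2.2
  exact integral_mul_sq_centred_le (h.otherAlg_le j) (h.measurable_S j) (h.indep_otherAlg j)
    (h.samp.law j) (h.measurable_pt_otherAlg j) (h.measurable_centredGrad j.2.2)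
    (h.obj.variance j.2.2) (ha.mono (c.weightAlg_le_otherAlg j) le_rfl) ha0 hai

end Valid

end Gradients

end

lemma memLp_smul_of_bound {E : Type*} [MeasurableSpace Ω] {μ : Measure Ω} [NormedAddCommGroup E]
    [NormedSpace ℝ E] {a : Ω → ℝ} {v : Ω → E} {K : ℝ} (ha : AEStronglyMeasurable a μ)
    (hK : ∀ᵐ ω ∂μ, |a ω| ≤ K) (hv : MemLp v 2 μ) : MemLp (fun ω => a ω • v ω) 2 μ := by
  refine hv.of_le_mul (c := K) (ha.smul hv.1) ?_
  filter_upwards [hK] with ω hω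
  rw [norm_smul]
  exact mul_le_mul_of_nonneg_right hω (norm_nonneg _)

namespace Valid

variable [MeasurableSpace Ω] {μ : Measure Ω} [IsProbabilityMeasure μ] {c : Experiment d N Ω Ξ}
  (h : c.Valid μ)
include h

/-- Weighted sums of the gradient noises: the second moment is that of orthogonal terms. -/
lemma integral_sq_sum_gradNoise_le {a : c.Idx → Ω → ℝ} {K : ℝ}
    (ha : ∀ j, Measurable[c.weightAlg] (a j)) (hK : ∀ j, ∀ᵐ ω ∂μ, |a j ω| ≤ K) :
    MemLp (fun ω => ∑ j, a j ω • c.gradNoise j ω) 2 μ ∧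
    ∫ ω, ‖∑ j, a j ω • c.gradNoise j ω‖ ^ 2 ∂μ ≤ c.σ ^ 2 * ∫ ω, ∑ j, a j ω ^ 2 ∂μ := by
  have ha0 : ∀ j, Measurable (a j) := fun j => (ha j).mono h.weightAlg_le le_rfl
  have hL : ∀ j, MemLp (fun ω => a j ω • c.gradNoise j ω) 2 μ := fun j =>
    memLp_smul_of_bound (ha0 j).aestronglyMeasurable (hK j) (h.memLp_gradNoise j)
  refine ⟨memLp_finsetSum _ fun j _ => hL j, ?_⟩
  have hprod : ∀ i j, Integrable
      (fun ω => ⟪a i ω • c.gradNoise i ω, a j ω • c.gradNoise j ω⟫) μ := fun i j =>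
    integrable_inner_of_memLp (hL i) (hL j)
  have hcross' : ∀ i j, i ≠ j → c.time i ≤ c.time j →
      ∫ ω, ⟪a i ω • c.gradNoise i ω, a j ω • c.gradNoise j ω⟫ ∂μ = 0 := by
    intro i j hij ht
    -- Both coefficients are moved onto the earlier noise. They are functions of the weights, which
    -- `otherAlg` contains, so the later noise stays centred against the product.
    have hm : Measurable[c.otherAlg j] fun ω => (a j ω * a i ω) • c.gradNoise i ω :=
      Measurable.smul (((ha j).mul (ha i)).mono (c.weightAlg_le_otherAlg j) le_rfl)
        (h.measurable_gradNoise_otherAlg hij ht)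
    have hm2 : MemLp (fun ω => (a j ω * a i ω) • c.gradNoise i ω) 2 μ := by
      simp_rw [mul_smul]
      exact memLp_smul_of_bound (ha0 j).aestronglyMeasurable (hK j) (hL i)
    rw [← h.integral_inner_gradNoise j hm hm2]
    refine integral_congr_ae (Eventually.of_forall fun ω => ?_)
    simp only [inner_smul_left, inner_smul_right, RCLike.conj_to_real]
    ring
  have hcross : ∀ i j, i ≠ j →
      ∫ ω, ⟪a i ω • c.gradNoise i ω, a j ω • c.gradNoise j ω⟫ ∂μ = 0 := by
    intro i j hij
    rcases le_total (c.time i) (c.time j) with ht | ht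
    · exact hcross' i j hij ht
    · rw [← hcross' j i hij.symm ht]
      simp_rw [real_inner_comm]
  have e : ∀ ω, ‖∑ j, a j ω • c.gradNoise j ω‖ ^ 2 =
      ∑ i, ∑ j, ⟪a i ω • c.gradNoise i ω, a j ω • c.gradNoise j ω⟫ := by
    intro ω
    rw [← real_inner_self_eq_norm_sq, sum_inner]
    simp_rw [inner_sum]
  have hai : ∀ j, Integrable (fun ω => a j ω ^ 2) μ := fun j => by
    refine (integrable_const (K ^ 2)).mono' ((ha0 j).pow_const 2).aestronglyMeasurable ?_
    filter_upwards [hK j] with ω hω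
    rw [Real.norm_eq_abs, abs_of_nonneg (sq_nonneg _), ← sq_abs]
    exact pow_le_pow_left₀ (abs_nonneg _) hω 2
  simp_rw [e]
  rw [integral_finsetSum _ fun i _ => integrable_finsetSum _ fun j _ => hprod i j,
    integral_finsetSum _ fun j _ => hai j, Finset.mul_sum]
  refine Finset.sum_le_sum fun i _ => ?_
  rw [integral_finsetSum _ fun j _ => hprod i j,
    Finset.sum_eq_single i (fun j _ hj => hcross i j hj.symm) (by simp)]
  refine le_trans (le_of_eq ?_) (h.integral_mul_sq_gradNoise_le i ((ha i).pow_const 2)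
    (fun _ => sq_nonneg _) (hai i))
  refine integral_congr_ae (Eventually.of_forall fun ω => ?_)
  simp only [real_inner_self_eq_norm_sq, norm_smul, mul_pow, Real.norm_eq_abs, sq_abs]

end Valid

end Experiment

/-! ### Normalised weights and participation given the samples -/

namespace Experiment

variable {d N : ℕ} {Ω Ξ : Type*} [MeasurableSpace Ξ] (c : Experiment d N Ω Ξ)

/-- The weights are normalised in all rounds. -/
def Good (ω : Ω) : Prop :=
  ∀ r < c.R, (∀ i, 0 ≤ c.q r i ω) ∧ ∑ i, c.q r i ω = 1 ∧ ∑ i, c.q r i ω ^ 2 ≤ c.ρ ^ 2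

/-- The σ-algebra of the weights before window `m` and of all the samples. -/
@[reducible] def windowAlg (m : ℕ) : MeasurableSpace Ω := pastQ c.q (m * c.P) ⊔ c.sampleAlg

variable {c}

lemma Good.q_le_one {ω : Ω} (hω : c.Good ω) {r : ℕ} (hr : r < c.R) (i : Fin N) :
    c.q r i ω ≤ 1 := by
  obtain ⟨h0, h1, -⟩ := hω r hr
  rw [← h1]
  exact Finset.single_le_sum (fun j _ => h0 j) (Finset.mem_univ i)

lemma qbar_mul {q : ℕ → Fin N → Ω → ℝ} {P : ℕ} (hP : 0 < P) (m : ℕ) (i : Fin N) (ω : Ω) :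
    (P : ℝ) * qbar q P m i ω = ∑ s ∈ Finset.range P, q (m * P + s) i ω := by
  have : (0 : ℝ) < P := Nat.cast_pos.2 hP
  rw [qbar]; field_simp

lemma qbar_pos_iff {q : ℕ → Fin N → Ω → ℝ} {P : ℕ} (hP : 0 < P) (m : ℕ) (i : Fin N) (ω : Ω) :
    0 < qbar q P m i ω ↔ 0 < ∑ s ∈ Finset.range P, q (m * P + s) i ω := by
  have : (0 : ℝ) < P := Nat.cast_pos.2 hP
  rw [← qbar_mul hP, mul_pos_iff_of_pos_left this]

section Window

variable [MeasurableSpace Ω] {μ : Measure Ω} (h : c.Valid μ)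
include h

namespace Valid

lemma lt_R {m s : ℕ} (hm : m < c.R / c.P) (hs : s < c.P) : m * c.P + s < c.R := by
  have h1 : (m + 1) * c.P ≤ c.R / c.P * c.P := Nat.mul_le_mul_right _ hm
  rw [Nat.div_mul_cancel h.dvd] at h1
  rw [Nat.succ_mul] at h1
  omega

lemma mul_le_R {m : ℕ} (hm : m ≤ c.R / c.P) : m * c.P ≤ c.R :=
  (Nat.mul_le_mul_right _ hm).trans (Nat.div_mul_le_self _ _)

lemma good_ae : ∀ᵐ ω ∂μ, c.Good ω := by
  unfold Good
  rw [ae_all_iff]; intro r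
  by_cases hr : r < c.R
  · filter_upwards [h.part.nonneg r hr, h.part.sum_eq_one r hr, h.part.sum_sq_le r hr]
      with ω h1 h2 h3 _ using ⟨h1, h2, h3⟩
  · exact Eventually.of_forall fun ω hr' => absurd hr' hr

lemma qbar_nonneg {ω : Ω} (hω : c.Good ω) {m : ℕ} (hm : m < c.R / c.P) (i : Fin N) :
    0 ≤ qbar c.q c.P m i ω :=
  mul_nonneg (by positivity) (Finset.sum_nonneg fun s hs =>
    (hω _ (h.lt_R hm (Finset.mem_range.1 hs))).1 i)

lemma sum_qbar {ω : Ω} (hω : c.Good ω) {m : ℕ} (hm : m < c.R / c.P) :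
    ∑ i, qbar c.q c.P m i ω = 1 := by
  have hP : (0 : ℝ) < c.P := Nat.cast_pos.2 h.P_pos
  simp_rw [qbar]
  rw [← Finset.mul_sum, Finset.sum_comm, Finset.sum_congr rfl fun s hs =>
    (hω _ (h.lt_R hm (Finset.mem_range.1 hs))).2.1]
  simp [hP.ne']

lemma qbar_le_one {ω : Ω} (hω : c.Good ω) {m : ℕ} (hm : m < c.R / c.P) (i : Fin N) :
    qbar c.q c.P m i ω ≤ 1 := by
  rw [← h.sum_qbar hω hm]
  exact Finset.single_le_sum (f := fun i => qbar c.q c.P m i ω)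
    (fun j _ => h.qbar_nonneg hω hm j) (Finset.mem_univ i)

lemma measurable_qbar {m : ℕ} (hm : m < c.R / c.P) (i : Fin N) :
    Measurable[c.weightAlg] (qbar c.q c.P m i) := by
  refine Measurable.const_mul (Finset.measurable_sum (Finset.range c.P) fun s hs => ?_) _
  exact c.measurable_q_weightAlg (h.lt_R hm (Finset.mem_range.1 hs)) i

lemma aemeasurable_qbar {m : ℕ} (hm : m < c.R / c.P) (i : Fin N) :
    Measurable (qbar c.q c.P m i) := (h.measurable_qbar hm i).mono h.weightAlg_le le_rfl

omit h in
lemma pastQ_le_weightAlg {r : ℕ} (hr : r ≤ c.R) : pastQ c.q r ≤ c.weightAlg :=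
  iSup_le fun s => iSup_le fun i =>
    Measurable.comap_le (c.measurable_q_weightAlg (s.2.trans_le hr) i)

lemma windowAlg_le {m : ℕ} (hm : m ≤ c.R / c.P) : c.windowAlg m ≤ ‹MeasurableSpace Ω› :=
  sup_le ((pastQ_le_weightAlg (h.mul_le_R hm)).trans h.weightAlg_le) h.sampleAlg_le

omit h in
lemma measurable_q_windowAlg {m r : ℕ} (hr : r < m * c.P) (i : Fin N) :
    Measurable[c.windowAlg m] (c.q r i) := by
  have h1 : MeasurableSpace.comap (c.q r i) inferInstance ≤ pastQ c.q (m * c.P) :=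
    le_iSup₂_of_le (f := fun (s : Fin (m * c.P)) (i : Fin N) =>
      MeasurableSpace.comap (c.q s i) inferInstance) ⟨r, hr⟩ i le_rfl
  exact (comap_measurable (c.q r i)).mono (h1.trans le_sup_left) le_rfl

omit h in
lemma measurable_S_windowAlg (m : ℕ) (j : c.Idx) : Measurable[c.windowAlg m] (c.S j) :=
  (c.measurable_S_sampleAlg j).mono le_sup_right le_rfl

/-- Adaptedness is needed in the weights only. All samples, even future ones, may be included,
because participation is independent of them. -/
lemma measurable_X_windowAlg {m : ℕ} (hm : m ≤ c.R / c.P) : Measurable[c.windowAlg m] (c.X m) :=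
  (h.measurable_state (h.mul_le_R hm) (fun _ hs i => measurable_q_windowAlg hs i)
    fun j _ => measurable_S_windowAlg m j).1

lemma measurable_G_windowAlg {m : ℕ} (hm : m ≤ c.R / c.P) (i : Fin N) :
    Measurable[c.windowAlg m] (c.G m i) :=
  (h.measurable_state (h.mul_le_R hm) (fun _ hs i => measurable_q_windowAlg hs i)
    fun j _ => measurable_S_windowAlg m j).2 i

variable [IsProbabilityMeasure μ]

lemma integrable_qbar {m : ℕ} (hm : m < c.R / c.P) (i : Fin N) :
    Integrable (qbar c.q c.P m i) μ := by
  refine (integrable_const (1 : ℝ)).mono' (h.aemeasurable_qbar hm i).aestronglyMeasurable ?_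
  filter_upwards [h.good_ae] with ω hω
  rw [Real.norm_eq_abs, abs_of_nonneg (h.qbar_nonneg hω hm i)]
  exact h.qbar_le_one hω hm i

lemma integrable_qbar_mul {m : ℕ} (hm : m < c.R / c.P) (i : Fin N) {f : Ω → ℝ}
    (hf : Integrable f μ) : Integrable (fun ω => qbar c.q c.P m i ω * f ω) μ := by
  refine hf.bdd_mul (c := 1) (h.aemeasurable_qbar hm i).aestronglyMeasurable ?_
  filter_upwards [h.good_ae] with ω hω
  rw [Real.norm_eq_abs, abs_of_nonneg (h.qbar_nonneg hω hm i)]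
  exact h.qbar_le_one hω hm i

/-- Participation is unbiased, also conditionally on the samples. -/
lemma integral_qbar_mul {m : ℕ} (hm : m < c.R / c.P) (i : Fin N) {f : Ω → ℝ}
    (hfm : Measurable[c.windowAlg m] f) (hf : Integrable f μ) :
    ∫ ω, qbar c.q c.P m i ω * f ω ∂μ = 1 / (N : ℝ) * ∫ ω, f ω ∂μ := by
  refine integral_mul_of_condExp_eq_const (h.windowAlg_le hm.le) ?_ (h.integrable_qbar hm i)
    hfm.stronglyMeasurable (h.integrable_qbar_mul hm i hf)
  exact (condExp_sup_of_indep (pastQ_le_weightAlg (h.mul_le_R hm.le)) h.weightAlg_le h.sampleAlg_le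
    h.indep_weightAlg_sampleAlg (h.measurable_qbar hm i).stronglyMeasurable
    (h.integrable_qbar hm i)).trans (h.part.unbiased m hm i)

/-- Applied to the inner product of ∇f(X) with a control error, this removes the control variates
from the first-order term of the descent. -/
lemma integral_vDev_mul {m : ℕ} (hm : m < c.R / c.P) (i : Fin N) {f : Ω → ℝ}
    (hfm : Measurable[c.windowAlg m] f) (hf : Integrable f μ) :
    ∫ ω, vDev c.q c.P m i ω * f ω ∂μ = 0 := by
  simp_rw [vDev, sub_mul]
  rw [integral_sub (h.integrable_qbar_mul hm i hf) (hf.const_mul _), h.integral_qbar_mul hm i hfm hf,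
    integral_const_mul, sub_self]

/-- A client is sampled with probability at least `p`, also conditionally on the samples. -/
lemma integral_not_sampled_le {m : ℕ} (hm : m < c.R / c.P) (i : Fin N) {f : Ω → ℝ}
    (hfm : Measurable[c.windowAlg m] f) (hf : Integrable f μ) (hf0 : ∀ ω, 0 ≤ f ω) :
    ∫ ω, (if 0 < qbar c.q c.P m i ω then 0 else f ω) ∂μ ≤ (1 - c.p) * ∫ ω, f ω ∂μ := by
  set A : Set Ω := {ω | 0 < qbar c.q c.P m i ω} with hA
  have hAm : MeasurableSet[c.weightAlg] A :=
    measurableSet_lt measurable_const (h.measurable_qbar hm i)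
  have e : (fun ω => if 0 < qbar c.q c.P m i ω then 0 else f ω) = Aᶜ.indicator f := by
    funext ω
    by_cases hω : 0 < qbar c.q c.P m i ω <;> simp [hA, hω]
  rw [e]
  refine integral_indicator_mul_le_of_le_condExp (h.windowAlg_le hm.le) (h.weightAlg_le _ hAm) ?_
    hfm.stronglyMeasurable hf hf0
  have hce := condExp_sup_of_indep (pastQ_le_weightAlg (h.mul_le_R hm.le)) h.weightAlg_le
    h.sampleAlg_le h.indep_weightAlg_sampleAlg
    (X := A.indicator fun _ => (1 : ℝ)) (stronglyMeasurable_const.indicator hAm)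
    ((integrable_const 1).indicator (h.weightAlg_le _ hAm))
  filter_upwards [hce, h.part.sampled m hm i] with ω h1 h2
  rw [h1]
  exact h2

end Valid

end Window

end Experiment

/-! ### Control variates as weighted averages of past gradients -/

namespace Experiment

variable {d N : ℕ} {Ω Ξ : Type*} [MeasurableSpace Ξ] (c : Experiment d N Ω Ξ)

noncomputable section

/-- The weight of a gradient of round slot `t` in the control variate of client `i` in window
`m`. -/
def coef : ℕ → Fin N → (Fin c.P ⊕ Fin c.R) → Ω → ℝ
  | 0, _, t, _ => Sum.elim (fun _ => 1 / ((c.I : ℝ) * c.P)) (fun _ => 0) t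
  | m + 1, i, t, ω =>
    if 0 < qbar c.q c.P m i ω then
      Sum.elim (fun _ => 0) (fun r : Fin c.R => if (r : ℕ) / c.P = m then
        1 / ((∑ s ∈ Finset.range c.P, c.q (m * c.P + s) i ω) * c.I) * c.q r i ω else 0) t
    else coef m i t ω

/-- The control variates without the gradient noise. -/
def Ghat : ℕ → Fin N → Ω → Vec d
  | 0, i, _ => c.df i c.x₀
  | m + 1, i, ω =>
    if 0 < qbar c.q c.P m i ω then
      (1 / ((∑ s ∈ Finset.range c.P, c.q (m * c.P + s) i ω) * c.I)) •
        ∑ s ∈ Finset.range c.P, c.q (m * c.P + s) i ω • ∑ k ∈ Finset.range c.I,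
          c.df i (c.Y (m * c.P + s) i k ω)
    else Ghat m i ω

/-- The noise of the control variates. -/
def Gnoise (m : ℕ) (i : Fin N) (ω : Ω) : Vec d :=
  ∑ t, ∑ k, c.coef m i t ω • c.gradNoise (t, k, i) ω

/-- The weighted average of the local updates of round `r`. -/
def upd (r : ℕ) (ω : Ω) : Vec d := ∑ i, c.q r i ω • (c.Y r i c.I ω - (c.state r ω).x)

/-- The average of the control variates of window `m`. -/
def Gbar (m : ℕ) (ω : Ω) : Vec d := (1 / (N : ℝ)) • ∑ j, c.G m j ω

variable {c}

/-- Noises are indexed by all rounds, weights by their position in a window; this translates between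
the two. -/
lemma sum_window {E : Type*} [AddCommMonoid E] {R P m : ℕ} (hP : 0 < P) (hm : (m + 1) * P ≤ R)
    (f : ℕ → E) :
    ∑ r : Fin R, (if (r : ℕ) / P = m then f r else 0) = ∑ s ∈ Finset.range P, f (m * P + s) := by
  rw [← Finset.sum_range (fun r => if r / P = m then f r else 0), ← Finset.sum_filter]
  refine Finset.sum_nbij' (fun r => r - m * P) (fun s => m * P + s) ?_ ?_ ?_ ?_ ?_
  · intro r hr
    obtain ⟨-, h2⟩ := Finset.mem_filter.1 hr
    have := (Nat.div_eq_iff hP).1 h2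
    simp only [Finset.mem_range]
    omega
  · intro s hs
    have hs := Finset.mem_range.1 hs
    rw [Nat.succ_mul] at hm
    simp only [Finset.mem_filter, Finset.mem_range]
    refine ⟨by omega, ?_⟩
    rw [Nat.mul_comm, Nat.mul_add_div hP, Nat.div_eq_of_lt hs, add_zero]
  · intro r hr
    obtain ⟨-, h2⟩ := Finset.mem_filter.1 hr
    have := (Nat.div_eq_iff hP).1 h2
    omega
  · intro s _
    omega
  · intro r hr
    obtain ⟨-, h2⟩ := Finset.mem_filter.1 hr
    have := (Nat.div_eq_iff hP).1 h2
    congr 1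
    omega

section Valid

variable [MeasurableSpace Ω] {μ : Measure Ω} (h : c.Valid μ)
include h

namespace Valid

lemma succ_mul_le {m : ℕ} (hm : m < c.R / c.P) : (m + 1) * c.P ≤ c.R := h.mul_le_R hm

lemma X_succ (m : ℕ) (ω : Ω) :
    c.X (m + 1) ω = c.X m ω + c.γ • ∑ s ∈ Finset.range c.P, c.upd (m * c.P + s) ω :=
  (run_window_succ c.I c.P c.η c.γ c.x₀ _ _ _ h.P_pos m).1

lemma state_x_eq (m : ℕ) {s : ℕ} (hs : s < c.P) (ω : Ω) :
    (c.state (m * c.P + s) ω).x =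
      c.X m ω + ∑ t ∈ Finset.range s, c.upd (m * c.P + t) ω :=
  (run_window c.I c.P c.η c.γ c.x₀ _ _ _ h.P_pos m s hs).2.2.1

lemma Y_eq (m : ℕ) {s : ℕ} (hs : s < c.P) (i : Fin N) (k : ℕ) (ω : Ω) :
    c.Y (m * c.P + s) i k ω = (c.state (m * c.P + s) ω).x -
      c.η • ∑ l ∈ Finset.range k, (c.df i (c.Y (m * c.P + s) i l ω) + c.noise (m * c.P + s) l i ω -
        c.G m i ω + c.Gbar m ω) := by
  refine (localModel_eq_sum c.I c.P c.η c.γ c.x₀ _ _ _ h.P_pos m s hs i k).trans ?_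
  congr 2
  refine Finset.sum_congr rfl fun l _ => ?_
  rw [noise, add_sub_cancel]
  rfl

lemma G_succ (m : ℕ) (i : Fin N) (ω : Ω) :
    c.G (m + 1) i ω = if 0 < qbar c.q c.P m i ω then
      (1 / ((∑ s ∈ Finset.range c.P, c.q (m * c.P + s) i ω) * c.I)) •
        ∑ s ∈ Finset.range c.P, c.q (m * c.P + s) i ω • ∑ k ∈ Finset.range c.I,
          (c.df i (c.Y (m * c.P + s) i k ω) + c.noise (m * c.P + s) k i ω)
      else c.G m i ω := by
  have := (run_window_succ c.I c.P c.η c.γ c.x₀ (initControl c.F c.I c.P c.x₀ c.ξ₀ ω)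
    (fun s i => c.q s i ω) (fun s i k x => stochGrad c.F i x (c.ξ s k i ω)) h.P_pos m).2 i
  simp only [qbar_pos_iff h.P_pos m i ω]
  refine this.trans ?_
  split_ifs
  · congr 1
    refine Finset.sum_congr rfl fun s _ => ?_
    congr 1
    refine Finset.sum_congr rfl fun k _ => ?_
    rw [noise, add_sub_cancel]
    rfl
  · rfl

/-- Each stored gradient is ∇f_i plus noise, and which window it comes from depends on the weights
only. All the noise therefore sits in one linear combination with weight-measurable coefficients, to
which the orthogonality estimate applies. -/
lemma G_eq_add {m : ℕ} (hm : m ≤ c.R / c.P) (i : Fin N) (ω : Ω) :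
    c.G m i ω = c.Ghat m i ω + c.Gnoise m i ω := by
  have hP : (0 : ℝ) < c.P := Nat.cast_pos.2 h.P_pos
  have hI : (0 : ℝ) < c.I := Nat.cast_pos.2 h.I_pos
  induction m with
  | zero =>
    have e : c.G 0 i ω = initControl c.F c.I c.P c.x₀ c.ξ₀ ω i := by
      simp [G, state, run]
    rw [e]
    simp only [Ghat, Gnoise, coef, Fintype.sum_sum_type, Sum.elim_inl, Sum.elim_inr, zero_smul,
      Finset.sum_const_zero, add_zero, ← Finset.smul_sum]
    have e2 : ∀ s k, c.gradNoise (Sum.inl s, k, i) ω =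
        stochGrad c.F i c.x₀ (c.ξ₀ s k i ω) - c.df i c.x₀ := fun _ _ => rfl
    simp only [e2, Finset.sum_sub_distrib, Finset.sum_const, Finset.card_univ, Fintype.card_fin,
      smul_sub]
    rw [← Nat.cast_smul_eq_nsmul ℝ, ← Nat.cast_smul_eq_nsmul ℝ, smul_smul, smul_smul]
    have e3 : 1 / ((c.I : ℝ) * c.P) * (c.P * c.I) = 1 := by field_simp
    rw [mul_assoc, e3, one_smul, add_sub_cancel, initControl, Finset.sum_range]
    simp_rw [Finset.sum_range]
  | succ m ih =>
    rw [h.G_succ]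
    by_cases hq : 0 < qbar c.q c.P m i ω
    · simp only [Ghat, Gnoise, coef, if_pos hq, Fintype.sum_sum_type, Sum.elim_inl, Sum.elim_inr,
        zero_smul, Finset.sum_const_zero, zero_add, Finset.sum_add_distrib, smul_add]
      congr 1
      set w := 1 / ((∑ s ∈ Finset.range c.P, c.q (m * c.P + s) i ω) * c.I) with hw
      have key := sum_window h.P_pos (h.succ_mul_le hm)
        (fun r => (w * c.q r i ω) • ∑ k ∈ Finset.range c.I, c.noise r k i ω)
      simp_rw [mul_smul, ← Finset.smul_sum] at key
      rw [← key]
      refine Finset.sum_congr rfl fun r _ => ?_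
      split_ifs
      · rw [← Finset.smul_sum, mul_smul, Finset.sum_range]
        rfl
      · simp
    · simp only [Ghat, Gnoise, coef, if_neg hq]
      exact ih (by omega)

lemma coef_nonneg {ω : Ω} (hω : c.Good ω) {m : ℕ} (hm : m ≤ c.R / c.P) (i : Fin N)
    (t : Fin c.P ⊕ Fin c.R) : 0 ≤ c.coef m i t ω := by
  induction m with
  | zero => cases t <;> simp [coef]; positivity
  | succ m ih =>
    rw [coef]
    split_ifs with hq
    · cases t with
      | inl s => simp
      | inr r =>
        rw [qbar_pos_iff h.P_pos] at hq
        simp only [Sum.elim_inr]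
        split_ifs
        · exact mul_nonneg (by positivity) ((hω r r.2).1 i)
        · exact le_rfl
    · exact ih (by omega)

/-- The total is 1/I and not 1 because a slot carries one coefficient for all its I local steps. -/
lemma sum_coef {m : ℕ} (hm : m ≤ c.R / c.P) (i : Fin N) (ω : Ω) :
    ∑ t, c.coef m i t ω = 1 / c.I := by
  have hP : (0 : ℝ) < c.P := Nat.cast_pos.2 h.P_pos
  have hI : (0 : ℝ) < c.I := Nat.cast_pos.2 h.I_pos
  induction m with
  | zero =>
    simp only [coef, Fintype.sum_sum_type, Sum.elim_inl, Sum.elim_inr, Finset.sum_const_zero,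
      add_zero, Finset.sum_const, Finset.card_univ, Fintype.card_fin, nsmul_eq_mul]
    field_simp
  | succ m ih =>
    by_cases hq : 0 < qbar c.q c.P m i ω
    · simp only [coef, if_pos hq, Fintype.sum_sum_type, Sum.elim_inl, Sum.elim_inr,
        Finset.sum_const_zero, zero_add]
      rw [sum_window h.P_pos (h.succ_mul_le hm) (fun r =>
        1 / ((∑ s ∈ Finset.range c.P, c.q (m * c.P + s) i ω) * c.I) * c.q r i ω),
        ← Finset.mul_sum]
      rw [qbar_pos_iff h.P_pos] at hq
      field_simp
    · simp only [coef, if_neg hq]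
      exact ih (by omega)

lemma coef_le {ω : Ω} (hω : c.Good ω) {m : ℕ} (hm : m ≤ c.R / c.P) (i : Fin N)
    (t : Fin c.P ⊕ Fin c.R) : c.coef m i t ω ≤ 1 / c.I := by
  rw [← h.sum_coef hm i ω]
  exact Finset.single_le_sum (f := fun t => c.coef m i t ω)
    (fun t _ => h.coef_nonneg hω hm i t) (Finset.mem_univ t)

lemma abs_coef_le_one {ω : Ω} (hω : c.Good ω) {m : ℕ} (hm : m ≤ c.R / c.P) (i : Fin N)
    (t : Fin c.P ⊕ Fin c.R) : |c.coef m i t ω| ≤ 1 := by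
  have hI : (1 : ℝ) ≤ c.I := Nat.one_le_cast.2 h.I_pos
  rw [abs_of_nonneg (h.coef_nonneg hω hm i t)]
  exact (h.coef_le hω hm i t).trans (by rw [div_le_one (by linarith)]; exact hI)

/-- Crude bound, valid without any control on Λ: a client may have drawn its control variate from
essentially a single round. -/
lemma sum_sq_coef_le {ω : Ω} (hω : c.Good ω) {m : ℕ} (hm : m ≤ c.R / c.P) (i : Fin N) :
    ∑ t, c.coef m i t ω ^ 2 ≤ (1 / c.I) ^ 2 := by
  calc ∑ t, c.coef m i t ω ^ 2 ≤ ∑ t, 1 / c.I * c.coef m i t ω := by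
        refine Finset.sum_le_sum fun t _ => ?_
        rw [sq]
        exact mul_le_mul_of_nonneg_right (h.coef_le hω hm i t) (h.coef_nonneg hω hm i t)
    _ = (1 / c.I) ^ 2 := by rw [← Finset.mul_sum, h.sum_coef hm, sq]

/-- Identifies Λ as the loss of averaging due to uneven weights (it is 1 for uniform ones). This is
how the regularity condition on Λ enters the noise bound. -/
lemma sum_sq_coef {m : ℕ} (hm : m ≤ c.R / c.P) (i : Fin N) (ω : Ω) :
    ∑ t, c.coef m i t ω ^ 2 = Lam c.q c.P m i ω / (c.P * c.I ^ 2) := by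
  have hP : (0 : ℝ) < c.P := Nat.cast_pos.2 h.P_pos
  have hI : (0 : ℝ) < c.I := Nat.cast_pos.2 h.I_pos
  induction m with
  | zero =>
    simp only [coef, Fintype.sum_sum_type, Sum.elim_inl, Sum.elim_inr, Finset.sum_const_zero,
      add_zero, Finset.sum_const, Finset.card_univ, Fintype.card_fin, nsmul_eq_mul, Lam, zWeight,
      Finset.card_range, ne_eq, OfNat.ofNat_ne_zero, not_false_eq_true, zero_pow, one_pow]
    field_simp
  | succ m ih =>
    by_cases hq : 0 < qbar c.q c.P m i ω
    · simp only [coef, if_pos hq, Fintype.sum_sum_type, Sum.elim_inl, Sum.elim_inr, Lam, zWeight,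
        Finset.sum_const_zero, zero_add, ne_eq, OfNat.ofNat_ne_zero, not_false_eq_true, zero_pow,
        ite_pow]
      rw [sum_window h.P_pos (h.succ_mul_le hm) (fun r =>
        (1 / ((∑ s ∈ Finset.range c.P, c.q (m * c.P + s) i ω) * c.I) * c.q r i ω) ^ 2)]
      simp_rw [mul_pow]
      rw [← Finset.mul_sum]
      rw [qbar_pos_iff h.P_pos] at hq
      field_simp
    · have e : Lam c.q c.P (m + 1) i ω = Lam c.q c.P m i ω := by
        simp only [Lam, zWeight, if_neg hq]
      rw [e, ← ih (by omega)]
      simp only [coef, if_neg hq]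

lemma measurable_coef {m : ℕ} (hm : m ≤ c.R / c.P) (i : Fin N) (t : Fin c.P ⊕ Fin c.R) :
    Measurable[c.weightAlg] (c.coef m i t) := by
  induction m with
  | zero => exact measurable_const
  | succ m ih =>
    have hq : ∀ s ∈ Finset.range c.P, Measurable[c.weightAlg] (c.q (m * c.P + s) i) :=
      fun s hs => c.measurable_q_weightAlg (h.lt_R hm (Finset.mem_range.1 hs)) i
    have e : c.coef (m + 1) i t = fun ω => if 0 < qbar c.q c.P m i ω then
      Sum.elim (fun _ => 0) (fun r : Fin c.R => if (r : ℕ) / c.P = m then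
        1 / ((∑ s ∈ Finset.range c.P, c.q (m * c.P + s) i ω) * c.I) * c.q r i ω else 0) t
      else c.coef m i t ω := rfl
    rw [e]
    refine Measurable.ite (measurableSet_lt measurable_const (h.measurable_qbar hm i)) ?_
      (ih (by omega))
    cases t with
    | inl s => exact measurable_const
    | inr r =>
      simp only [Sum.elim_inr]
      split_ifs
      · exact (((Finset.measurable_sum _ hq).mul_const _).const_div 1).mul
          (c.measurable_q_weightAlg r.2 i)
      · exact measurable_const

end Valid

end Valid

end

end Experiment

/-! ### Square integrability of all iterates -/

namespace Experiment

variable {d N : ℕ} {Ω Ξ : Type*} [MeasurableSpace Ξ] {c : Experiment d N Ω Ξ}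

variable [MeasurableSpace Ω] {μ : Measure Ω} [IsProbabilityMeasure μ] (h : c.Valid μ)
include h

namespace Valid

lemma memLp_df (i : Fin N) {v : Ω → Vec d} (hv : MemLp v 2 μ) :
    MemLp (fun ω => c.df i (v ω)) 2 μ := by
  refine MemLp.mono' ((memLp_const ‖c.df i 0‖).add (hv.norm.const_mul c.L))
    ((h.continuous_df i).comp_aestronglyMeasurable hv.1) (Eventually.of_forall fun ω => ?_)
  have h1 := h.lipschitz_df i (v ω) 0
  have h2 := norm_add_le (c.df i 0) (c.df i (v ω) - c.df i 0)
  rw [add_sub_cancel] at h2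
  rw [sub_zero] at h1
  simp only [Pi.add_apply]
  linarith

lemma memLp_dF {v : Ω → Vec d} (hv : MemLp v 2 μ) : MemLp (fun ω => c.dF (v ω)) 2 μ := by
  simp_rw [h.dF_eq]
  exact (memLp_finsetSum Finset.univ fun i _ => h.memLp_df i hv).const_smul (1 / (N : ℝ))

lemma memLp_noise {r k : ℕ} (hr : r < c.R) (hk : k < c.I) (i : Fin N) :
    MemLp (c.noise r k i) 2 μ :=
  h.memLp_gradNoise (Sum.inr ⟨r, hr⟩, ⟨k, hk⟩, i)

lemma memLp_q_smul {E : Type*} [NormedAddCommGroup E] [NormedSpace ℝ E] {r : ℕ} (hr : r < c.R)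
    (i : Fin N) {v : Ω → E} (hv : MemLp v 2 μ) : MemLp (fun ω => c.q r i ω • v ω) 2 μ := by
  refine memLp_smul_of_bound (K := 1) (h.part.measurable r hr i).aestronglyMeasurable ?_ hv
  filter_upwards [h.good_ae] with ω hω
  rw [abs_of_nonneg ((hω r hr).1 i)]
  exact hω.q_le_one hr i

lemma memLp_Gbar {m : ℕ} (hG : ∀ i, MemLp (c.G m i) 2 μ) : MemLp (c.Gbar m) 2 μ :=
  (memLp_finsetSum Finset.univ fun i _ => hG i).const_smul (1 / (N : ℝ))

/-- Nested strong induction, over rounds and over local steps, since every iterate is a sum over all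
its predecessors. -/
lemma memLp_window {m : ℕ} (hm : m < c.R / c.P) (hX : MemLp (c.X m) 2 μ)
    (hG : ∀ i, MemLp (c.G m i) 2 μ) {s : ℕ} (hs : s < c.P) :
    MemLp (fun ω => (c.state (m * c.P + s) ω).x) 2 μ ∧
      (∀ i, ∀ k ≤ c.I, MemLp (c.Y (m * c.P + s) i k) 2 μ) ∧
      MemLp (c.upd (m * c.P + s)) 2 μ := by
  induction s using Nat.strong_induction_on with
  | _ s ih =>
  have hr := h.lt_R hm hs
  have hx : MemLp (fun ω => (c.state (m * c.P + s) ω).x) 2 μ := by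
    simp_rw [h.state_x_eq m hs]
    refine hX.add (memLp_finsetSum _ fun t ht => ?_)
    have := Finset.mem_range.1 ht
    exact (ih t this (by omega)).2.2
  have hY : ∀ i, ∀ k ≤ c.I, MemLp (c.Y (m * c.P + s) i k) 2 μ := by
    intro i k
    induction k using Nat.strong_induction_on with
    | _ k ihk =>
    intro hk
    have hsum : MemLp (fun ω => ∑ l ∈ Finset.range k, (c.df i (c.Y (m * c.P + s) i l ω) +
        c.noise (m * c.P + s) l i ω - c.G m i ω + c.Gbar m ω)) 2 μ := by
      refine memLp_finsetSum (Finset.range k) fun l hl => ?_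
      have hl := Finset.mem_range.1 hl
      exact (((h.memLp_df i (ihk l hl (by omega))).add (h.memLp_noise hr (by omega) i)).sub
        (hG i)).add (h.memLp_Gbar hG)
    have e : c.Y (m * c.P + s) i k = fun ω => (c.state (m * c.P + s) ω).x -
      c.η • ∑ l ∈ Finset.range k, (c.df i (c.Y (m * c.P + s) i l ω) + c.noise (m * c.P + s) l i ω -
        c.G m i ω + c.Gbar m ω) := funext fun ω => h.Y_eq m hs i k ω
    rw [e]
    exact hx.sub (hsum.const_smul c.η)
  exact ⟨hx, hY, memLp_finsetSum Finset.univ fun i _ =>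
    h.memLp_q_smul hr i ((hY i c.I le_rfl).sub hx)⟩

/-- Square integrability of the weighted averages that form the control variates. -/
lemma memLp_window_average {m : ℕ} (hm : m < c.R / c.P) (i : Fin N) {v : ℕ → Ω → Vec d}
    {g : Ω → Vec d} (hv : ∀ s < c.P, MemLp (v s) 2 μ) (hg : MemLp g 2 μ) :
    MemLp (fun ω => if 0 < qbar c.q c.P m i ω then
      (1 / ((∑ s ∈ Finset.range c.P, c.q (m * c.P + s) i ω) * c.I)) •
        ∑ s ∈ Finset.range c.P, c.q (m * c.P + s) i ω • v s ω else g ω) 2 μ := by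
  have hI : (1 : ℝ) ≤ c.I := Nat.one_le_cast.2 h.I_pos
  have hqm : ∀ s ∈ Finset.range c.P, Measurable (c.q (m * c.P + s) i) := fun s hs =>
    h.part.measurable _ (h.lt_R hm (Finset.mem_range.1 hs)) i
  set A : Set Ω := {ω | 0 < qbar c.q c.P m i ω} with hA
  have hAm : MeasurableSet A := measurableSet_lt measurable_const (h.aemeasurable_qbar hm i)
  -- The normalising sum may be arbitrarily small, but the normalised weights stay in [0, 1], since
  -- each weight is at most the sum and I ≥ 1.
  set a : ℕ → Ω → ℝ := fun s ω => A.indicator (fun ω =>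
    1 / ((∑ s ∈ Finset.range c.P, c.q (m * c.P + s) i ω) * c.I) * c.q (m * c.P + s) i ω) ω with ha
  have e : (fun ω => if 0 < qbar c.q c.P m i ω then
      (1 / ((∑ s ∈ Finset.range c.P, c.q (m * c.P + s) i ω) * c.I)) •
        ∑ s ∈ Finset.range c.P, c.q (m * c.P + s) i ω • v s ω else g ω) =
      fun ω => ∑ s ∈ Finset.range c.P, a s ω • v s ω + Aᶜ.indicator g ω := by
    funext ω
    by_cases hω : 0 < qbar c.q c.P m i ω
    · simp [ha, hA, hω, Finset.smul_sum, mul_smul]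
    · simp [ha, hA, hω]
  rw [e]
  refine (memLp_finsetSum (Finset.range c.P) fun s hs => ?_).add (hg.indicator hAm.compl)
  refine memLp_smul_of_bound (K := 1) ?_ ?_ (hv s (Finset.mem_range.1 hs))
  · exact (((((Finset.measurable_sum (Finset.range c.P) hqm).mul_const _).const_div 1).mul
      (hqm s hs)).indicator hAm).aestronglyMeasurable
  · filter_upwards [h.good_ae] with ω hω
    simp only [ha, Set.indicator]
    split_ifs with hωA
    · have hpos : 0 < ∑ s ∈ Finset.range c.P, c.q (m * c.P + s) i ω :=
        (qbar_pos_iff h.P_pos m i ω).1 hωA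
      have h0 : ∀ s ∈ Finset.range c.P, 0 ≤ c.q (m * c.P + s) i ω := fun s hs =>
        (hω _ (h.lt_R hm (Finset.mem_range.1 hs))).1 i
      rw [abs_of_nonneg (mul_nonneg (by positivity) (h0 s hs)), one_div_mul_eq_div,
        div_le_one (by positivity)]
      exact (Finset.single_le_sum (f := fun s => c.q (m * c.P + s) i ω) h0 hs).trans
        (le_mul_of_one_le_right hpos.le hI)
    · simp

/-- The three claims must be proved together: models need the control variates of their window, and
the noiseless control variates need the models of the window before. -/
lemma memLp_X_G {m : ℕ} (hm : m ≤ c.R / c.P) :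
    MemLp (c.X m) 2 μ ∧ (∀ i, MemLp (c.G m i) 2 μ) ∧ ∀ i, MemLp (c.Ghat m i) 2 μ := by
  have hnoise : ∀ m ≤ c.R / c.P, ∀ i, MemLp (c.Gnoise m i) 2 μ := fun m hm i =>
    memLp_finsetSum _ fun t _ => memLp_finsetSum _ fun k _ =>
      memLp_smul_of_bound (K := 1)
        ((h.measurable_coef hm i t).mono h.weightAlg_le le_rfl).aestronglyMeasurable
        (h.good_ae.mono fun ω hω => h.abs_coef_le_one hω hm i t) (h.memLp_gradNoise _)
  have hadd : ∀ m ≤ c.R / c.P, ∀ i, MemLp (c.Ghat m i) 2 μ → MemLp (c.G m i) 2 μ := by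
    intro m hm i hi
    have e : c.G m i = fun ω => c.Ghat m i ω + c.Gnoise m i ω := funext fun ω => h.G_eq_add hm i ω
    rw [e]
    exact hi.add (hnoise m hm i)
  induction m with
  | zero =>
    have h0 : ∀ i, MemLp (c.Ghat 0 i) 2 μ := fun i => memLp_const (c.df i c.x₀)
    refine ⟨?_, fun i => hadd 0 hm i (h0 i), h0⟩
    have : c.X 0 = fun _ => c.x₀ := by
      funext ω; simp [X, state, run]
    rw [this]
    exact memLp_const _
  | succ m ih =>
    obtain ⟨hX, hG, hGh⟩ := ih (by omega)
    have hw := fun s (hs : s < c.P) => h.memLp_window (by omega : m < c.R / c.P) hX hG hs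
    have h0 : ∀ i, MemLp (c.Ghat (m + 1) i) 2 μ := fun i =>
      h.memLp_window_average (by omega : m < c.R / c.P) i
        (v := fun s ω => ∑ k ∈ Finset.range c.I, c.df i (c.Y (m * c.P + s) i k ω))
        (fun s hs => memLp_finsetSum (Finset.range c.I) fun k hk =>
          h.memLp_df i ((hw s hs).2.1 i k (Finset.mem_range.1 hk).le)) (hGh i)
    refine ⟨?_, fun i => hadd _ hm i (h0 i), h0⟩
    have hsum : MemLp (fun ω => ∑ s ∈ Finset.range c.P, c.upd (m * c.P + s) ω) 2 μ :=
      memLp_finsetSum (Finset.range c.P) fun s hs => (hw s (Finset.mem_range.1 hs)).2.2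
    have e : c.X (m + 1) = fun ω => c.X m ω + c.γ • ∑ s ∈ Finset.range c.P,
      c.upd (m * c.P + s) ω := funext fun ω => h.X_succ m ω
    rw [e]
    exact hX.add (hsum.const_smul c.γ)

lemma memLp_X {m : ℕ} (hm : m ≤ c.R / c.P) : MemLp (c.X m) 2 μ := (h.memLp_X_G hm).1

lemma memLp_G {m : ℕ} (hm : m ≤ c.R / c.P) (i : Fin N) : MemLp (c.G m i) 2 μ :=
  (h.memLp_X_G hm).2.1 i

lemma memLp_Ghat {m : ℕ} (hm : m ≤ c.R / c.P) (i : Fin N) : MemLp (c.Ghat m i) 2 μ :=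
  (h.memLp_X_G hm).2.2 i

lemma memLp_Y {m s : ℕ} (hm : m < c.R / c.P) (hs : s < c.P) (i : Fin N) {k : ℕ} (hk : k ≤ c.I) :
    MemLp (c.Y (m * c.P + s) i k) 2 μ :=
  (h.memLp_window hm (h.memLp_X hm.le) (h.memLp_G hm.le) hs).2.1 i k hk

end Valid

end Experiment

/-! ### Pathwise drift of the local models within a window -/

section Drift

variable {E : Type*} [NormedAddCommGroup E] [NormedSpace ℝ E]

/-- Cauchy–Schwarz with weights. For weights of total one it is Jensen's inequality, the form used
for averages over clients and over rounds. -/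
lemma sq_norm_sum_smul_le {ι : Type*} (s : Finset ι) {w : ι → ℝ} (hw : ∀ i ∈ s, 0 ≤ w i)
    (v : ι → E) : ‖∑ i ∈ s, w i • v i‖ ^ 2 ≤ (∑ i ∈ s, w i) * ∑ i ∈ s, w i * ‖v i‖ ^ 2 := by
  have h1 : ‖∑ i ∈ s, w i • v i‖ ≤ ∑ i ∈ s, w i * ‖v i‖ := by
    refine (norm_sum_le _ _).trans (le_of_eq (Finset.sum_congr rfl fun i hi => ?_))
    rw [norm_smul, Real.norm_eq_abs, abs_of_nonneg (hw i hi)]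
  refine (pow_le_pow_left₀ (norm_nonneg _) h1 2).trans ?_
  exact Finset.sum_sq_le_sum_mul_sum_of_sq_le_mul s hw
    (fun i hi => mul_nonneg (hw i hi) (sq_nonneg _)) (fun i _ => le_of_eq (by ring))

lemma sq_norm_sum_le {ι : Type*} (s : Finset ι) (v : ι → E) :
    ‖∑ i ∈ s, v i‖ ^ 2 ≤ (s.card : ℝ) * ∑ i ∈ s, ‖v i‖ ^ 2 := by
  simpa using sq_norm_sum_smul_le s (w := fun _ => 1) (fun _ _ => zero_le_one) v

lemma sq_norm_add_le (a b : E) : ‖a + b‖ ^ 2 ≤ 2 * ‖a‖ ^ 2 + 2 * ‖b‖ ^ 2 := by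
  have h1 := pow_le_pow_left₀ (norm_nonneg _) (norm_add_le a b) 2
  nlinarith [sq_nonneg (‖a‖ - ‖b‖)]

lemma sq_norm_add₄_le (a b c e : E) :
    ‖a + b + c + e‖ ^ 2 ≤ 4 * (‖a‖ ^ 2 + ‖b‖ ^ 2 + ‖c‖ ^ 2 + ‖e‖ ^ 2) := by
  have h1 := sq_norm_add_le (a + b) (c + e)
  rw [← add_assoc] at h1
  linarith [sq_norm_add_le a b, sq_norm_add_le c e]

/-- The local models of one window, relative to the model `x` at its beginning: `n` is the gradient
noise, `h` the change of the gradient since the beginning of the window, `b` the error of the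
control variates, and `g` the gradient of the objective. -/
structure WindowDynamics {N : ℕ} (P I : ℕ) (η L : ℝ) (q : ℕ → Fin N → ℝ) (x g : E)
    (b : Fin N → E) (xs : ℕ → E) (y n h : ℕ → Fin N → ℕ → E) : Prop where
  nonneg : ∀ s < P, ∀ i, 0 ≤ q s i
  sum_eq : ∀ s < P, ∑ i, q s i = 1
  iter : ∀ s < P, ∀ i k, y s i k = xs s - η • ∑ l ∈ Finset.range k, (n s i l + h s i l + b i + g)
  server : ∀ s < P, xs s = x + ∑ t ∈ Finset.range s, ∑ i, q t i • (y t i I - xs t)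
  lip : ∀ s < P, ∀ i k, ‖h s i k‖ ≤ L * ‖y s i k - x‖

namespace WindowDynamics

variable {N P I : ℕ} {η L : ℝ} {q : ℕ → Fin N → ℝ} {x g : E} {b : Fin N → E} {xs : ℕ → E}
  {y n h : ℕ → Fin N → ℕ → E} (W : WindowDynamics P I η L q x g b xs y n h)

/-- Total squared distance of the local models of a round from the beginning of the window. -/
noncomputable def localDrift (I : ℕ) (x : E) (y : ℕ → Fin N → ℕ → E) (s : ℕ) (i : Fin N) : ℝ :=
  ∑ k ∈ Finset.range I, ‖y s i k - x‖ ^ 2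

/-- The participation-weighted sum over a window of a quantity of each round and client. -/
noncomputable def wsum (P : ℕ) (q : ℕ → Fin N → ℝ) (f : ℕ → Fin N → ℝ) : ℝ :=
  ∑ s ∈ Finset.range P, ∑ i, q s i * f s i

include W

lemma wsum_mono {f f' : ℕ → Fin N → ℝ} (hf : ∀ s < P, ∀ i, f s i ≤ f' s i) :
    wsum P q f ≤ wsum P q f' :=
  Finset.sum_le_sum fun s hs => Finset.sum_le_sum fun i _ =>
    mul_le_mul_of_nonneg_left (hf s (Finset.mem_range.1 hs) i) (W.nonneg s (Finset.mem_range.1 hs) i)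

lemma wsum_const (a : ℝ) : wsum P q (fun _ _ => a) = P * a := by
  simp_rw [wsum, ← Finset.sum_mul]
  rw [Finset.sum_congr rfl fun s hs => W.sum_eq s (Finset.mem_range.1 hs)]
  simp

lemma wsum_nonneg {f : ℕ → Fin N → ℝ} (hf : ∀ s < P, ∀ i, 0 ≤ f s i) : 0 ≤ wsum P q f := by
  have := W.wsum_mono (f := fun _ _ => 0) hf
  rwa [W.wsum_const, mul_zero] at this

omit W in
lemma wsum_add (f f' : ℕ → Fin N → ℝ) :
    wsum P q (fun s i => f s i + f' s i) = wsum P q f + wsum P q f' := by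
  simp_rw [wsum, mul_add, Finset.sum_add_distrib]

omit W in
lemma wsum_mul (a : ℝ) (f : ℕ → Fin N → ℝ) :
    wsum P q (fun s i => a * f s i) = a * wsum P q f := by
  simp_rw [wsum, Finset.mul_sum]
  refine Finset.sum_congr rfl fun s _ => Finset.sum_congr rfl fun i _ => by ring

/-- The noise is kept as one sum rather than split step by step: its second moment then grows like I
instead of I². -/
lemma sq_norm_localSum_le {s : ℕ} (hs : s < P) (i : Fin N) {k : ℕ} (hk : k ≤ I) :
    ‖∑ l ∈ Finset.range k, (n s i l + h s i l + b i + g)‖ ^ 2 ≤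
      4 * (‖∑ l ∈ Finset.range k, n s i l‖ ^ 2 + I * L ^ 2 * localDrift I x y s i +
        I ^ 2 * ‖b i‖ ^ 2 + I ^ 2 * ‖g‖ ^ 2) := by
  have hkI : (k : ℝ) ≤ I := Nat.cast_le.2 hk
  simp only [Finset.sum_add_distrib, Finset.sum_const, Finset.card_range]
  refine (sq_norm_add₄_le _ _ _ _).trans ?_
  have hconst : ∀ v : E, ‖k • v‖ ^ 2 ≤ (I : ℝ) ^ 2 * ‖v‖ ^ 2 := fun v => by
    rw [← Nat.cast_smul_eq_nsmul ℝ, norm_smul, mul_pow]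
    gcongr
    rw [Real.norm_eq_abs, abs_of_nonneg (Nat.cast_nonneg k)]
    exact hkI
  have hh : ‖∑ l ∈ Finset.range k, h s i l‖ ^ 2 ≤ I * L ^ 2 * localDrift I x y s i := by
    refine (sq_norm_sum_le _ _).trans ?_
    rw [Finset.card_range, mul_assoc, localDrift, Finset.mul_sum (Finset.range I)]
    refine mul_le_mul hkI ?_ (Finset.sum_nonneg fun _ _ => sq_nonneg _) (Nat.cast_nonneg _)
    refine (Finset.sum_le_sum fun l _ => ?_).trans (Finset.sum_le_sum_of_subset_of_nonneg
      (Finset.range_mono hk) fun l _ _ => by positivity)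
    rw [← mul_pow]
    exact pow_le_pow_left₀ (norm_nonneg _) (W.lip s hs i l) 2
  linarith [hconst (b i), hconst g]

/-- The bound on the drift of the server model within a window. -/
lemma sq_norm_server_sub_le {s : ℕ} (hs : s < P) :
    ‖xs s - x‖ ^ 2 ≤ 4 * η ^ 2 * P *
      (wsum P q (fun s i => ‖∑ l ∈ Finset.range I, n s i l‖ ^ 2) +
        I * L ^ 2 * wsum P q (localDrift I x y) + I ^ 2 * wsum P q (fun _ i => ‖b i‖ ^ 2) +
        I ^ 2 * P * ‖g‖ ^ 2) := by
  have h1 : xs s - x = ∑ t ∈ Finset.range s, ∑ i, q t i •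
      ((-η) • ∑ l ∈ Finset.range I, (n t i l + h t i l + b i + g)) := by
    rw [W.server s hs, add_sub_cancel_left]
    refine Finset.sum_congr rfl fun t ht => Finset.sum_congr rfl fun i _ => ?_
    rw [W.iter t ((Finset.mem_range.1 ht).trans hs) i I, sub_sub_cancel_left, neg_smul]
  have h2 : ‖xs s - x‖ ^ 2 ≤ P * wsum P q (fun t i =>
      ‖(-η) • ∑ l ∈ Finset.range I, (n t i l + h t i l + b i + g)‖ ^ 2) := by
    rw [h1]
    refine (sq_norm_sum_le _ _).trans ?_
    rw [Finset.card_range, wsum]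
    refine mul_le_mul (Nat.cast_le.2 hs.le) ?_ (Finset.sum_nonneg fun _ _ => sq_nonneg _)
      (Nat.cast_nonneg _)
    refine (Finset.sum_le_sum fun t ht => ?_).trans (Finset.sum_le_sum_of_subset_of_nonneg
      (Finset.range_mono hs.le) fun t ht _ => Finset.sum_nonneg fun i _ =>
        mul_nonneg (W.nonneg t (Finset.mem_range.1 ht) i) (sq_nonneg _))
    have ht' := (Finset.mem_range.1 ht).trans hs
    refine (sq_norm_sum_smul_le _ (fun i _ => W.nonneg t ht' i) _).trans ?_
    rw [W.sum_eq t ht', one_mul]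
  have h3 := W.wsum_mono (f := fun t i =>
      ‖(-η) • ∑ l ∈ Finset.range I, (n t i l + h t i l + b i + g)‖ ^ 2)
    (f' := fun s i => 4 * η ^ 2 * (‖∑ l ∈ Finset.range I, n s i l‖ ^ 2 +
      I * L ^ 2 * localDrift I x y s i + I ^ 2 * ‖b i‖ ^ 2 + I ^ 2 * ‖g‖ ^ 2)) (fun t ht i => by
    rw [norm_smul, mul_pow, norm_neg, Real.norm_eq_abs, sq_abs]
    have := mul_le_mul_of_nonneg_left (W.sq_norm_localSum_le ht i le_rfl) (sq_nonneg η)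
    linarith)
  simp only [wsum_mul, wsum_add, W.wsum_const] at h3
  refine h2.trans ((mul_le_mul_of_nonneg_left h3 (Nat.cast_nonneg P)).trans (le_of_eq ?_))
  ring

/-- A local model is displaced by the server's motion within the window and by its own steps. Both
displacements contain the drift again, so this is an inequality of the drift in terms of itself. -/
lemma localDrift_le {s : ℕ} (hs : s < P) (i : Fin N) :
    localDrift I x y s i ≤ 8 * η ^ 2 * I * P *
      (wsum P q (fun s i => ‖∑ l ∈ Finset.range I, n s i l‖ ^ 2) +
        I * L ^ 2 * wsum P q (localDrift I x y) + I ^ 2 * wsum P q (fun _ i => ‖b i‖ ^ 2) +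
        I ^ 2 * P * ‖g‖ ^ 2) +
      8 * η ^ 2 * (∑ k ∈ Finset.range I, ‖∑ l ∈ Finset.range k, n s i l‖ ^ 2 +
        I ^ 2 * L ^ 2 * localDrift I x y s i + I ^ 3 * ‖b i‖ ^ 2 + I ^ 3 * ‖g‖ ^ 2) := by
  have h1 := W.sq_norm_server_sub_le hs
  set U := wsum P q (fun s i => ‖∑ l ∈ Finset.range I, n s i l‖ ^ 2) +
        I * L ^ 2 * wsum P q (localDrift I x y) + I ^ 2 * wsum P q (fun _ i => ‖b i‖ ^ 2) +
        I ^ 2 * P * ‖g‖ ^ 2 with hU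
  have h2 : ∀ k ∈ Finset.range I, ‖y s i k - x‖ ^ 2 ≤ 8 * η ^ 2 * P * U +
      8 * η ^ 2 * (‖∑ l ∈ Finset.range k, n s i l‖ ^ 2 + I * L ^ 2 * localDrift I x y s i +
        I ^ 2 * ‖b i‖ ^ 2 + I ^ 2 * ‖g‖ ^ 2) := by
    intro k hk
    have h3 : y s i k - x = (xs s - x) +
        (-η) • ∑ l ∈ Finset.range k, (n s i l + h s i l + b i + g) := by
      rw [W.iter s hs i k, neg_smul]; abel
    rw [h3]
    refine (sq_norm_add_le _ _).trans ?_
    rw [norm_smul (-η), mul_pow, norm_neg, Real.norm_eq_abs, sq_abs]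
    have := mul_le_mul_of_nonneg_left (W.sq_norm_localSum_le hs i (Finset.mem_range.1 hk).le)
      (sq_nonneg η)
    linarith
  have h4 := Finset.sum_le_sum h2
  clear_value U
  simp only [Finset.sum_add_distrib, ← Finset.mul_sum, Finset.sum_const, Finset.card_range,
    nsmul_eq_mul] at h4
  refine h4.trans (le_of_eq ?_)
  ring

omit W in
lemma localDrift_nonneg (s : ℕ) (i : Fin N) : 0 ≤ localDrift I x y s i :=
  Finset.sum_nonneg fun _ _ => sq_nonneg _

/-- The participation-weighted drift in a window. -/
lemma wsum_localDrift_le (hP : 0 < P) (hsmall : 32 * (η ^ 2 * L ^ 2 * P ^ 2 * I ^ 2) ≤ 1) :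
    wsum P q (localDrift I x y) ≤ 16 * η ^ 2 *
      (P ^ 2 * I * wsum P q (fun s i => ‖∑ l ∈ Finset.range I, n s i l‖ ^ 2) +
        wsum P q (fun s i => ∑ k ∈ Finset.range I, ‖∑ l ∈ Finset.range k, n s i l‖ ^ 2)) +
      32 * η ^ 2 * P ^ 2 * I ^ 3 * (wsum P q (fun _ i => ‖b i‖ ^ 2) + P * ‖g‖ ^ 2) := by
  have h1 := W.wsum_mono fun s hs i => W.localDrift_le hs i
  simp only [wsum_add, wsum_mul, W.wsum_const] at h1
  set T := wsum P q (localDrift I x y)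
  set B := wsum P q (fun _ i => ‖b i‖ ^ 2)
  have hT : 0 ≤ T := W.wsum_nonneg fun s _ i => localDrift_nonneg s i
  have hB : 0 ≤ B := W.wsum_nonneg fun s _ i => sq_nonneg _
  have hP1 : (1 : ℝ) ≤ (P : ℝ) ^ 2 := one_le_pow₀ (Nat.one_le_cast.2 hP)
  -- The drift T returns on the right with coefficient at most 16η²L²P²I² ≤ 1/2. Absorbing it
  -- doubles the constants, 8 to 16; merging the server and local parts of the B and g terms doubles
  -- again, to 32.
  have hc : (η ^ 2 * I ^ 2 * L ^ 2) * T ≤ (η ^ 2 * L ^ 2 * P ^ 2 * I ^ 2) * T := by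
    refine mul_le_mul_of_nonneg_right ?_ hT
    nlinarith [show 0 ≤ η ^ 2 * I ^ 2 * L ^ 2 by positivity]
  have hs : (η ^ 2 * L ^ 2 * P ^ 2 * I ^ 2) * T ≤ 1 / 32 * T :=
    mul_le_mul_of_nonneg_right (by linarith) hT
  have hB' : (η ^ 2 * I ^ 3) * (B + P * ‖g‖ ^ 2) ≤
      (η ^ 2 * P ^ 2 * I ^ 3) * (B + P * ‖g‖ ^ 2) := by
    refine mul_le_mul_of_nonneg_right ?_ (by positivity)
    nlinarith [show 0 ≤ η ^ 2 * I ^ 3 by positivity]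
  nlinarith [hc, hs, hB']

/-- The drift of one client in one round. -/
lemma localDrift_le' (hP : 0 < P) (hsmall : 32 * (η ^ 2 * L ^ 2 * P ^ 2 * I ^ 2) ≤ 1) {s : ℕ}
    (hs : s < P) (i : Fin N) :
    localDrift I x y s i ≤ 16 * η ^ 2 * I * P *
      (wsum P q (fun s i => ‖∑ l ∈ Finset.range I, n s i l‖ ^ 2) +
        I * L ^ 2 * wsum P q (localDrift I x y) + I ^ 2 * wsum P q (fun _ i => ‖b i‖ ^ 2) +
        I ^ 2 * P * ‖g‖ ^ 2) +
      16 * η ^ 2 * (∑ k ∈ Finset.range I, ‖∑ l ∈ Finset.range k, n s i l‖ ^ 2 +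
        I ^ 3 * ‖b i‖ ^ 2 + I ^ 3 * ‖g‖ ^ 2) := by
  have h1 := W.localDrift_le hs i
  set T := localDrift I x y s i
  have hT : 0 ≤ T := localDrift_nonneg s i
  have hP1 : (1 : ℝ) ≤ (P : ℝ) ^ 2 := one_le_pow₀ (Nat.one_le_cast.2 hP)
  -- Only the client's own drift is absorbed here; the drift of the whole window stays on the right
  -- and is bounded separately.
  have hc : (η ^ 2 * I ^ 2 * L ^ 2) * T ≤ 1 / 32 * T := by
    refine mul_le_mul_of_nonneg_right ?_ hT
    nlinarith [show 0 ≤ η ^ 2 * I ^ 2 * L ^ 2 by positivity]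
  nlinarith

end WindowDynamics

end Drift

/-! ### Mean drift of a window -/

namespace Experiment

variable {d N : ℕ} {Ω Ξ : Type*} [MeasurableSpace Ξ] (c : Experiment d N Ω Ξ)

lemma measurable_sq_norm {m : MeasurableSpace Ω} {v : Ω → Vec d} (hv : Measurable[m] v) :
    Measurable[m] fun ω => ‖v ω‖ ^ 2 :=
  (measurable_norm.pow_const 2).comp hv

noncomputable section

/-- The error of the control variate of client `i` in window `m`. -/
def ctrlErr (m : ℕ) (i : Fin N) (ω : Ω) : Vec d := c.G m i ω - c.df i (c.X m ω)

/-- The deviation of the error of a control variate from the average error. -/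
def ctrlDev (m : ℕ) (i : Fin N) (ω : Ω) : Vec d :=
  (1 / (N : ℝ)) • ∑ j, c.ctrlErr m j ω - c.ctrlErr m i ω

/-- The error of the noiseless control variate: its staleness. -/
def stale (m : ℕ) (i : Fin N) (ω : Ω) : Vec d := c.Ghat m i ω - c.df i (c.X m ω)

/-- The change of the local gradients since the beginning of window `m`. -/
def gradChange (m s : ℕ) (i : Fin N) (k : ℕ) (ω : Ω) : Vec d :=
  c.df i (c.Y (m * c.P + s) i k ω) - c.df i (c.X m ω)

/-- The weights of window `m`. -/
def wq (m : ℕ) (ω : Ω) (s : ℕ) (i : Fin N) : ℝ := c.q (m * c.P + s) i ω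

/-- The drift of client `i` in round `s` of window `m`. -/
def drift (m s : ℕ) (i : Fin N) (ω : Ω) : ℝ :=
  WindowDynamics.localDrift c.I (c.X m ω) (fun s i k => c.Y (m * c.P + s) i k ω) s i

/-- The participation-weighted drift of window `m`. -/
def totalDrift (m : ℕ) (ω : Ω) : ℝ :=
  WindowDynamics.wsum c.P (c.wq m ω) (fun s i => c.drift m s i ω)

/-- The squared noise of all the local steps of a round. -/
def fullNoise (m s : ℕ) (i : Fin N) (ω : Ω) : ℝ :=
  ‖∑ l ∈ Finset.range c.I, c.noise (m * c.P + s) l i ω‖ ^ 2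

/-- The squared noises of the initial segments of the local steps of a round. -/
def partialNoise (m s : ℕ) (i : Fin N) (ω : Ω) : ℝ :=
  ∑ k ∈ Finset.range c.I, ‖∑ l ∈ Finset.range k, c.noise (m * c.P + s) l i ω‖ ^ 2

variable {c}

section

variable [MeasurableSpace Ω] {μ : Measure Ω} (h : c.Valid μ)
include h

namespace Valid

/-- The local direction ∇f_i(y) - G^i + G is regrouped as gradient change, plus deviation of the
control error from its mean, plus ∇f(X), using that ∇f is the mean of the ∇f_i. This is the step in
which heterogeneity cancels. -/
lemma dynamics {m : ℕ} (hm : m < c.R / c.P) {ω : Ω} (hω : c.Good ω) :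
    WindowDynamics c.P c.I c.η c.L (c.wq m ω) (c.X m ω) (c.dF (c.X m ω)) (fun i => c.ctrlDev m i ω)
      (fun s => (c.state (m * c.P + s) ω).x) (fun s i k => c.Y (m * c.P + s) i k ω)
      (fun s i k => c.noise (m * c.P + s) k i ω) (fun s i k => c.gradChange m s i k ω) where
  nonneg s hs i := (hω _ (h.lt_R hm hs)).1 i
  sum_eq s hs := (hω _ (h.lt_R hm hs)).2.1
  iter s hs i k := by
    rw [h.Y_eq m hs]
    congr 2
    refine Finset.sum_congr rfl fun l _ => ?_
    have e : c.dF (c.X m ω) + (1 / (N : ℝ)) • ∑ j, c.ctrlErr m j ω = c.Gbar m ω := by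
      simp only [ctrlErr, Finset.sum_sub_distrib, smul_sub, h.dF_eq, Gbar]
      abel
    rw [gradChange, ctrlDev, ← e, ctrlErr]
    abel
  server s hs := h.state_x_eq m hs ω
  lip s _ i k := h.lipschitz_df i _ _

variable [IsProbabilityMeasure μ]

lemma integrable_mul_of_bound {a f : Ω → ℝ} (ha : Measurable a)
    (ha1 : ∀ᵐ ω ∂μ, 0 ≤ a ω ∧ a ω ≤ 1) (hf : Integrable f μ) :
    Integrable (fun ω => a ω * f ω) μ :=
  hf.bdd_mul (c := 1) ha.aestronglyMeasurable (ha1.mono fun ω hω => by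
    rw [Real.norm_eq_abs, abs_of_nonneg hω.1]; exact hω.2)

lemma integrable_q_mul {r : ℕ} (hr : r < c.R) (i : Fin N) {f : Ω → ℝ} (hf : Integrable f μ) :
    Integrable (fun ω => c.q r i ω * f ω) μ :=
  h.integrable_mul_of_bound (h.part.measurable r hr i)
    (h.good_ae.mono fun _ hω => ⟨(hω r hr).1 i, hω.q_le_one hr i⟩) hf

lemma integrable_wsum {m : ℕ} (hm : m < c.R / c.P) {f : ℕ → Fin N → Ω → ℝ}
    (hf : ∀ s < c.P, ∀ i, Integrable (f s i) μ) :
    Integrable (fun ω => WindowDynamics.wsum c.P (c.wq m ω) (fun s i => f s i ω)) μ :=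
  integrable_finsetSum _ fun s hs => integrable_finsetSum _ fun i _ =>
    h.integrable_q_mul (h.lt_R hm (Finset.mem_range.1 hs)) i (hf s (Finset.mem_range.1 hs) i)

omit [IsProbabilityMeasure μ] in
lemma sum_idx_round {E : Type*} [AddCommMonoid E] {r : ℕ} (hr : r < c.R) (i : Fin N) {k : ℕ}
    (hk : k ≤ c.I) (f : ℕ → E) :
    ∑ j : c.Idx, (if j.1 = Sum.inr ⟨r, hr⟩ ∧ j.2.2 = i ∧ (j.2.1 : ℕ) < k then f j.2.1 else 0) =
      ∑ l ∈ Finset.range k, f l := by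
  rw [Fintype.sum_prod_type, Finset.sum_eq_single (Sum.inr ⟨r, hr⟩) (fun t _ ht => by simp [ht])
    (by simp), Fintype.sum_prod_type]
  simp only [true_and]
  have e : ∀ l : Fin c.I, ∑ i' : Fin N, (if i' = i ∧ (l : ℕ) < k then f l else 0) =
      if (l : ℕ) < k then f l else 0 := fun l => by
    rw [Finset.sum_eq_single i (fun i' _ hi' => by simp [hi']) (by simp)]
    simp
  simp only [e]
  rw [← Finset.sum_range (fun l => if l < k then f l else 0), ← Finset.sum_filter]
  congr 1
  ext l
  simp only [Finset.mem_filter, Finset.mem_range]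
  omega

/-- A random factor `a` depending on the weights enters the orthogonality estimate as coefficients
√a, whose squares add up to k·a over k steps. -/
lemma integral_mul_sq_noise_le {r : ℕ} (hr : r < c.R) (i : Fin N) {k : ℕ} (hk : k ≤ c.I)
    {a : Ω → ℝ} (ha : Measurable[c.weightAlg] a) (ha1 : ∀ᵐ ω ∂μ, 0 ≤ a ω ∧ a ω ≤ 1) :
    ∫ ω, a ω * ‖∑ l ∈ Finset.range k, c.noise r l i ω‖ ^ 2 ∂μ ≤
      c.I * c.σ ^ 2 * ∫ ω, a ω ∂μ := by
  have hai : Integrable a μ := by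
    simpa using h.integrable_mul_of_bound (ha.mono h.weightAlg_le le_rfl) ha1
      (integrable_const (1 : ℝ))
  set w : c.Idx → Ω → ℝ := fun j ω =>
    if j.1 = Sum.inr ⟨r, hr⟩ ∧ j.2.2 = i ∧ (j.2.1 : ℕ) < k then √(a ω) else 0 with hw
  have hwm : ∀ j, Measurable[c.weightAlg] (w j) := by
    intro j
    simp only [hw]
    split_ifs
    · exact ha.sqrt
    · exact measurable_const
  have hw1 : ∀ j, ∀ᵐ ω ∂μ, |w j ω| ≤ 1 := by
    intro j
    filter_upwards [ha1] with ω hω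
    simp only [hw]
    split_ifs
    · rw [abs_of_nonneg (Real.sqrt_nonneg _)]
      exact Real.sqrt_le_one.2 hω.2
    · simp
  have e1 : ∀ ω, ∑ j, w j ω • c.gradNoise j ω =
      ∑ l ∈ Finset.range k, √(a ω) • c.noise r l i ω := by
    intro ω
    rw [← h.sum_idx_round hr i hk]
    refine Finset.sum_congr rfl fun j _ => ?_
    obtain ⟨t, l, i'⟩ := j
    simp only [hw]
    split_ifs with hj
    · obtain ⟨rfl, rfl, -⟩ := hj
      rfl
    · simp
  have e2 : ∀ᵐ ω ∂μ, ∑ j, w j ω ^ 2 = k * a ω := by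
    filter_upwards [ha1] with ω hω
    have := h.sum_idx_round hr i hk (fun _ => a ω)
    simp only [Finset.sum_const, Finset.card_range, nsmul_eq_mul] at this
    rw [← this]
    refine Finset.sum_congr rfl fun j _ => ?_
    simp only [hw]
    split_ifs
    · exact Real.sq_sqrt hω.1
    · simp
  have key := (h.integral_sq_sum_gradNoise_le hwm hw1).2
  rw [integral_congr_ae e2, integral_const_mul] at key
  have ha0 : 0 ≤ ∫ ω, a ω ∂μ := integral_nonneg_of_ae (ha1.mono fun _ hω => hω.1)
  have e3 : ∫ ω, ‖∑ j, w j ω • c.gradNoise j ω‖ ^ 2 ∂μ =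
      ∫ ω, a ω * ‖∑ l ∈ Finset.range k, c.noise r l i ω‖ ^ 2 ∂μ := by
    refine integral_congr_ae ?_
    filter_upwards [ha1] with ω hω
    rw [e1, ← Finset.smul_sum, norm_smul, mul_pow, Real.norm_eq_abs, sq_abs, Real.sq_sqrt hω.1]
  rw [e3] at key
  refine key.trans ?_
  have : (k : ℝ) * ∫ ω, a ω ∂μ ≤ c.I * ∫ ω, a ω ∂μ :=
    mul_le_mul_of_nonneg_right (Nat.cast_le.2 hk) ha0
  nlinarith [sq_nonneg c.σ]

lemma integrable_noise_sq {r : ℕ} (hr : r < c.R) (i : Fin N) {k : ℕ} (hk : k ≤ c.I) :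
    Integrable (fun ω => ‖∑ l ∈ Finset.range k, c.noise r l i ω‖ ^ 2) μ := by
  have : MemLp (fun ω => ∑ l ∈ Finset.range k, c.noise r l i ω) 2 μ :=
    memLp_finsetSum _ fun l hl => h.memLp_noise hr ((Finset.mem_range.1 hl).trans_le hk) i
  exact this.integrable_norm_pow (by norm_num)

lemma integrable_fullNoise {m s : ℕ} (hm : m < c.R / c.P) (hs : s < c.P) (i : Fin N) :
    Integrable (c.fullNoise m s i) μ := h.integrable_noise_sq (h.lt_R hm hs) i le_rfl

lemma integrable_partialNoise {m s : ℕ} (hm : m < c.R / c.P) (hs : s < c.P) (i : Fin N) :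
    Integrable (c.partialNoise m s i) μ :=
  integrable_finsetSum _ fun _ hk =>
    h.integrable_noise_sq (h.lt_R hm hs) i (Finset.mem_range.1 hk).le

lemma integral_mul_fullNoise_le {m s : ℕ} (hm : m < c.R / c.P) (hs : s < c.P) (i : Fin N)
    {a : Ω → ℝ} (ha : Measurable[c.weightAlg] a) (ha1 : ∀ᵐ ω ∂μ, 0 ≤ a ω ∧ a ω ≤ 1) :
    ∫ ω, a ω * c.fullNoise m s i ω ∂μ ≤ c.I * c.σ ^ 2 * ∫ ω, a ω ∂μ :=
  h.integral_mul_sq_noise_le (h.lt_R hm hs) i le_rfl ha ha1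

lemma integral_mul_partialNoise_le {m s : ℕ} (hm : m < c.R / c.P) (hs : s < c.P) (i : Fin N)
    {a : Ω → ℝ} (ha : Measurable[c.weightAlg] a) (ha1 : ∀ᵐ ω ∂μ, 0 ≤ a ω ∧ a ω ≤ 1) :
    ∫ ω, a ω * c.partialNoise m s i ω ∂μ ≤ c.I ^ 2 * c.σ ^ 2 * ∫ ω, a ω ∂μ := by
  simp_rw [partialNoise, Finset.mul_sum]
  rw [integral_finsetSum _ fun k hk => h.integrable_mul_of_bound (ha.mono h.weightAlg_le le_rfl) ha1
    (h.integrable_noise_sq (h.lt_R hm hs) i (Finset.mem_range.1 hk).le)]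
  refine (Finset.sum_le_sum fun k hk => h.integral_mul_sq_noise_le (h.lt_R hm hs) i
    (Finset.mem_range.1 hk).le ha ha1).trans (le_of_eq ?_)
  rw [Finset.sum_const, Finset.card_range, nsmul_eq_mul]
  ring

/-- Weighted sums of quantities whose weighted means are bounded. -/
lemma integral_wsum_le {m : ℕ} (hm : m < c.R / c.P) {f : ℕ → Fin N → Ω → ℝ} {K : ℝ}
    (hf : ∀ s < c.P, ∀ i, Integrable (f s i) μ)
    (hK : ∀ s < c.P, ∀ i, ∫ ω, c.wq m ω s i * f s i ω ∂μ ≤ K * ∫ ω, c.wq m ω s i ∂μ) :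
    ∫ ω, WindowDynamics.wsum c.P (c.wq m ω) (fun s i => f s i ω) ∂μ ≤ c.P * K := by
  have hqi : ∀ s < c.P, ∀ i, Integrable (fun ω => c.wq m ω s i) μ := fun s hs i => by
    simpa [wq] using h.integrable_q_mul (h.lt_R hm hs) i (integrable_const (1 : ℝ))
  have hint : ∀ s < c.P, ∀ i, Integrable (fun ω => c.wq m ω s i * f s i ω) μ := fun s hs i =>
    h.integrable_q_mul (h.lt_R hm hs) i (hf s hs i)
  simp_rw [WindowDynamics.wsum]
  rw [integral_finsetSum _ fun s hs => integrable_finsetSum _ fun i _ =>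
    hint s (Finset.mem_range.1 hs) i]
  have : ∀ s ∈ Finset.range c.P, ∫ ω, ∑ i, c.wq m ω s i * f s i ω ∂μ ≤ K := by
    intro s hs
    have hs' := Finset.mem_range.1 hs
    rw [integral_finsetSum _ fun i _ => hint s hs' i]
    refine (Finset.sum_le_sum fun i _ => hK s hs' i).trans (le_of_eq ?_)
    rw [← Finset.mul_sum, ← integral_finsetSum _ fun i _ => hqi s hs' i,
      integral_congr_ae (f := fun ω => ∑ i, c.wq m ω s i) (g := fun _ => (1 : ℝ))
        (h.good_ae.mono fun ω hω => (hω _ (h.lt_R hm hs')).2.1)]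
    simp
  refine (Finset.sum_le_sum this).trans (le_of_eq ?_)
  simp

lemma wq_bounds {m s : ℕ} (hm : m < c.R / c.P) (hs : s < c.P) (i : Fin N) :
    ∀ᵐ ω ∂μ, 0 ≤ c.wq m ω s i ∧ c.wq m ω s i ≤ 1 :=
  h.good_ae.mono fun _ hω => ⟨(hω _ (h.lt_R hm hs)).1 i, hω.q_le_one (h.lt_R hm hs) i⟩

lemma integral_wsum_fullNoise_le {m : ℕ} (hm : m < c.R / c.P) :
    ∫ ω, WindowDynamics.wsum c.P (c.wq m ω) (fun s i => c.fullNoise m s i ω) ∂μ ≤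
      c.P * (c.I * c.σ ^ 2) :=
  h.integral_wsum_le hm (fun _ hs i => h.integrable_fullNoise hm hs i) fun _ hs i =>
    h.integral_mul_fullNoise_le hm hs i (c.measurable_q_weightAlg (h.lt_R hm hs) i)
      (h.wq_bounds hm hs i)

lemma integral_wsum_partialNoise_le {m : ℕ} (hm : m < c.R / c.P) :
    ∫ ω, WindowDynamics.wsum c.P (c.wq m ω) (fun s i => c.partialNoise m s i ω) ∂μ ≤
      c.P * (c.I ^ 2 * c.σ ^ 2) :=
  h.integral_wsum_le hm (fun _ hs i => h.integrable_partialNoise hm hs i) fun _ hs i =>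
    h.integral_mul_partialNoise_le hm hs i (c.measurable_q_weightAlg (h.lt_R hm hs) i)
      (h.wq_bounds hm hs i)

omit [IsProbabilityMeasure μ] in
lemma wsum_round_const (m : ℕ) (f : Fin N → ℝ) (ω : Ω) :
    WindowDynamics.wsum c.P (c.wq m ω) (fun _ i => f i) =
      ∑ i, c.P * (qbar c.q c.P m i ω * f i) := by
  rw [WindowDynamics.wsum, Finset.sum_comm]
  refine Finset.sum_congr rfl fun i _ => ?_
  rw [← mul_assoc, qbar_mul h.P_pos, Finset.sum_mul]
  rfl

lemma memLp_df_X {m : ℕ} (hm : m ≤ c.R / c.P) (i : Fin N) :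
    MemLp (fun ω => c.df i (c.X m ω)) 2 μ := h.memLp_df i (h.memLp_X hm)

lemma memLp_dF_X {m : ℕ} (hm : m ≤ c.R / c.P) : MemLp (fun ω => c.dF (c.X m ω)) 2 μ :=
  h.memLp_dF (h.memLp_X hm)

lemma memLp_ctrlErr {m : ℕ} (hm : m ≤ c.R / c.P) (i : Fin N) : MemLp (c.ctrlErr m i) 2 μ :=
  (h.memLp_G hm i).sub (h.memLp_df_X hm i)

lemma memLp_ctrlDev {m : ℕ} (hm : m ≤ c.R / c.P) (i : Fin N) : MemLp (c.ctrlDev m i) 2 μ :=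
  ((memLp_finsetSum Finset.univ fun j _ => h.memLp_ctrlErr hm j).const_smul (1 / (N : ℝ))).sub
    (h.memLp_ctrlErr hm i)

lemma memLp_stale {m : ℕ} (hm : m ≤ c.R / c.P) (i : Fin N) : MemLp (c.stale m i) 2 μ :=
  (h.memLp_Ghat hm i).sub (h.memLp_df_X hm i)

omit [IsProbabilityMeasure μ] in
lemma measurable_df_X {m : ℕ} (hm : m ≤ c.R / c.P) (i : Fin N) :
    Measurable[c.windowAlg m] (fun ω => c.df i (c.X m ω)) :=
  (h.continuous_df i).measurable.comp (h.measurable_X_windowAlg hm)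

omit [IsProbabilityMeasure μ] in
lemma measurable_dF_X {m : ℕ} (hm : m ≤ c.R / c.P) :
    Measurable[c.windowAlg m] (fun ω => c.dF (c.X m ω)) :=
  h.continuous_dF.measurable.comp (h.measurable_X_windowAlg hm)

omit [IsProbabilityMeasure μ] in
lemma measurable_ctrlErr {m : ℕ} (hm : m ≤ c.R / c.P) (i : Fin N) :
    Measurable[c.windowAlg m] (c.ctrlErr m i) :=
  (h.measurable_G_windowAlg hm i).sub (h.measurable_df_X hm i)

omit [IsProbabilityMeasure μ] in
lemma measurable_ctrlDev {m : ℕ} (hm : m ≤ c.R / c.P) (i : Fin N) :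
    Measurable[c.windowAlg m] (c.ctrlDev m i) :=
  ((Finset.measurable_sum Finset.univ fun j _ => h.measurable_ctrlErr hm j).const_smul
    (1 / (N : ℝ))).sub (h.measurable_ctrlErr hm i)

lemma integral_sum_qbar_mul {m : ℕ} (hm : m < c.R / c.P) {f : Fin N → Ω → ℝ}
    (hfm : ∀ i, Measurable[c.windowAlg m] (f i)) (hf : ∀ i, Integrable (f i) μ) :
    ∫ ω, ∑ i, qbar c.q c.P m i ω * f i ω ∂μ = 1 / (N : ℝ) * ∑ i, ∫ ω, f i ω ∂μ := by
  rw [integral_finsetSum _ fun i _ => h.integrable_qbar_mul hm i (hf i), Finset.mul_sum]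
  exact Finset.sum_congr rfl fun i _ => h.integral_qbar_mul hm i (hfm i) (hf i)

/-- Control deviations are known before the window, so unbiased participation turns the weights q̄^i
into the uniform 1/N. -/
lemma integral_wsum_ctrlDev {m : ℕ} (hm : m < c.R / c.P) :
    ∫ ω, WindowDynamics.wsum c.P (c.wq m ω) (fun _ i => ‖c.ctrlDev m i ω‖ ^ 2) ∂μ =
      c.P * (1 / (N : ℝ) * ∑ i, ∫ ω, ‖c.ctrlDev m i ω‖ ^ 2 ∂μ) := by
  simp_rw [h.wsum_round_const, ← Finset.mul_sum]
  rw [integral_const_mul, h.integral_sum_qbar_mul hm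
    (fun i => measurable_sq_norm (h.measurable_ctrlDev hm.le i))
    fun i => (h.memLp_ctrlDev hm.le i).integrable_norm_pow (by norm_num)]

lemma integrable_drift {m s : ℕ} (hm : m < c.R / c.P) (hs : s < c.P) (i : Fin N) :
    Integrable (c.drift m s i) μ :=
  integrable_finsetSum _ fun _ hk =>
    ((h.memLp_Y hm hs i (Finset.mem_range.1 hk).le).sub (h.memLp_X hm.le)).integrable_norm_pow
      (by norm_num)

lemma integrable_totalDrift {m : ℕ} (hm : m < c.R / c.P) : Integrable (c.totalDrift m) μ :=
  h.integrable_wsum hm fun _ hs i => h.integrable_drift hm hs i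

/-- The mean participation-weighted drift of a window. -/
lemma integral_totalDrift_le {m : ℕ} (hm : m < c.R / c.P)
    (hsmall : 32 * (c.η ^ 2 * c.L ^ 2 * (c.P : ℝ) ^ 2 * (c.I : ℝ) ^ 2) ≤ 1) :
    ∫ ω, c.totalDrift m ω ∂μ ≤ 32 * c.η ^ 2 * c.P ^ 3 * c.I ^ 3 * (c.σ ^ 2 / c.I +
      1 / (N : ℝ) * ∑ i, ∫ ω, ‖c.ctrlDev m i ω‖ ^ 2 ∂μ + ∫ ω, ‖c.dF (c.X m ω)‖ ^ 2 ∂μ) := by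
  have hP : (1 : ℝ) ≤ c.P := Nat.one_le_cast.2 h.P_pos
  have hI : (1 : ℝ) ≤ c.I := Nat.one_le_cast.2 h.I_pos
  have hF := h.integrable_wsum hm fun s hs i => h.integrable_fullNoise hm hs i
  have hPn := h.integrable_wsum hm fun s hs i => h.integrable_partialNoise hm hs i
  have hB := h.integrable_wsum (f := fun _ i ω => ‖c.ctrlDev m i ω‖ ^ 2) hm fun s hs i =>
    (h.memLp_ctrlDev hm.le i).integrable_norm_pow (by norm_num)
  have hg : Integrable (fun ω => ‖c.dF (c.X m ω)‖ ^ 2) μ :=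
    (h.memLp_dF_X hm.le).integrable_norm_pow (by norm_num)
  have i1 : Integrable (fun ω => (c.P : ℝ) ^ 2 * c.I *
      WindowDynamics.wsum c.P (c.wq m ω) (fun s i => c.fullNoise m s i ω) +
        WindowDynamics.wsum c.P (c.wq m ω) (fun s i => c.partialNoise m s i ω)) μ :=
    (hF.const_mul _).add hPn
  have i2 : Integrable (fun ω => WindowDynamics.wsum c.P (c.wq m ω)
      (fun _ i => ‖c.ctrlDev m i ω‖ ^ 2) + c.P * ‖c.dF (c.X m ω)‖ ^ 2) μ :=
    hB.add (hg.const_mul _)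
  have hle := integral_mono_ae (h.integrable_totalDrift hm)
    ((i1.const_mul (16 * c.η ^ 2)).add (i2.const_mul (32 * c.η ^ 2 * c.P ^ 2 * c.I ^ 3)))
    (h.good_ae.mono fun ω hω => (h.dynamics hm hω).wsum_localDrift_le h.P_pos hsmall)
  simp only [Pi.add_apply] at hle
  rw [integral_add (i1.const_mul _) (i2.const_mul _), integral_const_mul, integral_const_mul,
    integral_add (hF.const_mul _) hPn, integral_add hB (hg.const_mul _), integral_const_mul,
    integral_const_mul, h.integral_wsum_ctrlDev hm] at hle
  have h1 := h.integral_wsum_fullNoise_le hm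
  have h2 := h.integral_wsum_partialNoise_le hm
  refine hle.trans ?_
  have h3 : (c.P : ℝ) ^ 2 * c.I * ∫ ω, WindowDynamics.wsum c.P (c.wq m ω)
      (fun s i => c.fullNoise m s i ω) ∂μ ≤ c.P ^ 2 * c.I * (c.P * (c.I * c.σ ^ 2)) :=
    mul_le_mul_of_nonneg_left h1 (by positivity)
  -- Since P ≥ 1 the partial noise is dominated by the bound for the full noise; the two equal terms
  -- turn 16 into 32.
  have h4 : (c.P : ℝ) * (c.I ^ 2 * c.σ ^ 2) ≤ c.P ^ 2 * c.I * (c.P * (c.I * c.σ ^ 2)) := by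
    have : (1 : ℝ) ≤ c.P ^ 2 := one_le_pow₀ hP
    have h0 : (0 : ℝ) ≤ c.P * (c.I ^ 2 * c.σ ^ 2) := by positivity
    nlinarith
  have h5 := mul_le_mul_of_nonneg_left (add_le_add h3 (h2.trans h4))
    (show 0 ≤ 16 * c.η ^ 2 by positivity)
  refine (add_le_add_left h5 _).trans (le_of_eq ?_)
  field_simp
  ring

end Valid

end

end

end Experiment

/-! ### Mean drift over the rounds in which a client participates -/

namespace Experiment

variable {d N : ℕ} {Ω Ξ : Type*} [MeasurableSpace Ξ] (c : Experiment d N Ω Ξ)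

/-- Three contributions of size 16η²P²I³(σ²/I + b + g) each: the window-wide terms, the feedback of
the total drift (by smallness of η), and the client's own terms. -/
lemma partDrift_arith {η I P L σ b g T : ℝ} (hI : 1 ≤ I) (hP : 1 ≤ P) (hb : 0 ≤ b) (hg : 0 ≤ g)
    (hsmall : 32 * (η ^ 2 * L ^ 2 * P ^ 2 * I ^ 2) ≤ 1)
    (hT : T ≤ 32 * η ^ 2 * P ^ 3 * I ^ 3 * (σ ^ 2 / I + b + g)) :
    16 * η ^ 2 * I * P * (P * (I * σ ^ 2) + I * L ^ 2 * T + I ^ 2 * (P * b) + I ^ 2 * P * g) +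
      16 * η ^ 2 * (I ^ 2 * σ ^ 2 + I ^ 3 * b + I ^ 3 * g) ≤
    48 * η ^ 2 * P ^ 2 * I ^ 3 * (σ ^ 2 / I + b + g) := by
  have hσ : σ ^ 2 = I * (σ ^ 2 / I) := by field_simp
  have ht : 0 ≤ σ ^ 2 / I := by positivity
  rw [hσ, mul_div_cancel_left₀ _ (by positivity : I ≠ 0)]
  generalize σ ^ 2 / I = t at *
  set Q := t + b + g with hQ
  have hQ0 : 0 ≤ Q := by positivity
  have e1 : 16 * η ^ 2 * I * P * (P * (I * (I * t)) + I * L ^ 2 * T +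
      I ^ 2 * (P * b) + I ^ 2 * P * g) = 16 * η ^ 2 * P ^ 2 * I ^ 3 * Q +
      16 * η ^ 2 * L ^ 2 * P * I ^ 2 * T := by
    rw [hQ]; ring
  have e2 : 16 * η ^ 2 * (I ^ 2 * (I * t) + I ^ 3 * b + I ^ 3 * g) = 16 * η ^ 2 * I ^ 3 * Q := by
    rw [hQ]; ring
  have e3 : 16 * η ^ 2 * I ^ 3 * Q ≤ 16 * η ^ 2 * P ^ 2 * I ^ 3 * Q := by
    have : (1 : ℝ) ≤ P ^ 2 := one_le_pow₀ hP
    have h0 : 0 ≤ 16 * η ^ 2 * I ^ 3 * Q := by positivity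
    nlinarith
  have e4 : 16 * η ^ 2 * L ^ 2 * P * I ^ 2 * T ≤ 16 * η ^ 2 * P ^ 2 * I ^ 3 * Q := by
    calc 16 * η ^ 2 * L ^ 2 * P * I ^ 2 * T
        ≤ 16 * η ^ 2 * L ^ 2 * P * I ^ 2 * (32 * η ^ 2 * P ^ 3 * I ^ 3 * Q) := by gcongr
      _ = 32 * (η ^ 2 * L ^ 2 * P ^ 2 * I ^ 2) * (16 * η ^ 2 * P ^ 2 * I ^ 3 * Q) := by ring
      _ ≤ 1 * (16 * η ^ 2 * P ^ 2 * I ^ 3 * Q) := by gcongr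
      _ = _ := one_mul _
  rw [e1, e2]
  linarith

noncomputable section

/-- The share of round `s` in the participation of client `i` in window `m`. -/
def share (m s : ℕ) (i : Fin N) (ω : Ω) : ℝ :=
  if 0 < qbar c.q c.P m i ω then
    c.q (m * c.P + s) i ω / ∑ s ∈ Finset.range c.P, c.q (m * c.P + s) i ω else 0

/-- The drift of client `i` in window `m`, averaged over the rounds in which it participates. -/
def partDrift (m : ℕ) (i : Fin N) (ω : Ω) : ℝ :=
  ∑ s ∈ Finset.range c.P, c.share m s i ω * c.drift m s i ω

variable {c}

section

variable [MeasurableSpace Ω] {μ : Measure Ω} (h : c.Valid μ)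
include h

namespace Valid

lemma share_nonneg {ω : Ω} (hω : c.Good ω) {m s : ℕ} (hm : m < c.R / c.P) (hs : s < c.P)
    (i : Fin N) : 0 ≤ c.share m s i ω := by
  rw [share]
  split_ifs with hq
  · exact div_nonneg ((hω _ (h.lt_R hm hs)).1 i) ((qbar_pos_iff h.P_pos m i ω).1 hq).le
  · exact le_rfl

lemma sum_share (m : ℕ) (i : Fin N) (ω : Ω) :
    ∑ s ∈ Finset.range c.P, c.share m s i ω = if 0 < qbar c.q c.P m i ω then 1 else 0 := by
  simp only [share]
  split_ifs with hq
  · rw [← Finset.sum_div, div_self ((qbar_pos_iff h.P_pos m i ω).1 hq).ne']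
  · simp

lemma sum_share_le (m : ℕ) (i : Fin N) (ω : Ω) :
    ∑ s ∈ Finset.range c.P, c.share m s i ω ≤ 1 := by
  rw [h.sum_share]
  split_ifs <;> norm_num

lemma share_le_one {ω : Ω} (hω : c.Good ω) {m s : ℕ} (hm : m < c.R / c.P) (hs : s < c.P)
    (i : Fin N) : c.share m s i ω ≤ 1 :=
  (Finset.single_le_sum (f := fun s => c.share m s i ω)
    (fun _ ht => h.share_nonneg hω hm (Finset.mem_range.1 ht) i) (Finset.mem_range.2 hs)).trans
    (h.sum_share_le m i ω)

lemma measurable_share {m s : ℕ} (hm : m < c.R / c.P) (hs : s < c.P) (i : Fin N) :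
    Measurable[c.weightAlg] (c.share m s i) := by
  have hq : ∀ s ∈ Finset.range c.P, Measurable[c.weightAlg] (c.q (m * c.P + s) i) :=
    fun s hs => c.measurable_q_weightAlg (h.lt_R hm (Finset.mem_range.1 hs)) i
  exact Measurable.ite (measurableSet_lt measurable_const (h.measurable_qbar hm i))
    ((hq s (Finset.mem_range.2 hs)).div (Finset.measurable_sum (Finset.range c.P) hq))
    measurable_const

/-- All terms but the partial noise are the same for every round, so averaging with shares of total
at most one leaves them unchanged. -/
lemma partDrift_le {ω : Ω} (hω : c.Good ω) {m : ℕ} (hm : m < c.R / c.P)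
    (hsmall : 32 * (c.η ^ 2 * c.L ^ 2 * (c.P : ℝ) ^ 2 * (c.I : ℝ) ^ 2) ≤ 1) (i : Fin N) :
    c.partDrift m i ω ≤ 16 * c.η ^ 2 * c.I * c.P *
      (WindowDynamics.wsum c.P (c.wq m ω) (fun s i => c.fullNoise m s i ω) +
        c.I * c.L ^ 2 * c.totalDrift m ω +
        c.I ^ 2 * WindowDynamics.wsum c.P (c.wq m ω) (fun _ i => ‖c.ctrlDev m i ω‖ ^ 2) +
        c.I ^ 2 * c.P * ‖c.dF (c.X m ω)‖ ^ 2) +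
      16 * c.η ^ 2 * (∑ s ∈ Finset.range c.P, c.share m s i ω * c.partialNoise m s i ω +
        c.I ^ 3 * ‖c.ctrlDev m i ω‖ ^ 2 + c.I ^ 3 * ‖c.dF (c.X m ω)‖ ^ 2) := by
  have W := h.dynamics hm hω
  have hF : 0 ≤ WindowDynamics.wsum c.P (c.wq m ω) (fun s i => c.fullNoise m s i ω) :=
    W.wsum_nonneg fun s _ i => sq_nonneg _
  have hT : 0 ≤ c.totalDrift m ω := W.wsum_nonneg fun s _ i => WindowDynamics.localDrift_nonneg s i
  have hB : 0 ≤ WindowDynamics.wsum c.P (c.wq m ω) (fun _ i => ‖c.ctrlDev m i ω‖ ^ 2) :=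
    W.wsum_nonneg fun s _ i => sq_nonneg _
  have hd : ∀ s < c.P, c.drift m s i ω ≤ 16 * c.η ^ 2 * c.I * c.P *
      (WindowDynamics.wsum c.P (c.wq m ω) (fun s i => c.fullNoise m s i ω) +
        c.I * c.L ^ 2 * c.totalDrift m ω +
        c.I ^ 2 * WindowDynamics.wsum c.P (c.wq m ω) (fun _ i => ‖c.ctrlDev m i ω‖ ^ 2) +
        c.I ^ 2 * c.P * ‖c.dF (c.X m ω)‖ ^ 2) +
      16 * c.η ^ 2 * (c.partialNoise m s i ω +
        c.I ^ 3 * ‖c.ctrlDev m i ω‖ ^ 2 + c.I ^ 3 * ‖c.dF (c.X m ω)‖ ^ 2) :=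
    fun s hs => W.localDrift_le' h.P_pos hsmall hs i
  set U := 16 * c.η ^ 2 * c.I * c.P *
      (WindowDynamics.wsum c.P (c.wq m ω) (fun s i => c.fullNoise m s i ω) +
        c.I * c.L ^ 2 * c.totalDrift m ω +
        c.I ^ 2 * WindowDynamics.wsum c.P (c.wq m ω) (fun _ i => ‖c.ctrlDev m i ω‖ ^ 2) +
        c.I ^ 2 * c.P * ‖c.dF (c.X m ω)‖ ^ 2) with hU
  have hU0 : 0 ≤ U := by positivity
  set V := 16 * c.η ^ 2 * (c.I ^ 3 * ‖c.ctrlDev m i ω‖ ^ 2 + c.I ^ 3 * ‖c.dF (c.X m ω)‖ ^ 2) with hV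
  have hV0 : 0 ≤ V := by positivity
  have h1 : c.partDrift m i ω ≤ ∑ s ∈ Finset.range c.P, c.share m s i ω *
      ((U + V) + 16 * c.η ^ 2 * c.partialNoise m s i ω) := by
    refine Finset.sum_le_sum fun s hs => ?_
    have hs' := Finset.mem_range.1 hs
    refine mul_le_mul_of_nonneg_left ?_ (h.share_nonneg hω hm hs' i)
    have := hd s hs'
    rw [hV]
    linarith
  simp_rw [mul_add (c.share m _ i ω) (U + V)] at h1
  rw [Finset.sum_add_distrib, ← Finset.sum_mul] at h1
  have h2 := mul_le_mul_of_nonneg_right (h.sum_share_le m i ω) (add_nonneg hU0 hV0)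
  have h3 : ∑ s ∈ Finset.range c.P, c.share m s i ω * (16 * c.η ^ 2 * c.partialNoise m s i ω) =
      16 * c.η ^ 2 * ∑ s ∈ Finset.range c.P, c.share m s i ω * c.partialNoise m s i ω := by
    rw [Finset.mul_sum]
    exact Finset.sum_congr rfl fun s _ => by ring
  rw [h3] at h1
  rw [hV] at h1 h2
  linarith

variable [IsProbabilityMeasure μ]

lemma share_bounds {m s : ℕ} (hm : m < c.R / c.P) (hs : s < c.P) (i : Fin N) :
    ∀ᵐ ω ∂μ, 0 ≤ c.share m s i ω ∧ c.share m s i ω ≤ 1 :=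
  h.good_ae.mono fun _ hω => ⟨h.share_nonneg hω hm hs i, h.share_le_one hω hm hs i⟩

lemma integrable_share_mul {m s : ℕ} (hm : m < c.R / c.P) (hs : s < c.P) (i : Fin N) {f : Ω → ℝ}
    (hf : Integrable f μ) : Integrable (fun ω => c.share m s i ω * f ω) μ :=
  h.integrable_mul_of_bound ((h.measurable_share hm hs i).mono h.weightAlg_le le_rfl)
    (h.share_bounds hm hs i) hf

lemma integrable_partDrift {m : ℕ} (hm : m < c.R / c.P) (i : Fin N) :
    Integrable (c.partDrift m i) μ :=
  integrable_finsetSum _ fun _ hs =>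
    h.integrable_share_mul hm (Finset.mem_range.1 hs) i (h.integrable_drift hm (Finset.mem_range.1 hs) i)

/-- The shares are functions of the weights, so each is an admissible coefficient for the noise
estimate; as they sum to at most one, no factor P is lost. -/
lemma integral_share_mul_partialNoise_le {m : ℕ} (hm : m < c.R / c.P) (i : Fin N) :
    Integrable (fun ω => ∑ s ∈ Finset.range c.P, c.share m s i ω * c.partialNoise m s i ω) μ ∧
    ∫ ω, ∑ s ∈ Finset.range c.P, c.share m s i ω * c.partialNoise m s i ω ∂μ ≤
      c.I ^ 2 * c.σ ^ 2 := by
  have hi : ∀ s ∈ Finset.range c.P,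
      Integrable (fun ω => c.share m s i ω * c.partialNoise m s i ω) μ := fun s hs =>
    h.integrable_share_mul hm (Finset.mem_range.1 hs) i
      (h.integrable_partialNoise hm (Finset.mem_range.1 hs) i)
  have hsi : ∀ s ∈ Finset.range c.P, Integrable (c.share m s i) μ := fun s hs => by
    simpa using h.integrable_share_mul hm (Finset.mem_range.1 hs) i (integrable_const (1 : ℝ))
  refine ⟨integrable_finsetSum _ hi, ?_⟩
  rw [integral_finsetSum _ hi]
  refine (Finset.sum_le_sum fun s hs => h.integral_mul_partialNoise_le hm (Finset.mem_range.1 hs) i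
    (h.measurable_share hm (Finset.mem_range.1 hs) i)
    (h.share_bounds hm (Finset.mem_range.1 hs) i)).trans ?_
  rw [← Finset.mul_sum, ← integral_finsetSum _ hsi]
  have : ∫ ω, ∑ s ∈ Finset.range c.P, c.share m s i ω ∂μ ≤ ∫ _, (1 : ℝ) ∂μ :=
    integral_mono (integrable_finsetSum _ hsi) (integrable_const _) fun ω => h.sum_share_le m i ω
  rw [integral_const, probReal_univ, one_smul] at this
  exact mul_le_of_le_one_right (by positivity) this

/-- The mean drift of the clients, averaged over the rounds in which they participate. -/
lemma integral_partDrift_le {m : ℕ} (hm : m < c.R / c.P)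
    (hsmall : 32 * (c.η ^ 2 * c.L ^ 2 * (c.P : ℝ) ^ 2 * (c.I : ℝ) ^ 2) ≤ 1) :
    1 / (N : ℝ) * ∑ i, ∫ ω, c.partDrift m i ω ∂μ ≤ 48 * c.η ^ 2 * c.P ^ 2 * c.I ^ 3 *
      (c.σ ^ 2 / c.I + 1 / (N : ℝ) * ∑ i, ∫ ω, ‖c.ctrlDev m i ω‖ ^ 2 ∂μ +
        ∫ ω, ‖c.dF (c.X m ω)‖ ^ 2 ∂μ) := by
  have hN : (0 : ℝ) < N := Nat.cast_pos.2 h.N_pos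
  have hP : (1 : ℝ) ≤ c.P := Nat.one_le_cast.2 h.P_pos
  have hI : (1 : ℝ) ≤ c.I := Nat.one_le_cast.2 h.I_pos
  have hF := h.integrable_wsum hm fun s hs i => h.integrable_fullNoise hm hs i
  have hT := h.integrable_totalDrift hm
  have hBi : ∀ i, Integrable (fun ω => ‖c.ctrlDev m i ω‖ ^ 2) μ := fun i =>
    (h.memLp_ctrlDev hm.le i).integrable_norm_pow (by norm_num)
  have hB := h.integrable_wsum (f := fun _ i ω => ‖c.ctrlDev m i ω‖ ^ 2) hm fun s hs i => hBi i
  have hg : Integrable (fun ω => ‖c.dF (c.X m ω)‖ ^ 2) μ :=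
    (h.memLp_dF_X hm.le).integrable_norm_pow (by norm_num)
  set b := 1 / (N : ℝ) * ∑ i, ∫ ω, ‖c.ctrlDev m i ω‖ ^ 2 ∂μ with hb
  set g := ∫ ω, ‖c.dF (c.X m ω)‖ ^ 2 ∂μ with hgdef
  have hb0 : 0 ≤ b := mul_nonneg (by positivity)
    (Finset.sum_nonneg fun i _ => integral_nonneg fun _ => sq_nonneg _)
  have hg0 : 0 ≤ g := integral_nonneg fun _ => sq_nonneg _
  have hone : ∀ i, ∫ ω, c.partDrift m i ω ∂μ ≤ 16 * c.η ^ 2 * c.I * c.P *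
      (c.P * (c.I * c.σ ^ 2) + c.I * c.L ^ 2 * ∫ ω, c.totalDrift m ω ∂μ +
        c.I ^ 2 * (c.P * b) + c.I ^ 2 * c.P * g) +
      16 * c.η ^ 2 * (c.I ^ 2 * c.σ ^ 2 + c.I ^ 3 * ∫ ω, ‖c.ctrlDev m i ω‖ ^ 2 ∂μ +
        c.I ^ 3 * g) := by
    intro i
    obtain ⟨hNi, hNle⟩ := h.integral_share_mul_partialNoise_le hm i
    have i1 : Integrable (fun ω => WindowDynamics.wsum c.P (c.wq m ω)
        (fun s i => c.fullNoise m s i ω) + c.I * c.L ^ 2 * c.totalDrift m ω) μ :=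
      hF.add (hT.const_mul _)
    have i2 : Integrable (fun ω => WindowDynamics.wsum c.P (c.wq m ω)
        (fun s i => c.fullNoise m s i ω) + c.I * c.L ^ 2 * c.totalDrift m ω +
        c.I ^ 2 * WindowDynamics.wsum c.P (c.wq m ω) (fun _ i => ‖c.ctrlDev m i ω‖ ^ 2)) μ :=
      i1.add (hB.const_mul _)
    have i3 : Integrable (fun ω => WindowDynamics.wsum c.P (c.wq m ω)
        (fun s i => c.fullNoise m s i ω) + c.I * c.L ^ 2 * c.totalDrift m ω +
        c.I ^ 2 * WindowDynamics.wsum c.P (c.wq m ω) (fun _ i => ‖c.ctrlDev m i ω‖ ^ 2) +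
        c.I ^ 2 * c.P * ‖c.dF (c.X m ω)‖ ^ 2) μ := i2.add (hg.const_mul _)
    have i4 : Integrable (fun ω => ∑ s ∈ Finset.range c.P, c.share m s i ω *
        c.partialNoise m s i ω + c.I ^ 3 * ‖c.ctrlDev m i ω‖ ^ 2) μ :=
      hNi.add ((hBi i).const_mul _)
    have i5 : Integrable (fun ω => ∑ s ∈ Finset.range c.P, c.share m s i ω *
        c.partialNoise m s i ω + c.I ^ 3 * ‖c.ctrlDev m i ω‖ ^ 2 +
        c.I ^ 3 * ‖c.dF (c.X m ω)‖ ^ 2) μ := i4.add (hg.const_mul _)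
    have hle := integral_mono_ae (h.integrable_partDrift hm i)
      ((i3.const_mul (16 * c.η ^ 2 * c.I * c.P)).add (i5.const_mul (16 * c.η ^ 2)))
      (h.good_ae.mono fun ω hω => h.partDrift_le hω hm hsmall i)
    simp only [Pi.add_apply] at hle
    rw [integral_add (i3.const_mul _) (i5.const_mul _), integral_const_mul, integral_const_mul,
      integral_add i2 (hg.const_mul _), integral_add i1 (hB.const_mul _),
      integral_add hF (hT.const_mul _), integral_add i4 (hg.const_mul _),
      integral_add hNi ((hBi i).const_mul _), integral_const_mul, integral_const_mul,
      integral_const_mul, integral_const_mul, integral_const_mul, h.integral_wsum_ctrlDev hm] at hle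
    refine hle.trans ?_
    have := h.integral_wsum_fullNoise_le hm
    gcongr
  have hTle := h.integral_totalDrift_le hm hsmall
  rw [← hb, ← hgdef] at hTle
  have hsum := Finset.sum_le_sum fun i (_ : i ∈ Finset.univ) => hone i
  rw [Finset.sum_add_distrib, Finset.sum_const, Finset.card_univ, Fintype.card_fin, nsmul_eq_mul,
    ← Finset.mul_sum, Finset.sum_add_distrib, Finset.sum_add_distrib, Finset.sum_const,
    Finset.sum_const, Finset.card_univ, Fintype.card_fin, nsmul_eq_mul, nsmul_eq_mul,
    ← Finset.mul_sum] at hsum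
  have hbN : ∑ i, ∫ ω, ‖c.ctrlDev m i ω‖ ^ 2 ∂μ = N * b := by rw [hb]; field_simp
  rw [hbN] at hsum
  set T := ∫ ω, c.totalDrift m ω ∂μ
  have h1 : 1 / (N : ℝ) * ∑ i, ∫ ω, c.partDrift m i ω ∂μ ≤ 16 * c.η ^ 2 * c.I * c.P *
      (c.P * (c.I * c.σ ^ 2) + c.I * c.L ^ 2 * T + c.I ^ 2 * (c.P * b) + c.I ^ 2 * c.P * g) +
      16 * c.η ^ 2 * (c.I ^ 2 * c.σ ^ 2 + c.I ^ 3 * b + c.I ^ 3 * g) := by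
    rw [one_div, inv_mul_le_iff₀ hN]
    linarith
  exact h1.trans (partDrift_arith hI hP hb0 hg0 hsmall hTle)

end Valid

end

end

end Experiment

/-! ### Noise and staleness of the control variates -/

namespace Experiment

variable {d N : ℕ} {Ω Ξ : Type*} [MeasurableSpace Ξ] (c : Experiment d N Ω Ξ)

noncomputable section

/-- The mean squared staleness of the control variates. -/
def meanStale [MeasurableSpace Ω] (μ : Measure Ω) (m : ℕ) : ℝ :=
  1 / (N : ℝ) * ∑ i, ∫ ω, ‖c.stale m i ω‖ ^ 2 ∂μ

/-- The mean squared gradient norm. -/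
def meanGrad [MeasurableSpace Ω] (μ : Measure Ω) (m : ℕ) : ℝ := ∫ ω, ‖c.dF (c.X m ω)‖ ^ 2 ∂μ

variable {c}

section

variable [MeasurableSpace Ω] {μ : Measure Ω} (h : c.Valid μ)
include h

namespace Valid

lemma ctrlErr_eq {m : ℕ} (hm : m ≤ c.R / c.P) (i : Fin N) (ω : Ω) :
    c.ctrlErr m i ω = c.stale m i ω + c.Gnoise m i ω := by
  rw [ctrlErr, stale, h.G_eq_add hm]; abel

variable [IsProbabilityMeasure μ]

/-- Second moment of a combination of the noises of the control variates. -/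
lemma integral_sq_sum_Gnoise_le {m : ℕ} (hm : m ≤ c.R / c.P) {v : Fin N → Ω → ℝ}
    (hv : ∀ i, Measurable[c.weightAlg] (v i)) (hv1 : ∀ i, ∀ᵐ ω ∂μ, |v i ω| ≤ 1) :
    MemLp (fun ω => ∑ i, v i ω • c.Gnoise m i ω) 2 μ ∧
    ∫ ω, ‖∑ i, v i ω • c.Gnoise m i ω‖ ^ 2 ∂μ ≤
      c.σ ^ 2 * ∫ ω, ∑ i, v i ω ^ 2 * (c.I * ∑ t, c.coef m i t ω ^ 2) ∂μ := by
  set a : c.Idx → Ω → ℝ := fun j ω => v j.2.2 ω * c.coef m j.2.2 j.1 ω with ha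
  have ham : ∀ j, Measurable[c.weightAlg] (a j) := fun j =>
    (hv j.2.2).mul (h.measurable_coef hm j.2.2 j.1)
  have ha1 : ∀ j, ∀ᵐ ω ∂μ, |a j ω| ≤ 1 := by
    intro j
    filter_upwards [hv1 j.2.2, h.good_ae] with ω h1 hω
    rw [ha, abs_mul]
    exact mul_le_one₀ h1 (abs_nonneg _) (h.abs_coef_le_one hω hm _ _)
  have e1 : ∀ ω, ∑ j, a j ω • c.gradNoise j ω = ∑ i, v i ω • c.Gnoise m i ω := by
    intro ω
    simp only [Gnoise, Finset.smul_sum, Fintype.sum_prod_type, ha, mul_smul]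
    conv_rhs => rw [Finset.sum_comm]
    exact Finset.sum_congr rfl fun t _ => Finset.sum_comm
  have e2 : ∀ ω, ∑ j, a j ω ^ 2 = ∑ i, v i ω ^ 2 * (c.I * ∑ t, c.coef m i t ω ^ 2) := by
    intro ω
    simp only [Fintype.sum_prod_type, ha, mul_pow, Finset.sum_const, Finset.card_univ,
      Fintype.card_fin, nsmul_eq_mul, Finset.mul_sum]
    rw [Finset.sum_comm]
    refine Finset.sum_congr rfl fun i _ => Finset.sum_congr rfl fun t _ => by ring
  have key := h.integral_sq_sum_gradNoise_le ham ha1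
  simp_rw [e1, e2] at key
  exact key

lemma abs_vDev_le {ω : Ω} (hω : c.Good ω) {m : ℕ} (hm : m < c.R / c.P) (i : Fin N) :
    |vDev c.q c.P m i ω| ≤ qbar c.q c.P m i ω + 1 / (N : ℝ) := by
  have h0 := h.qbar_nonneg hω hm i
  have hN : (0 : ℝ) ≤ 1 / (N : ℝ) := by positivity
  rw [vDev, abs_le]
  constructor <;> linarith

lemma abs_vDev_le_one {ω : Ω} (hω : c.Good ω) {m : ℕ} (hm : m < c.R / c.P) (i : Fin N) :
    |vDev c.q c.P m i ω| ≤ 1 := by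
  have h0 := h.qbar_nonneg hω hm i
  have h1 := h.qbar_le_one hω hm i
  have hN : (1 : ℝ) ≤ N := Nat.one_le_cast.2 h.N_pos
  have hN0 : (0 : ℝ) ≤ 1 / (N : ℝ) := by positivity
  have hN1 : 1 / (N : ℝ) ≤ 1 := by rw [div_le_one (by linarith)]; exact hN
  rw [vDev, abs_le]
  constructor <;> linarith

lemma measurable_vDev {m : ℕ} (hm : m < c.R / c.P) (i : Fin N) :
    Measurable[c.weightAlg] (vDev c.q c.P m i) := (h.measurable_qbar hm i).sub_const _

/-- The noise that the control variates add to the update. -/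
lemma integral_sq_vDev_Gnoise_le {m : ℕ} (hm : m < c.R / c.P) :
    MemLp (fun ω => ∑ i, vDev c.q c.P m i ω • c.Gnoise m i ω) 2 μ ∧
    ∫ ω, ‖∑ i, vDev c.q c.P m i ω • c.Gnoise m i ω‖ ^ 2 ∂μ ≤
      c.ρ ^ 2 * c.σ ^ 2 / (c.P * c.I) := by
  have hP : (0 : ℝ) < c.P := Nat.cast_pos.2 h.P_pos
  have hI : (0 : ℝ) < c.I := Nat.cast_pos.2 h.I_pos
  obtain ⟨h1, h2⟩ := h.integral_sq_sum_Gnoise_le hm.le (h.measurable_vDev hm)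
    (fun i => h.good_ae.mono fun ω hω => h.abs_vDev_le_one hω hm i)
  refine ⟨h1, h2.trans ?_⟩
  have e : ∀ ω, ∑ i, vDev c.q c.P m i ω ^ 2 * (c.I * ∑ t, c.coef m i t ω ^ 2) =
      1 / (c.P * c.I) * ∑ i, vDev c.q c.P m i ω ^ 2 * Lam c.q c.P m i ω := by
    intro ω
    rw [Finset.mul_sum]
    refine Finset.sum_congr rfl fun i _ => ?_
    rw [h.sum_sq_coef hm.le]
    field_simp
  simp_rw [e]
  rw [integral_const_mul]
  calc c.σ ^ 2 * (1 / (c.P * c.I) * ∫ ω, ∑ i, vDev c.q c.P m i ω ^ 2 * Lam c.q c.P m i ω ∂μ)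
      ≤ c.σ ^ 2 * (1 / (c.P * c.I) * c.ρ ^ 2) := by
        gcongr
        exact h.reg m hm
    _ = _ := by ring

/-- I steps per slot and squared coefficients of total at most 1/I² leave σ²/I: at least the local
steps average out, even for very uneven weights. -/
lemma integral_sq_Gnoise_le {m : ℕ} (hm : m ≤ c.R / c.P) (i : Fin N) :
    MemLp (c.Gnoise m i) 2 μ ∧ ∫ ω, ‖c.Gnoise m i ω‖ ^ 2 ∂μ ≤ c.σ ^ 2 / c.I := by
  have hI : (0 : ℝ) < c.I := Nat.cast_pos.2 h.I_pos
  obtain ⟨h1, h2⟩ := h.integral_sq_sum_Gnoise_le hm (v := fun i' _ => if i' = i then 1 else 0)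
    (fun _ => measurable_const) (fun i' => Eventually.of_forall fun _ => by split_ifs <;> simp)
  simp only [ite_smul, one_smul, zero_smul, Finset.sum_ite_eq', Finset.mem_univ, if_true, ite_pow,
    one_pow, ne_eq, OfNat.ofNat_ne_zero, not_false_eq_true, zero_pow, ite_mul, one_mul, zero_mul]
    at h1 h2
  refine ⟨h1, h2.trans ?_⟩
  have : ∫ ω, (c.I : ℝ) * ∑ t, c.coef m i t ω ^ 2 ∂μ ≤ ∫ _, 1 / (c.I : ℝ) ∂μ := by
    refine integral_mono_of_nonneg (Eventually.of_forall fun ω =>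
      mul_nonneg hI.le (Finset.sum_nonneg fun _ _ => sq_nonneg _)) (integrable_const _) ?_
    filter_upwards [h.good_ae] with ω hω
    calc (c.I : ℝ) * ∑ t, c.coef m i t ω ^ 2 ≤ c.I * (1 / c.I) ^ 2 := by
          gcongr
          exact h.sum_sq_coef_le hω hm i
      _ = 1 / c.I := by field_simp
  rw [integral_const, probReal_univ, one_smul] at this
  calc _ ≤ c.σ ^ 2 * (1 / (c.I : ℝ)) := mul_le_mul_of_nonneg_left this (sq_nonneg _)
    _ = _ := by ring

/-- The mean squared deviation of the control variates. -/
lemma mean_ctrlDev_le {m : ℕ} (hm : m ≤ c.R / c.P) :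
    1 / (N : ℝ) * ∑ i, ∫ ω, ‖c.ctrlDev m i ω‖ ^ 2 ∂μ ≤
      8 * c.meanStale μ m + 8 * (c.σ ^ 2 / c.I) := by
  have hN : (0 : ℝ) < N := Nat.cast_pos.2 h.N_pos
  have hs : ∀ i, Integrable (fun ω => ‖c.stale m i ω‖ ^ 2) μ := fun i =>
    (h.memLp_stale hm i).integrable_norm_pow (by norm_num)
  have hg : ∀ i, Integrable (fun ω => ‖c.Gnoise m i ω‖ ^ 2) μ := fun i =>
    (h.integral_sq_Gnoise_le hm i).1.integrable_norm_pow (by norm_num)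
  have hd : ∀ i, Integrable (fun ω => ‖c.ctrlDev m i ω‖ ^ 2) μ := fun i =>
    (h.memLp_ctrlDev hm i).integrable_norm_pow (by norm_num)
  -- Splitting the deviation from the mean gives 2 + 2, since N times the squared mean is at most
  -- the sum of squares; splitting each error into staleness and noise doubles this to 8.
  have hpt : ∀ ω, ∑ i, ‖c.ctrlDev m i ω‖ ^ 2 ≤
      ∑ i, (8 * ‖c.stale m i ω‖ ^ 2 + 8 * ‖c.Gnoise m i ω‖ ^ 2) := by
    intro ω
    have h1 : ∀ i, ‖c.ctrlErr m i ω‖ ^ 2 ≤ 2 * ‖c.stale m i ω‖ ^ 2 + 2 * ‖c.Gnoise m i ω‖ ^ 2 := by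
      intro i
      rw [h.ctrlErr_eq hm]
      exact sq_norm_add_le _ _
    have h2 : (N : ℝ) * ‖(1 / (N : ℝ)) • ∑ j, c.ctrlErr m j ω‖ ^ 2 ≤
        ∑ j, ‖c.ctrlErr m j ω‖ ^ 2 := by
      have := sq_norm_sum_le Finset.univ (fun j => c.ctrlErr m j ω)
      rw [Finset.card_univ, Fintype.card_fin] at this
      rw [norm_smul, mul_pow, Real.norm_eq_abs, sq_abs]
      calc (N : ℝ) * ((1 / (N : ℝ)) ^ 2 * ‖∑ j, c.ctrlErr m j ω‖ ^ 2)
          ≤ N * ((1 / (N : ℝ)) ^ 2 * (N * ∑ j, ‖c.ctrlErr m j ω‖ ^ 2)) := by gcongr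
        _ = _ := by field_simp
    have h3 : ∀ i, ‖c.ctrlDev m i ω‖ ^ 2 ≤
        2 * ‖(1 / (N : ℝ)) • ∑ j, c.ctrlErr m j ω‖ ^ 2 + 2 * ‖c.ctrlErr m i ω‖ ^ 2 := by
      intro i
      rw [ctrlDev, sub_eq_add_neg]
      refine (sq_norm_add_le _ _).trans ?_
      rw [norm_neg]
    calc ∑ i, ‖c.ctrlDev m i ω‖ ^ 2 ≤ ∑ i, (2 * ‖(1 / (N : ℝ)) • ∑ j, c.ctrlErr m j ω‖ ^ 2 +
          2 * ‖c.ctrlErr m i ω‖ ^ 2) := Finset.sum_le_sum fun i _ => h3 i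
      _ = 2 * (N * ‖(1 / (N : ℝ)) • ∑ j, c.ctrlErr m j ω‖ ^ 2) +
          2 * ∑ i, ‖c.ctrlErr m i ω‖ ^ 2 := by
        rw [Finset.sum_add_distrib, Finset.sum_const, Finset.card_univ, Fintype.card_fin,
          nsmul_eq_mul, ← Finset.mul_sum]
        ring
      _ ≤ 4 * ∑ i, ‖c.ctrlErr m i ω‖ ^ 2 := by linarith
      _ ≤ 4 * ∑ i, (2 * ‖c.stale m i ω‖ ^ 2 + 2 * ‖c.Gnoise m i ω‖ ^ 2) := by
        gcongr with i
        exact h1 i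
      _ = _ := by
        rw [Finset.mul_sum]
        exact Finset.sum_congr rfl fun i _ => by ring
  have hint : ∀ i, Integrable (fun ω => 8 * ‖c.stale m i ω‖ ^ 2 + 8 * ‖c.Gnoise m i ω‖ ^ 2) μ :=
    fun i => ((hs i).const_mul 8).add ((hg i).const_mul 8)
  have hle := integral_mono (integrable_finsetSum Finset.univ fun i _ => hd i)
    (integrable_finsetSum Finset.univ fun i _ => hint i) hpt
  rw [integral_finsetSum _ fun i _ => hd i, integral_finsetSum _ fun i _ => hint i] at hle
  have h4 : ∀ i ∈ Finset.univ, ∫ ω, (8 * ‖c.stale m i ω‖ ^ 2 + 8 * ‖c.Gnoise m i ω‖ ^ 2) ∂μ ≤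
      8 * ∫ ω, ‖c.stale m i ω‖ ^ 2 ∂μ + 8 * (c.σ ^ 2 / c.I) := by
    intro i _
    rw [integral_add ((hs i).const_mul 8) ((hg i).const_mul 8), integral_const_mul,
      integral_const_mul]
    linarith [(h.integral_sq_Gnoise_le hm i).2]
  have h5 := hle.trans (Finset.sum_le_sum h4)
  rw [Finset.sum_add_distrib, Finset.sum_const, Finset.card_univ, Fintype.card_fin, nsmul_eq_mul,
    ← Finset.mul_sum] at h5
  rw [meanStale, one_div, inv_mul_le_iff₀ hN]
  refine h5.trans (le_of_eq ?_)
  field_simp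

/-- The staleness part of the update. -/
lemma integral_sq_vDev_stale_le {m : ℕ} (hm : m < c.R / c.P)
    (hst : ∀ i, Measurable[c.windowAlg m] (c.stale m i)) :
    MemLp (fun ω => ∑ i, vDev c.q c.P m i ω • c.stale m i ω) 2 μ ∧
    ∫ ω, ‖∑ i, vDev c.q c.P m i ω • c.stale m i ω‖ ^ 2 ∂μ ≤ 4 * c.meanStale μ m := by
  have hN : (0 : ℝ) < N := Nat.cast_pos.2 h.N_pos
  have hL : MemLp (fun ω => ∑ i, vDev c.q c.P m i ω • c.stale m i ω) 2 μ :=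
    memLp_finsetSum _ fun i _ => memLp_smul_of_bound (K := 1)
      ((h.measurable_vDev hm i).mono h.weightAlg_le le_rfl).aestronglyMeasurable
      (h.good_ae.mono fun ω hω => h.abs_vDev_le_one hω hm i) (h.memLp_stale hm.le i)
  refine ⟨hL, ?_⟩
  have hs : ∀ i, Integrable (fun ω => ‖c.stale m i ω‖ ^ 2) μ := fun i =>
    (h.memLp_stale hm.le i).integrable_norm_pow (by norm_num)
  have hqs : Integrable (fun ω => ∑ i, qbar c.q c.P m i ω * ‖c.stale m i ω‖ ^ 2) μ :=
    integrable_finsetSum _ fun i _ => h.integrable_qbar_mul hm i (hs i)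
  have hss : Integrable (fun ω => 1 / (N : ℝ) * ∑ i, ‖c.stale m i ω‖ ^ 2) μ :=
    (integrable_finsetSum _ fun i _ => hs i).const_mul _
  -- Here |q̄^i - 1/N| is replaced by q̄^i + 1/N, weights of total 2. In expectation q̄^i becomes
  -- 1/N as well, whence the constant 2·(1 + 1) = 4.
  have hpt : ∀ᵐ ω ∂μ, ‖∑ i, vDev c.q c.P m i ω • c.stale m i ω‖ ^ 2 ≤
      2 * (∑ i, qbar c.q c.P m i ω * ‖c.stale m i ω‖ ^ 2 +
        1 / (N : ℝ) * ∑ i, ‖c.stale m i ω‖ ^ 2) := by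
    filter_upwards [h.good_ae] with ω hω
    have h1 : ‖∑ i, vDev c.q c.P m i ω • c.stale m i ω‖ ≤
        ∑ i, (qbar c.q c.P m i ω + 1 / (N : ℝ)) * ‖c.stale m i ω‖ := by
      refine (norm_sum_le _ _).trans (Finset.sum_le_sum fun i _ => ?_)
      rw [norm_smul]
      exact mul_le_mul_of_nonneg_right (h.abs_vDev_le hω hm i) (norm_nonneg _)
    have hw : ∀ i, 0 ≤ qbar c.q c.P m i ω + 1 / (N : ℝ) := fun i =>
      add_nonneg (h.qbar_nonneg hω hm i) (by positivity)
    have h2 : (∑ i, (qbar c.q c.P m i ω + 1 / (N : ℝ)) * ‖c.stale m i ω‖) ^ 2 ≤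
        (∑ i, (qbar c.q c.P m i ω + 1 / (N : ℝ))) *
          ∑ i, (qbar c.q c.P m i ω + 1 / (N : ℝ)) * ‖c.stale m i ω‖ ^ 2 :=
      Finset.sum_sq_le_sum_mul_sum_of_sq_le_mul _ (fun i _ => hw i)
        (fun i _ => mul_nonneg (hw i) (sq_nonneg _)) fun i _ => le_of_eq (by ring)
    have h3 : ∑ i, (qbar c.q c.P m i ω + 1 / (N : ℝ)) = 2 := by
      rw [Finset.sum_add_distrib, h.sum_qbar hω hm, Finset.sum_const, Finset.card_univ,
        Fintype.card_fin, nsmul_eq_mul]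
      field_simp
      norm_num
    rw [h3] at h2
    refine (pow_le_pow_left₀ (norm_nonneg _) h1 2).trans (h2.trans (le_of_eq ?_))
    simp_rw [add_mul]
    rw [Finset.sum_add_distrib, ← Finset.mul_sum]
  have hle := integral_mono_ae (hL.integrable_norm_pow (by norm_num)) ((hqs.add hss).const_mul 2) hpt
  simp only [Pi.add_apply] at hle
  rw [integral_const_mul, integral_add hqs hss, h.integral_sum_qbar_mul hm
    (fun i => measurable_sq_norm (hst i)) hs, integral_const_mul,
    integral_finsetSum _ fun i _ => hs i] at hle
  refine hle.trans (le_of_eq ?_)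
  rw [meanStale]
  ring

omit [IsProbabilityMeasure μ] in
-- The two indices keep the σ-algebra fixed while the induction descends to the last window of
-- participation.
lemma measurable_Ghat {m M : ℕ} (hmM : m ≤ M) (hM : M ≤ c.R / c.P) (i : Fin N) :
    Measurable[c.windowAlg M] (c.Ghat m i) := by
  induction m with
  | zero => exact measurable_const
  | succ m ih =>
    have hmul : (m + 1) * c.P ≤ M * c.P := Nat.mul_le_mul_right _ hmM
    rw [Nat.succ_mul] at hmul
    have hq : ∀ s ∈ Finset.range c.P, Measurable[c.windowAlg M] (c.q (m * c.P + s) i) :=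
      fun s hs => measurable_q_windowAlg (by have := Finset.mem_range.1 hs; omega) i
    have hY : ∀ s ∈ Finset.range c.P, ∀ k ∈ Finset.range c.I,
        Measurable[c.windowAlg M] fun ω => c.df i (c.Y (m * c.P + s) i k ω) := by
      intro s hs k hk
      have hs' := Finset.mem_range.1 hs
      refine (h.continuous_df i).measurable.comp (h.measurable_Y (h.lt_R (by omega) hs') i
        (Finset.mem_range.1 hk).le (fun r hr i => measurable_q_windowAlg (by omega) i)
        fun j _ => measurable_S_windowAlg M j)
    have hqb : Measurable[c.windowAlg M] (qbar c.q c.P m i) :=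
      Measurable.const_mul (Finset.measurable_sum (Finset.range c.P) hq) _
    exact Measurable.ite (measurableSet_lt measurable_const hqb)
      ((((Finset.measurable_sum (Finset.range c.P) hq).mul_const _).const_div 1).smul
        (Finset.measurable_sum (Finset.range c.P) fun s hs => (hq s hs).smul
          (Finset.measurable_sum (Finset.range c.I) (hY s hs)))) (ih (by omega))

omit [IsProbabilityMeasure μ] in
lemma measurable_stale {m : ℕ} (hm : m ≤ c.R / c.P) (i : Fin N) :
    Measurable[c.windowAlg m] (c.stale m i) :=
  (h.measurable_Ghat le_rfl hm i).sub (h.measurable_df_X hm i)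

omit [IsProbabilityMeasure μ] in
-- The preliminary window evaluates every client's gradient at x₀ itself, so no initial
-- heterogeneity term is left to be forgotten.
lemma meanStale_zero : c.meanStale μ 0 = 0 := by
  have : ∀ i ω, c.stale 0 i ω = 0 := fun i ω => by
    simp [stale, Ghat, X, state, run]
  simp [meanStale, this]

omit [IsProbabilityMeasure μ] in
-- A participating client stores a share-weighted average of gradients near X, at a distance
-- controlled by its drift; an absent one keeps its error. In both cases the motion of X is then
-- added by Young's inequality.
lemma sq_norm_stale_succ_le {ω : Ω} (hω : c.Good ω) {m : ℕ} (hm : m < c.R / c.P) (i : Fin N) :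
    ‖c.stale (m + 1) i ω‖ ^ 2 ≤ (1 + c.p / 2) * (c.L ^ 2 / c.I * c.partDrift m i ω +
      (if 0 < qbar c.q c.P m i ω then 0 else ‖c.stale m i ω‖ ^ 2)) +
      (1 + 2 / c.p) * (c.L ^ 2 * ‖c.X (m + 1) ω - c.X m ω‖ ^ 2) := by
  have hp := h.p_pos
  have hI : (0 : ℝ) < c.I := Nat.cast_pos.2 h.I_pos
  have hpd : 0 ≤ c.partDrift m i ω := Finset.sum_nonneg fun s hs =>
    mul_nonneg (h.share_nonneg hω hm (Finset.mem_range.1 hs) i)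
      (WindowDynamics.localDrift_nonneg s i)
  -- The parameter p/2 spends half of the contraction: (1 + p/2)(1 - p) ≤ 1 - p/2.
  have young : ∀ a b : Vec d, ‖a + b‖ ^ 2 ≤
      (1 + c.p / 2) * ‖a‖ ^ 2 + (1 + 2 / c.p) * ‖b‖ ^ 2 := by
    intro a b
    have h1 := pow_le_pow_left₀ (norm_nonneg _) (norm_add_le a b) 2
    have h2 : 2 * ‖a‖ * ‖b‖ ≤ c.p / 2 * ‖a‖ ^ 2 + 2 / c.p * ‖b‖ ^ 2 := by
      have := sq_nonneg (c.p * ‖a‖ - 2 * ‖b‖)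
      have e : c.p / 2 * ‖a‖ ^ 2 + 2 / c.p * ‖b‖ ^ 2 - 2 * ‖a‖ * ‖b‖ =
          (c.p * ‖a‖ - 2 * ‖b‖) ^ 2 / (2 * c.p) := by field_simp; ring
      have := div_nonneg this (by positivity : 0 ≤ 2 * c.p)
      linarith
    nlinarith
  have hX : ‖c.df i (c.X m ω) - c.df i (c.X (m + 1) ω)‖ ^ 2 ≤
      c.L ^ 2 * ‖c.X (m + 1) ω - c.X m ω‖ ^ 2 := by
    rw [← mul_pow, norm_sub_rev (c.X (m + 1) ω)]
    exact pow_le_pow_left₀ (norm_nonneg _) (h.lipschitz_df i _ _) 2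
  have e : c.stale (m + 1) i ω = (c.Ghat (m + 1) i ω - c.df i (c.X m ω)) +
      (c.df i (c.X m ω) - c.df i (c.X (m + 1) ω)) := by rw [stale]; abel
  rw [e]
  refine (young _ _).trans ?_
  have hmain : ‖c.Ghat (m + 1) i ω - c.df i (c.X m ω)‖ ^ 2 ≤ c.L ^ 2 / c.I * c.partDrift m i ω +
      (if 0 < qbar c.q c.P m i ω then 0 else ‖c.stale m i ω‖ ^ 2) := by
    by_cases hq : 0 < qbar c.q c.P m i ω
    -- Shares of total one allow ∇f_i(X) to be subtracted inside the average; Jensen over rounds and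
    -- Cauchy–Schwarz over steps then give the drift.
    · rw [if_pos hq, add_zero]
      have hS := (qbar_pos_iff h.P_pos m i ω).1 hq
      have hsum : ∑ s ∈ Finset.range c.P, c.share m s i ω = 1 := by
        rw [h.sum_share, if_pos hq]
      have e2 : c.Ghat (m + 1) i ω - c.df i (c.X m ω) = ∑ s ∈ Finset.range c.P, c.share m s i ω •
          ((1 / (c.I : ℝ)) • ∑ k ∈ Finset.range c.I, c.gradChange m s i k ω) := by
        simp only [gradChange, Finset.sum_sub_distrib, smul_sub, Finset.sum_const,
          Finset.card_range, ← Nat.cast_smul_eq_nsmul ℝ]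
        simp only [smul_smul (1 / (c.I : ℝ)) (c.I : ℝ), one_div_mul_cancel hI.ne', one_smul]
        rw [← Finset.sum_smul, hsum, one_smul]
        congr 1
        simp only [Ghat, if_pos hq, share, Finset.smul_sum (s := Finset.range c.P), smul_smul]
        refine Finset.sum_congr rfl fun s _ => ?_
        congr 1
        field_simp
      rw [e2]
      refine (sq_norm_sum_smul_le _ (fun s hs =>
        h.share_nonneg hω hm (Finset.mem_range.1 hs) i) _).trans ?_
      rw [hsum, one_mul, partDrift, Finset.mul_sum]
      refine Finset.sum_le_sum fun s hs => ?_
      have h1 : ‖(1 / (c.I : ℝ)) • ∑ k ∈ Finset.range c.I, c.gradChange m s i k ω‖ ^ 2 ≤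
          c.L ^ 2 / c.I * c.drift m s i ω := by
        rw [norm_smul, mul_pow, Real.norm_eq_abs, sq_abs]
        have h2 := sq_norm_sum_le (Finset.range c.I) fun k => c.gradChange m s i k ω
        have h3 : ∑ k ∈ Finset.range c.I, ‖c.gradChange m s i k ω‖ ^ 2 ≤
            c.L ^ 2 * c.drift m s i ω := by
          rw [drift, WindowDynamics.localDrift, Finset.mul_sum]
          refine Finset.sum_le_sum fun k _ => ?_
          rw [← mul_pow]
          exact pow_le_pow_left₀ (norm_nonneg _) (h.lipschitz_df i _ _) 2
        rw [Finset.card_range] at h2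
        calc (1 / (c.I : ℝ)) ^ 2 * ‖∑ k ∈ Finset.range c.I, c.gradChange m s i k ω‖ ^ 2
            ≤ (1 / (c.I : ℝ)) ^ 2 * (c.I * (c.L ^ 2 * c.drift m s i ω)) := by
              gcongr
              exact h2.trans (by gcongr)
          _ = _ := by field_simp
      have := mul_le_mul_of_nonneg_left h1 (h.share_nonneg hω hm (Finset.mem_range.1 hs) i)
      linarith
    · rw [if_neg hq]
      have e2 : c.Ghat (m + 1) i ω - c.df i (c.X m ω) = c.stale m i ω := by
        simp only [Ghat, if_neg hq, stale]
      rw [e2]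
      have : 0 ≤ c.L ^ 2 / c.I * c.partDrift m i ω := by positivity
      linarith
  have hp1 : 0 ≤ 1 + c.p / 2 := by positivity
  have hp2 : 0 ≤ 1 + 2 / c.p := by positivity
  exact add_le_add (mul_le_mul_of_nonneg_left hmain hp1) (mul_le_mul_of_nonneg_left hX hp2)

/-- The recursion of the mean squared staleness. -/
lemma meanStale_succ_le {m : ℕ} (hm : m < c.R / c.P) :
    c.meanStale μ (m + 1) ≤ (1 - c.p / 2) * c.meanStale μ m +
      3 / 2 * (c.L ^ 2 / c.I * (1 / (N : ℝ) * ∑ i, ∫ ω, c.partDrift m i ω ∂μ)) +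
      3 / c.p * (c.L ^ 2 * ∫ ω, ‖c.X (m + 1) ω - c.X m ω‖ ^ 2 ∂μ) := by
  have hp := h.p_pos
  have hp1 := h.p_le
  have hI : (0 : ℝ) < c.I := Nat.cast_pos.2 h.I_pos
  have hN : (0 : ℝ) < N := Nat.cast_pos.2 h.N_pos
  have hD : Integrable (fun ω => ‖c.X (m + 1) ω - c.X m ω‖ ^ 2) μ :=
    ((h.memLp_X hm).sub (h.memLp_X hm.le)).integrable_norm_pow (by norm_num)
  set D := ∫ ω, ‖c.X (m + 1) ω - c.X m ω‖ ^ 2 ∂μ with hDdef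
  have hD0 : 0 ≤ D := integral_nonneg fun _ => sq_nonneg _
  have hone : ∀ i, ∫ ω, ‖c.stale (m + 1) i ω‖ ^ 2 ∂μ ≤
      (1 - c.p / 2) * ∫ ω, ‖c.stale m i ω‖ ^ 2 ∂μ +
      3 / 2 * (c.L ^ 2 / c.I * ∫ ω, c.partDrift m i ω ∂μ) + 3 / c.p * (c.L ^ 2 * D) := by
    intro i
    have hs : Integrable (fun ω => ‖c.stale m i ω‖ ^ 2) μ :=
      (h.memLp_stale hm.le i).integrable_norm_pow (by norm_num)
    have hs' : Integrable (fun ω => ‖c.stale (m + 1) i ω‖ ^ 2) μ :=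
      (h.memLp_stale hm i).integrable_norm_pow (by norm_num)
    have hA : MeasurableSet {ω | 0 < qbar c.q c.P m i ω} :=
      measurableSet_lt measurable_const (h.aemeasurable_qbar hm i)
    have hns : Integrable (fun ω => if 0 < qbar c.q c.P m i ω then 0
        else ‖c.stale m i ω‖ ^ 2) μ := by
      refine (hs.indicator hA.compl).congr (Eventually.of_forall fun ω => ?_)
      by_cases hq : 0 < qbar c.q c.P m i ω <;> simp [hq]
    have hpd := h.integrable_partDrift hm i
    have i1 : Integrable (fun ω => c.L ^ 2 / c.I * c.partDrift m i ω +
        (if 0 < qbar c.q c.P m i ω then 0 else ‖c.stale m i ω‖ ^ 2)) μ :=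
      (hpd.const_mul _).add hns
    have hle := integral_mono_ae hs' ((i1.const_mul (1 + c.p / 2)).add
      ((hD.const_mul (c.L ^ 2)).const_mul (1 + 2 / c.p)))
      (h.good_ae.mono fun ω hω => h.sq_norm_stale_succ_le hω hm i)
    simp only [Pi.add_apply] at hle
    rw [integral_add (i1.const_mul _) ((hD.const_mul _).const_mul _), integral_const_mul,
      integral_const_mul, integral_const_mul, integral_add (hpd.const_mul _) hns,
      integral_const_mul, ← hDdef] at hle
    have h1 := h.integral_not_sampled_le hm i (measurable_sq_norm (h.measurable_stale hm.le i)) hs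
      fun _ => sq_nonneg _
    have hs0 : 0 ≤ ∫ ω, ‖c.stale m i ω‖ ^ 2 ∂μ := integral_nonneg fun _ => sq_nonneg _
    have hpd0 : 0 ≤ ∫ ω, c.partDrift m i ω ∂μ := by
      refine integral_nonneg_of_ae (h.good_ae.mono fun ω hω => ?_)
      exact Finset.sum_nonneg fun s hs =>
        mul_nonneg (h.share_nonneg hω hm (Finset.mem_range.1 hs) i)
          (WindowDynamics.localDrift_nonneg s i)
    have h2 : (1 + c.p / 2) * (c.L ^ 2 / c.I * ∫ ω, c.partDrift m i ω ∂μ) ≤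
        3 / 2 * (c.L ^ 2 / c.I * ∫ ω, c.partDrift m i ω ∂μ) := by
      refine mul_le_mul_of_nonneg_right (by linarith) (by positivity)
    have h3 : (1 + 2 / c.p) * (c.L ^ 2 * D) ≤ 3 / c.p * (c.L ^ 2 * D) := by
      refine mul_le_mul_of_nonneg_right ?_ (by positivity)
      have : 1 ≤ 1 / c.p := by rw [le_div_iff₀ hp]; linarith
      have e : 3 / c.p = 1 / c.p + 2 / c.p := by ring
      linarith
    have h4 : (1 + c.p / 2) * ((1 - c.p) * ∫ ω, ‖c.stale m i ω‖ ^ 2 ∂μ) ≤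
        (1 - c.p / 2) * ∫ ω, ‖c.stale m i ω‖ ^ 2 ∂μ := by
      rw [← mul_assoc]
      refine mul_le_mul_of_nonneg_right ?_ hs0
      nlinarith
    have h5 := mul_le_mul_of_nonneg_left h1 (by positivity : 0 ≤ 1 + c.p / 2)
    linarith
  have hsum := Finset.sum_le_sum fun i (_ : i ∈ Finset.univ) => hone i
  rw [Finset.sum_add_distrib, Finset.sum_add_distrib, Finset.sum_const, Finset.card_univ,
    Fintype.card_fin, nsmul_eq_mul, ← Finset.mul_sum, ← Finset.mul_sum, ← Finset.mul_sum] at hsum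
  simp only [meanStale]
  have := mul_le_mul_of_nonneg_left hsum (by positivity : 0 ≤ 1 / (N : ℝ))
  refine this.trans (le_of_eq ?_)
  field_simp

end Valid

end

end

end Experiment

/-! ### The update direction of a window -/

namespace Experiment

variable {d N : ℕ} {Ω Ξ : Type*} [MeasurableSpace Ξ] (c : Experiment d N Ω Ξ)

noncomputable section

/-- The average gradient noise of window `m`. -/
def meanNoise (m : ℕ) (ω : Ω) : Vec d :=
  (1 / ((c.P : ℝ) * c.I)) • ∑ s ∈ Finset.range c.P, ∑ i, c.q (m * c.P + s) i ω •
    ∑ k ∈ Finset.range c.I, c.noise (m * c.P + s) k i ω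

/-- The average gradient change of window `m`. -/
def meanChange (m : ℕ) (ω : Ω) : Vec d :=
  (1 / ((c.P : ℝ) * c.I)) • ∑ s ∈ Finset.range c.P, ∑ i, c.q (m * c.P + s) i ω •
    ∑ k ∈ Finset.range c.I, c.gradChange m s i k ω

/-- The contribution of the errors of the control variates to the update of window `m`. -/
def ctrlBias (m : ℕ) (ω : Ω) : Vec d := ∑ i, vDev c.q c.P m i ω • c.ctrlErr m i ω

/-- The update direction of window `m`. -/
def dir (m : ℕ) (ω : Ω) : Vec d :=
  c.dF (c.X m ω) + c.meanNoise m ω + c.meanChange m ω - c.ctrlBias m ω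

/-- The effective step size. -/
def stepSize : ℝ := c.γ * c.η * c.P * c.I

variable {c}

section

variable [MeasurableSpace Ω] {μ : Measure Ω} (h : c.Valid μ)
include h

namespace Valid

/-- As the q̄^i sum to one, the mean control error appears with weight one and turns the weights
q̄^i into q̄^i - 1/N. -/
lemma sum_qbar_smul_ctrlDev {ω : Ω} (hω : c.Good ω) {m : ℕ} (hm : m < c.R / c.P) :
    ∑ i, qbar c.q c.P m i ω • c.ctrlDev m i ω = -c.ctrlBias m ω := by
  simp only [ctrlDev, ctrlBias, vDev, smul_sub, sub_smul, Finset.sum_sub_distrib]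
  rw [← Finset.sum_smul, h.sum_qbar hω hm, one_smul, ← Finset.smul_sum]
  abel

lemma X_succ_eq {ω : Ω} (hω : c.Good ω) {m : ℕ} (hm : m < c.R / c.P) :
    c.X (m + 1) ω = c.X m ω + -(c.stepSize • c.dir m ω) := by
  have hP : (0 : ℝ) < c.P := Nat.cast_pos.2 h.P_pos
  have hI : (0 : ℝ) < c.I := Nat.cast_pos.2 h.I_pos
  have W := h.dynamics hm hω
  rw [h.X_succ]
  congr 1
  have e1 : ∀ s ∈ Finset.range c.P, c.upd (m * c.P + s) ω = -(c.η • (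
      (∑ i, c.q (m * c.P + s) i ω • ∑ k ∈ Finset.range c.I, c.noise (m * c.P + s) k i ω) +
      (∑ i, c.q (m * c.P + s) i ω • ∑ k ∈ Finset.range c.I, c.gradChange m s i k ω) +
      (c.I : ℝ) • (∑ i, c.q (m * c.P + s) i ω • c.ctrlDev m i ω) +
      (c.I : ℝ) • c.dF (c.X m ω))) := by
    intro s hs
    have hs' := Finset.mem_range.1 hs
    have hq : ∑ i, c.q (m * c.P + s) i ω = 1 := (hω _ (h.lt_R hm hs')).2.1
    have e2 : (c.I : ℝ) • c.dF (c.X m ω) =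
        ∑ i, c.q (m * c.P + s) i ω • ((c.I : ℝ) • c.dF (c.X m ω)) := by
      rw [← Finset.sum_smul, hq, one_smul]
    rw [e2, Finset.smul_sum (r := (c.I : ℝ)), ← Finset.sum_add_distrib, ← Finset.sum_add_distrib,
      ← Finset.sum_add_distrib, Finset.smul_sum, ← Finset.sum_neg_distrib, upd]
    refine Finset.sum_congr rfl fun i _ => ?_
    rw [W.iter s hs' i c.I]
    simp only [Finset.sum_add_distrib, Finset.sum_const, Finset.card_range,
      ← Nat.cast_smul_eq_nsmul ℝ]
    module
  have e3 : ∑ s ∈ Finset.range c.P, ∑ i, c.q (m * c.P + s) i ω • c.ctrlDev m i ω =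
      (c.P : ℝ) • -c.ctrlBias m ω := by
    rw [← h.sum_qbar_smul_ctrlDev hω hm, Finset.sum_comm, Finset.smul_sum]
    refine Finset.sum_congr rfl fun i _ => ?_
    rw [← Finset.sum_smul, smul_smul, qbar_mul h.P_pos]
  rw [Finset.sum_congr rfl e1, Finset.sum_neg_distrib, ← Finset.smul_sum, Finset.sum_add_distrib,
    Finset.sum_add_distrib, Finset.sum_add_distrib, ← Finset.smul_sum, e3, Finset.sum_const,
    Finset.card_range, ← Nat.cast_smul_eq_nsmul ℝ, dir, meanNoise, meanChange, stepSize]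
  set A := ∑ s ∈ Finset.range c.P, ∑ i, c.q (m * c.P + s) i ω •
    ∑ k ∈ Finset.range c.I, c.noise (m * c.P + s) k i ω
  set B := ∑ s ∈ Finset.range c.P, ∑ i, c.q (m * c.P + s) i ω •
    ∑ k ∈ Finset.range c.I, c.gradChange m s i k ω
  match_scalars <;> field_simp

variable [IsProbabilityMeasure μ]

/-- Coefficients q_r^i/(PI) over P rounds and I steps have squares summing to at most PI·ρ²/(PI)²;
this is the variance reduction by averaging over clients. -/
lemma integral_sq_meanNoise_le {m : ℕ} (hm : m < c.R / c.P) :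
    MemLp (c.meanNoise m) 2 μ ∧
      ∫ ω, ‖c.meanNoise m ω‖ ^ 2 ∂μ ≤ c.ρ ^ 2 * c.σ ^ 2 / (c.P * c.I) := by
  have hP : (0 : ℝ) < c.P := Nat.cast_pos.2 h.P_pos
  have hI : (0 : ℝ) < c.I := Nat.cast_pos.2 h.I_pos
  have hP1 : (1 : ℝ) ≤ c.P := Nat.one_le_cast.2 h.P_pos
  have hI1 : (1 : ℝ) ≤ c.I := Nat.one_le_cast.2 h.I_pos
  set w : ℝ := 1 / ((c.P : ℝ) * c.I) with hw
  have hw0 : 0 ≤ w := by positivity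
  have hw1 : w ≤ 1 := by
    rw [hw, div_le_one (by positivity)]; nlinarith
  set a : c.Idx → Ω → ℝ := fun j ω => Sum.elim (fun _ => 0)
    (fun r : Fin c.R => if (r : ℕ) / c.P = m then w * c.q r j.2.2 ω else 0) j.1 with ha
  have ham : ∀ j, Measurable[c.weightAlg] (a j) := by
    rintro ⟨s | r, k, i⟩
    · exact measurable_const
    · simp only [ha, Sum.elim_inr]
      split_ifs
      · exact (c.measurable_q_weightAlg r.2 i).const_mul w
      · exact measurable_const
  have ha1 : ∀ j, ∀ᵐ ω ∂μ, |a j ω| ≤ 1 := by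
    rintro ⟨s | r, k, i⟩
    · simp [ha]
    · filter_upwards [h.good_ae] with ω hω
      simp only [ha, Sum.elim_inr]
      split_ifs
      · rw [abs_of_nonneg (mul_nonneg hw0 ((hω r r.2).1 i))]
        exact mul_le_one₀ hw1 ((hω r r.2).1 i) (hω.q_le_one r.2 i)
      · simp
  have e1 : ∀ ω, ∑ j, a j ω • c.gradNoise j ω = c.meanNoise m ω := by
    intro ω
    have key := sum_window h.P_pos (h.succ_mul_le hm) (fun r => w • ∑ i, c.q r i ω •
      ∑ k ∈ Finset.range c.I, c.noise r k i ω)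
    rw [meanNoise, Finset.smul_sum, ← key, Fintype.sum_prod_type, Fintype.sum_sum_type]
    simp only [ha, Sum.elim_inl, zero_smul, Finset.sum_const_zero, zero_add, Sum.elim_inr]
    refine Finset.sum_congr rfl fun r _ => ?_
    split_ifs
    · rw [Fintype.sum_prod_type, Finset.sum_comm, Finset.smul_sum]
      refine Finset.sum_congr rfl fun i _ => ?_
      rw [smul_smul, Finset.sum_range, Finset.smul_sum]
      rfl
    · simp
  have e2 : ∀ ω, ∑ j, a j ω ^ 2 =
      w ^ 2 * c.I * ∑ s ∈ Finset.range c.P, ∑ i, c.q (m * c.P + s) i ω ^ 2 := by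
    intro ω
    have key := sum_window h.P_pos (h.succ_mul_le hm) (fun r => w ^ 2 * c.I * ∑ i, c.q r i ω ^ 2)
    rw [Finset.mul_sum, ← key, Fintype.sum_prod_type, Fintype.sum_sum_type]
    simp only [ha, Sum.elim_inl, ne_eq, OfNat.ofNat_ne_zero, not_false_eq_true, zero_pow,
      Finset.sum_const_zero, zero_add, Sum.elim_inr]
    refine Finset.sum_congr rfl fun r _ => ?_
    split_ifs
    · simp only [Fintype.sum_prod_type, Finset.sum_const, Finset.card_univ, Fintype.card_fin,
        nsmul_eq_mul, mul_pow, ← Finset.mul_sum]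
      ring
    · simp
  obtain ⟨h1, h2⟩ := h.integral_sq_sum_gradNoise_le ham ha1
  simp_rw [e1] at h1 h2
  refine ⟨h1, h2.trans ?_⟩
  have h3 : ∫ ω, ∑ j, a j ω ^ 2 ∂μ ≤ ∫ _, w ^ 2 * c.I * (c.P * c.ρ ^ 2) ∂μ := by
    refine integral_mono_of_nonneg (Eventually.of_forall fun ω =>
      Finset.sum_nonneg fun _ _ => sq_nonneg _) (integrable_const _) ?_
    filter_upwards [h.good_ae] with ω hω
    rw [e2]
    refine mul_le_mul_of_nonneg_left ?_ (by positivity)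
    refine (Finset.sum_le_sum fun s hs =>
      (hω _ (h.lt_R hm (Finset.mem_range.1 hs))).2.2).trans (le_of_eq ?_)
    simp
  rw [integral_const, probReal_univ, one_smul] at h3
  refine (mul_le_mul_of_nonneg_left h3 (sq_nonneg _)).trans (le_of_eq ?_)
  rw [hw]
  field_simp

lemma memLp_meanChange {m : ℕ} (hm : m < c.R / c.P) : MemLp (c.meanChange m) 2 μ := by
  have h1 : ∀ s < c.P, ∀ i, ∀ k < c.I, MemLp (c.gradChange m s i k) 2 μ := fun s hs i k hk =>
    (h.memLp_df i (h.memLp_Y hm hs i hk.le)).sub (h.memLp_df_X hm.le i)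
  have h2 : ∀ s < c.P, ∀ i, MemLp (fun ω => c.q (m * c.P + s) i ω •
      ∑ k ∈ Finset.range c.I, c.gradChange m s i k ω) 2 μ := fun s hs i =>
    h.memLp_q_smul (h.lt_R hm hs) i
      (memLp_finsetSum _ fun k hk => h1 s hs i k (Finset.mem_range.1 hk))
  have h3 : MemLp (fun ω => ∑ s ∈ Finset.range c.P, ∑ i, c.q (m * c.P + s) i ω •
      ∑ k ∈ Finset.range c.I, c.gradChange m s i k ω) 2 μ :=
    memLp_finsetSum _ fun s hs => memLp_finsetSum _ fun i _ => h2 s (Finset.mem_range.1 hs) i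
  exact h3.const_smul (1 / ((c.P : ℝ) * c.I))

/-- The gradient change is controlled by the drift. -/
lemma integral_sq_meanChange_le {m : ℕ} (hm : m < c.R / c.P) :
    ∫ ω, ‖c.meanChange m ω‖ ^ 2 ∂μ ≤
      c.L ^ 2 / (c.P * c.I) * ∫ ω, c.totalDrift m ω ∂μ := by
  have hP : (0 : ℝ) < c.P := Nat.cast_pos.2 h.P_pos
  have hI : (0 : ℝ) < c.I := Nat.cast_pos.2 h.I_pos
  rw [← integral_const_mul]
  refine integral_mono_ae ((h.memLp_meanChange hm).integrable_norm_pow (by norm_num))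
    ((h.integrable_totalDrift hm).const_mul _) (h.good_ae.mono fun ω hω => ?_)
  have W := h.dynamics hm hω
  have h1 : ∀ s i, ‖∑ k ∈ Finset.range c.I, c.gradChange m s i k ω‖ ^ 2 ≤
      c.I * c.L ^ 2 * c.drift m s i ω := by
    intro s i
    refine (sq_norm_sum_le _ _).trans ?_
    rw [Finset.card_range, mul_assoc, drift, WindowDynamics.localDrift,
      Finset.mul_sum (a := c.L ^ 2)]
    refine mul_le_mul_of_nonneg_left (Finset.sum_le_sum fun k _ => ?_) hI.le
    rw [← mul_pow]
    exact pow_le_pow_left₀ (norm_nonneg _) (h.lipschitz_df i _ _) 2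
  have h2 : ∀ s ∈ Finset.range c.P, ‖∑ i, c.q (m * c.P + s) i ω •
      ∑ k ∈ Finset.range c.I, c.gradChange m s i k ω‖ ^ 2 ≤
      ∑ i, c.q (m * c.P + s) i ω * (c.I * c.L ^ 2 * c.drift m s i ω) := by
    intro s hs
    have hs' := Finset.mem_range.1 hs
    refine (sq_norm_sum_smul_le _ (fun i _ => W.nonneg s hs' i) _).trans ?_
    rw [show ∑ i, c.wq m ω s i = 1 from W.sum_eq s hs', one_mul]
    exact Finset.sum_le_sum fun i _ => mul_le_mul_of_nonneg_left (h1 s i) (W.nonneg s hs' i)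
  show ‖c.meanChange m ω‖ ^ 2 ≤ c.L ^ 2 / (c.P * c.I) * c.totalDrift m ω
  rw [meanChange, norm_smul, mul_pow, Real.norm_eq_abs, sq_abs]
  have h3 := sq_norm_sum_le (Finset.range c.P) fun s => ∑ i, c.q (m * c.P + s) i ω •
    ∑ k ∈ Finset.range c.I, c.gradChange m s i k ω
  rw [Finset.card_range] at h3
  have h4 := mul_le_mul_of_nonneg_left (h3.trans
    (mul_le_mul_of_nonneg_left (Finset.sum_le_sum h2) hP.le)) (sq_nonneg (1 / ((c.P : ℝ) * c.I)))
  refine h4.trans (le_of_eq ?_)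
  have e : ∑ s ∈ Finset.range c.P, ∑ i, c.q (m * c.P + s) i ω *
      (c.I * c.L ^ 2 * c.drift m s i ω) = c.I * c.L ^ 2 * c.totalDrift m ω := by
    rw [totalDrift, WindowDynamics.wsum, Finset.mul_sum]
    refine Finset.sum_congr rfl fun s _ => ?_
    rw [Finset.mul_sum]
    refine Finset.sum_congr rfl fun i _ => ?_
    simp only [wq]
    ring
  rw [e]
  field_simp

lemma ctrlBias_eq {m : ℕ} (hm : m < c.R / c.P) (ω : Ω) :
    c.ctrlBias m ω = ∑ i, vDev c.q c.P m i ω • c.stale m i ω +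
      ∑ i, vDev c.q c.P m i ω • c.Gnoise m i ω := by
  rw [ctrlBias, ← Finset.sum_add_distrib]
  refine Finset.sum_congr rfl fun i _ => ?_
  rw [h.ctrlErr_eq hm.le, smul_add]

lemma memLp_ctrlBias {m : ℕ} (hm : m < c.R / c.P) : MemLp (c.ctrlBias m) 2 μ := by
  have := (h.integral_sq_vDev_stale_le hm (h.measurable_stale hm.le)).1.add
    (h.integral_sq_vDev_Gnoise_le hm).1
  refine this.congr_norm ?_ (Eventually.of_forall fun ω => ?_)
  · exact this.1.congr (Eventually.of_forall fun ω => (h.ctrlBias_eq hm ω).symm)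
  · rw [h.ctrlBias_eq hm]; rfl

lemma memLp_dir {m : ℕ} (hm : m < c.R / c.P) : MemLp (c.dir m) 2 μ :=
  (((h.memLp_dF_X hm.le).add (h.integral_sq_meanNoise_le hm).1).add (h.memLp_meanChange hm)).sub
    (h.memLp_ctrlBias hm)

omit [IsProbabilityMeasure μ] h in
lemma sq_norm_add₅_le {E : Type*} [NormedAddCommGroup E] [NormedSpace ℝ E] (a b e f g : E) :
    ‖a + b + e - (f + g)‖ ^ 2 ≤
      5 * (‖a‖ ^ 2 + ‖b‖ ^ 2 + ‖e‖ ^ 2 + ‖f‖ ^ 2 + ‖g‖ ^ 2) := by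
  have := sq_norm_sum_le Finset.univ ![a, b, e, -f, -g]
  simp only [Fin.sum_univ_five, Matrix.cons_val, Finset.card_univ, Fintype.card_fin, norm_neg]
    at this
  rw [show a + b + e - (f + g) = a + b + e + -f + -g by abel]
  exact_mod_cast this

/-- The second moment of the update direction. -/
lemma integral_sq_dir_le {m : ℕ} (hm : m < c.R / c.P) :
    ∫ ω, ‖c.dir m ω‖ ^ 2 ∂μ ≤ 5 * (c.meanGrad μ m +
      c.L ^ 2 / (c.P * c.I) * ∫ ω, c.totalDrift m ω ∂μ +
      2 * (c.ρ ^ 2 * c.σ ^ 2 / (c.P * c.I)) + 4 * c.meanStale μ m) := by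
  have sqi : ∀ {v : Ω → Vec d}, MemLp v 2 μ → Integrable (fun ω => ‖v ω‖ ^ 2) μ := fun hv =>
    hv.integrable_norm_pow (by norm_num)
  obtain ⟨n1, n2⟩ := h.integral_sq_meanNoise_le hm
  obtain ⟨s1, s2⟩ := h.integral_sq_vDev_stale_le hm (h.measurable_stale hm.le)
  obtain ⟨g1, g2⟩ := h.integral_sq_vDev_Gnoise_le hm
  have c1 := h.memLp_meanChange hm
  have c2 := h.integral_sq_meanChange_le hm
  have f1 := h.memLp_dF_X hm.le
  -- Five summands: gradient, current noise, gradient change, and the stale and noisy halves of the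
  -- control bias. The two noises share one bound, hence the factor 2.
  have hle := integral_mono (sqi (h.memLp_dir hm))
    ((((((sqi f1).add (sqi n1)).add (sqi c1)).add (sqi s1)).add (sqi g1)).const_mul 5)
    (fun ω => by
      simp only [dir, h.ctrlBias_eq hm]
      exact sq_norm_add₅_le _ _ _ _ _)
  rw [integral_const_mul, integral_add' (((((sqi f1).add (sqi n1)).add (sqi c1)).add (sqi s1)))
    (sqi g1), integral_add' ((((sqi f1).add (sqi n1)).add (sqi c1))) (sqi s1),
    integral_add' (((sqi f1).add (sqi n1))) (sqi c1), integral_add' (sqi f1) (sqi n1)] at hle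
  rw [meanGrad]
  linarith

/-- The current gradient noise is orthogonal to the gradient. -/
lemma integral_inner_meanNoise {m : ℕ} (hm : m < c.R / c.P) :
    ∫ ω, ⟪c.dF (c.X m ω), c.meanNoise m ω⟫ ∂μ = 0 := by
  have hterm : ∀ s (hs : s < c.P), ∀ i, ∀ k (hk : k < c.I),
      Integrable (fun ω => ⟪c.q (m * c.P + s) i ω • c.dF (c.X m ω),
        c.noise (m * c.P + s) k i ω⟫) μ ∧
      ∫ ω, ⟪c.q (m * c.P + s) i ω • c.dF (c.X m ω), c.noise (m * c.P + s) k i ω⟫ ∂μ = 0 := by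
    intro s hs i k hk
    have hr := h.lt_R hm hs
    have hv : MemLp (fun ω => c.q (m * c.P + s) i ω • c.dF (c.X m ω)) 2 μ :=
      h.memLp_q_smul hr i (h.memLp_dF_X hm.le)
    refine ⟨integrable_inner_of_memLp hv (h.memLp_noise hr hk i), ?_⟩
    set j : c.Idx := (Sum.inr ⟨m * c.P + s, hr⟩, ⟨k, hk⟩, i) with hj
    refine h.integral_inner_gradNoise j ?_ hv
    -- The model at the window start uses only samples of time at most mPI, which excludes every
    -- sample of the window.
    refine ((c.measurable_q_weightAlg hr i).mono (c.weightAlg_le_otherAlg j) le_rfl).smul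
      (h.continuous_dF.measurable.comp (h.measurable_state (h.mul_le_R hm.le) (fun r' hr' i' =>
        (c.measurable_q_weightAlg (by omega) i').mono (c.weightAlg_le_otherAlg j) le_rfl)
        fun j' hj' => c.measurable_S_otherAlg fun e => ?_).1)
    subst e
    simp only [hj, time, Sum.elim_inr] at hj'
    nlinarith
  have e : ∀ ω, ⟪c.dF (c.X m ω), c.meanNoise m ω⟫ = 1 / ((c.P : ℝ) * c.I) *
      ∑ s ∈ Finset.range c.P, ∑ i, ∑ k ∈ Finset.range c.I,
        ⟪c.q (m * c.P + s) i ω • c.dF (c.X m ω), c.noise (m * c.P + s) k i ω⟫ := by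
    intro ω
    simp only [meanNoise, inner_smul_right, inner_sum, real_inner_smul_left, Finset.mul_sum]
  simp_rw [e]
  rw [integral_const_mul, integral_finsetSum _ fun s hs => integrable_finsetSum _ fun i _ =>
    integrable_finsetSum _ fun k hk =>
      (hterm s (Finset.mem_range.1 hs) i k (Finset.mem_range.1 hk)).1,
    Finset.sum_eq_zero, mul_zero]
  intro s hs
  rw [integral_finsetSum _ fun i _ => integrable_finsetSum _ fun k hk =>
      (hterm s (Finset.mem_range.1 hs) i k (Finset.mem_range.1 hk)).1]
  refine Finset.sum_eq_zero fun i _ => ?_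
  rw [integral_finsetSum _ fun k hk =>
      (hterm s (Finset.mem_range.1 hs) i k (Finset.mem_range.1 hk)).1]
  exact Finset.sum_eq_zero fun k hk =>
    (hterm s (Finset.mem_range.1 hs) i k (Finset.mem_range.1 hk)).2

/-- Unbiased participation makes the control variates unbiased. -/
lemma integral_inner_ctrlBias {m : ℕ} (hm : m < c.R / c.P) :
    ∫ ω, ⟪c.dF (c.X m ω), c.ctrlBias m ω⟫ ∂μ = 0 := by
  have hint : ∀ i, Integrable (fun ω => ⟪c.dF (c.X m ω), c.ctrlErr m i ω⟫) μ := fun i =>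
    integrable_inner_of_memLp (h.memLp_dF_X hm.le) (h.memLp_ctrlErr hm.le i)
  have hv : ∀ i, Integrable (fun ω => vDev c.q c.P m i ω * ⟪c.dF (c.X m ω), c.ctrlErr m i ω⟫) μ :=
    fun i => (hint i).bdd_mul (c := 1)
      ((h.measurable_vDev hm i).mono h.weightAlg_le le_rfl).aestronglyMeasurable
      (h.good_ae.mono fun ω hω => h.abs_vDev_le_one hω hm i)
  simp only [ctrlBias, inner_sum, inner_smul_right]
  rw [integral_finsetSum _ fun i _ => hv i]
  exact Finset.sum_eq_zero fun i _ => h.integral_vDev_mul hm i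
    ((h.measurable_dF_X hm.le).inner (h.measurable_ctrlErr hm.le i)) (hint i)

/-- The update direction is aligned with the gradient. -/
lemma le_integral_inner_dir {m : ℕ} (hm : m < c.R / c.P) :
    1 / 2 * c.meanGrad μ m - 1 / 2 * (c.L ^ 2 / (c.P * c.I) * ∫ ω, c.totalDrift m ω ∂μ) ≤
      ∫ ω, ⟪c.dF (c.X m ω), c.dir m ω⟫ ∂μ := by
  have f1 := h.memLp_dF_X hm.le
  have c1 := h.memLp_meanChange hm
  have i1 : Integrable (fun ω => ‖c.dF (c.X m ω)‖ ^ 2) μ := f1.integrable_norm_pow (by norm_num)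
  have i2 : Integrable (fun ω => ‖c.meanChange m ω‖ ^ 2) μ := c1.integrable_norm_pow (by norm_num)
  have i3 := integrable_inner_of_memLp f1 (h.integral_sq_meanNoise_le hm).1
  have i4 := integrable_inner_of_memLp f1 c1
  have i5 := integrable_inner_of_memLp f1 (h.memLp_ctrlBias hm)
  have e : ∀ ω, ⟪c.dF (c.X m ω), c.dir m ω⟫ = ‖c.dF (c.X m ω)‖ ^ 2 +
      ⟪c.dF (c.X m ω), c.meanNoise m ω⟫ + ⟪c.dF (c.X m ω), c.meanChange m ω⟫ -
      ⟪c.dF (c.X m ω), c.ctrlBias m ω⟫ := by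
    intro ω
    rw [dir, inner_sub_right, inner_add_right, inner_add_right, real_inner_self_eq_norm_sq]
  simp_rw [e]
  have i6 : Integrable (fun ω => ‖c.dF (c.X m ω)‖ ^ 2 + ⟪c.dF (c.X m ω), c.meanNoise m ω⟫) μ :=
    i1.add i3
  have i7 : Integrable (fun ω => ‖c.dF (c.X m ω)‖ ^ 2 + ⟪c.dF (c.X m ω), c.meanNoise m ω⟫ +
    ⟪c.dF (c.X m ω), c.meanChange m ω⟫) μ := i6.add i4
  rw [integral_sub i7 i5, integral_add i6 i4, integral_add i1 i3, h.integral_inner_meanNoise hm, h.integral_inner_ctrlBias hm]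
  -- Only the gradient change can oppose the gradient in mean; half of the squared gradient pays for
  -- the cross term.
  have hle : ∫ ω, (-(1 / 2) * ‖c.dF (c.X m ω)‖ ^ 2 + -(1 / 2) * ‖c.meanChange m ω‖ ^ 2) ∂μ ≤
      ∫ ω, ⟪c.dF (c.X m ω), c.meanChange m ω⟫ ∂μ := by
    refine integral_mono ((i1.const_mul _).add (i2.const_mul _)) i4 fun ω => ?_
    have h1 := sq_nonneg ‖c.dF (c.X m ω) + c.meanChange m ω‖
    rw [norm_add_sq_real] at h1
    simp only
    linarith
  rw [integral_add (i1.const_mul _) (i2.const_mul _), integral_const_mul, integral_const_mul] at hle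
  have := h.integral_sq_meanChange_le hm
  rw [meanGrad]
  linarith

end Valid

end

end

end Experiment

/-! ### Summation over the windows -/

/-- Resolution of the coupled bounds on the total squared gradient `g`, the total drifts `t` and
`t'`, the total squared update direction `z` and the total staleness `C`. -/
lemma resolve_bounds {p L α K s ν A B W Δ g C t t' z : ℝ} (hp : 0 < p) (hp1 : p ≤ 1) (hL : 0 < L)
    (hα : 0 < α) (hW : 0 ≤ W) (hA : 0 ≤ A) (hB : 0 ≤ B) (hg : 0 ≤ g) (hC : 0 ≤ C)
    (ht : 0 ≤ t) (hz0 : 0 ≤ z) (hK : K ≤ p / 69696) (hKs : K * s ≤ A / 69696)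
    (hLα : L * α ≤ p / 60) (hLαν : L * α * ν ≤ A / 60)
    (hgap : Δ ≤ α * W * (60 * A + 60 * B))
    (t_le : t ≤ 32 * K * (9 * s * W + 8 * C + g)) (t'_le : t' ≤ 48 * K * (9 * s * W + 8 * C + g))
    (z_le : z ≤ 5 * (g + t + 2 * ν * W + 4 * C))
    (descent_le : α * (1 / 2 * g - 1 / 2 * t) ≤ Δ + L / 2 * α ^ 2 * z)
    (stale_le : p / 2 * C ≤ 3 / 2 * t' + 3 / p * (L ^ 2 * (α ^ 2 * z))) :
    g ≤ 135 * W * (A + B) := by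
  -- The natural unknown is pC, the quantity that `stale_le` controls. Every C elsewhere has a
  -- factor K or Lα, and both are at most a small multiple of p.
  have hKC : K * C ≤ p * C / 69696 := by
    have := mul_le_mul_of_nonneg_right hK hC
    linarith
  have hKg : K * g ≤ g / 69696 := by
    have := mul_le_mul_of_nonneg_right (hK.trans (by linarith : p / 69696 ≤ 1 / 69696)) hg
    linarith
  have hKs' : K * s * W ≤ A * W / 69696 := by
    have := mul_le_mul_of_nonneg_right hKs hW
    linarith
  have ha0 : 0 ≤ L * α := by positivity
  have ha1 : L * α ≤ 1 / 60 := by linarith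
  have hag := mul_le_mul_of_nonneg_right ha1 hg
  have hat := mul_le_mul_of_nonneg_right ha1 ht
  have haC := mul_le_mul_of_nonneg_right hLα hC
  have haν := mul_le_mul_of_nonneg_right hLαν hW
  have haz := mul_le_mul_of_nonneg_left z_le ha0
  -- The factor 1/p from Young's inequality is cancelled by one factor Lα ≤ p/60.
  have hstale : 3 / p * (L ^ 2 * (α ^ 2 * z)) ≤ L * α * z / 20 := by
    have e : 3 / p * (L ^ 2 * (α ^ 2 * z)) = 3 * (L * α) * (L * α * z) / p := by ring
    rw [e, div_le_iff₀ hp]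
    have := mul_le_mul_of_nonneg_right hLα (mul_nonneg ha0 hz0)
    linarith
  have hdesc : 1 / 2 * g - 1 / 2 * t ≤ W * (60 * A + 60 * B) + L * α * z / 2 := by
    refine le_of_mul_le_mul_left ?_ hα
    calc α * (1 / 2 * g - 1 / 2 * t) ≤ _ := descent_le
      _ ≤ α * W * (60 * A + 60 * B) + L / 2 * α ^ 2 * z := by linarith
      _ = _ := by ring
  have hAW : 0 ≤ A * W := by positivity
  have hBW : 0 ≤ B * W := by positivity
  have hpC : 0 ≤ p * C := by positivity
  -- What remains is linear in g, t, t', pC and Lαz, with feedback small enough to be eliminated.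
  linarith

namespace Experiment

variable {d N : ℕ} {Ω Ξ : Type*} [MeasurableSpace Ξ] {c : Experiment d N Ω Ξ}
  [MeasurableSpace Ω] {μ : Measure Ω} (h : c.Valid μ)

namespace Valid

include h

lemma sum_inner_dir_le {ω : Ω} (hω : c.Good ω) {n : ℕ} (hn : n ≤ c.R / c.P) :
    c.stepSize * ∑ m ∈ Finset.range n, ⟪c.dF (c.X m ω), c.dir m ω⟫ ≤
      globalObj c.F c.D c.x₀ - globalObj c.F c.D (c.X n ω) +
        c.L / 2 * c.stepSize ^ 2 * ∑ m ∈ Finset.range n, ‖c.dir m ω‖ ^ 2 := by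
  induction n with
  | zero => simp [X, state, run]
  | succ n ih =>
    have h1 := ih (by omega)
    have h2 := descent h.differentiable_globalObj h.lipschitz_dF (c.X n ω)
      (-(c.stepSize • c.dir n ω))
    rw [← h.X_succ_eq hω hn, norm_neg, norm_smul, mul_pow, Real.norm_eq_abs, sq_abs,
      inner_neg_right, inner_smul_right] at h2
    rw [Finset.sum_range_succ, Finset.sum_range_succ]
    simp only [dF] at h1 h2 ⊢
    linarith

variable [IsProbabilityMeasure μ]

/-- The descent inequality, summed over all windows. -/
lemma sum_integral_inner_dir_le :
    c.stepSize * ∑ m ∈ Finset.range (c.R / c.P), ∫ ω, ⟪c.dF (c.X m ω), c.dir m ω⟫ ∂μ ≤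
      c.Δ + c.L / 2 * c.stepSize ^ 2 *
        ∑ m ∈ Finset.range (c.R / c.P), ∫ ω, ‖c.dir m ω‖ ^ 2 ∂μ := by
  have i1 : ∀ m ∈ Finset.range (c.R / c.P),
      Integrable (fun ω => ⟪c.dF (c.X m ω), c.dir m ω⟫) μ := fun m hm =>
    integrable_inner_of_memLp (h.memLp_dF_X (Finset.mem_range.1 hm).le)
      (h.memLp_dir (Finset.mem_range.1 hm))
  have i2 : ∀ m ∈ Finset.range (c.R / c.P), Integrable (fun ω => ‖c.dir m ω‖ ^ 2) μ :=
    fun m hm => (h.memLp_dir (Finset.mem_range.1 hm)).integrable_norm_pow (by norm_num)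
  have hle := integral_mono_ae ((integrable_finsetSum _ i1).const_mul c.stepSize)
    ((integrable_const c.Δ).add
      ((integrable_finsetSum _ i2).const_mul (c.L / 2 * c.stepSize ^ 2)))
    (h.good_ae.mono fun ω hω =>
      (h.sum_inner_dir_le hω le_rfl).trans (add_le_add_left (h.obj.gap _) _))
  simp only [Pi.add_apply] at hle
  rwa [integral_add (integrable_const _) ((integrable_finsetSum _ i2).const_mul _),
    integral_const_mul, integral_const_mul, integral_finsetSum _ i1, integral_finsetSum _ i2,
    integral_const, probReal_univ, one_smul] at hle

lemma integral_sq_X_succ_sub {m : ℕ} (hm : m < c.R / c.P) :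
    ∫ ω, ‖c.X (m + 1) ω - c.X m ω‖ ^ 2 ∂μ = c.stepSize ^ 2 * ∫ ω, ‖c.dir m ω‖ ^ 2 ∂μ := by
  rw [← integral_const_mul]
  refine integral_congr_ae (h.good_ae.mono fun ω hω => ?_)
  simp only
  rw [h.X_succ_eq hω hm, add_sub_cancel_left, norm_neg, norm_smul, mul_pow, Real.norm_eq_abs,
    sq_abs]

omit [IsProbabilityMeasure μ] in
lemma meanStale_nonneg (m : ℕ) : 0 ≤ c.meanStale μ m :=
  mul_nonneg (by positivity) (Finset.sum_nonneg fun _ _ => integral_nonneg fun _ => sq_nonneg _)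

/-- The total staleness of the control variates. -/
lemma sum_meanStale_le :
    c.p / 2 * ∑ m ∈ Finset.range (c.R / c.P), c.meanStale μ m ≤
      ∑ m ∈ Finset.range (c.R / c.P),
        (3 / 2 * (c.L ^ 2 / c.I * (1 / (N : ℝ) * ∑ i, ∫ ω, c.partDrift m i ω ∂μ)) +
          3 / c.p * (c.L ^ 2 * (c.stepSize ^ 2 * ∫ ω, ‖c.dir m ω‖ ^ 2 ∂μ))) := by
  -- The current staleness is kept on the left to telescope; it starts at zero and is dropped at the
  -- end by nonnegativity.
  have key : ∀ n ≤ c.R / c.P, c.meanStale μ n +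
      c.p / 2 * ∑ m ∈ Finset.range n, c.meanStale μ m ≤ ∑ m ∈ Finset.range n,
        (3 / 2 * (c.L ^ 2 / c.I * (1 / (N : ℝ) * ∑ i, ∫ ω, c.partDrift m i ω ∂μ)) +
          3 / c.p * (c.L ^ 2 * (c.stepSize ^ 2 * ∫ ω, ‖c.dir m ω‖ ^ 2 ∂μ))) := by
    intro n hn
    induction n with
    | zero => simp [h.meanStale_zero]
    | succ n ih =>
      have h1 := ih (by omega)
      have h2 := h.meanStale_succ_le hn
      rw [h.integral_sq_X_succ_sub hn] at h2
      rw [Finset.sum_range_succ, Finset.sum_range_succ]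
      linarith
  linarith [key _ le_rfl, h.meanStale_nonneg (c.R / c.P)]

/-- The total squared gradient norm, under the step size conditions. -/
lemma sum_meanGrad_le {A B : ℝ} (hA : 0 ≤ A) (hB : 0 ≤ B) (hα : 0 < c.stepSize)
    (hdrift : c.η ^ 2 * c.P ^ 2 * c.I ^ 2 * c.L ^ 2 ≤ c.p / 69696)
    (hdrift_noise : c.η ^ 2 * c.P ^ 2 * c.I ^ 2 * c.L ^ 2 * (c.σ ^ 2 / c.I) ≤ A / 69696)
    (hstep : c.L * c.stepSize ≤ c.p / 60)
    (hstep_noise : c.L * c.stepSize * (c.ρ ^ 2 * c.σ ^ 2 / (c.P * c.I)) ≤ A / 60)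
    (hgap : c.Δ ≤ c.stepSize * ((c.R / c.P : ℕ) : ℝ) * (60 * A + 60 * B)) :
    ∑ m ∈ Finset.range (c.R / c.P), c.meanGrad μ m ≤
      135 * ((c.R / c.P : ℕ) : ℝ) * (A + B) := by
  have hp := h.p_pos
  have hp1 := h.p_le
  have hL := h.L_pos
  have hP : (0 : ℝ) < c.P := Nat.cast_pos.2 h.P_pos
  have hI : (0 : ℝ) < c.I := Nat.cast_pos.2 h.I_pos
  set K := c.η ^ 2 * c.P ^ 2 * c.I ^ 2 * c.L ^ 2 with hK
  have hK0 : 0 ≤ K := by positivity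
  set ν := c.ρ ^ 2 * c.σ ^ 2 / (c.P * c.I) with hν
  set s := c.σ ^ 2 / c.I with hs
  set W := ((c.R / c.P : ℕ) : ℝ) with hW
  have hW0 : 0 ≤ W := Nat.cast_nonneg _
  have hsmall : 32 * (c.η ^ 2 * c.L ^ 2 * (c.P : ℝ) ^ 2 * (c.I : ℝ) ^ 2) ≤ 1 := by
    have : c.η ^ 2 * c.L ^ 2 * (c.P : ℝ) ^ 2 * (c.I : ℝ) ^ 2 = K := by rw [hK]; ring
    rw [this]; linarith
  set T : ℕ → ℝ := fun m => c.L ^ 2 / (c.P * c.I) * ∫ ω, c.totalDrift m ω ∂μ with hT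
  set T' : ℕ → ℝ := fun m => c.L ^ 2 / c.I * (1 / (N : ℝ) * ∑ i, ∫ ω, c.partDrift m i ω ∂μ)
    with hT'
  set S : ℕ → ℝ := fun m => ∫ ω, ‖c.dir m ω‖ ^ 2 ∂μ with hS
  set g := ∑ m ∈ Finset.range (c.R / c.P), c.meanGrad μ m with hg
  set C := ∑ m ∈ Finset.range (c.R / c.P), c.meanStale μ m with hC
  have hg0 : 0 ≤ g := Finset.sum_nonneg fun m _ => integral_nonneg fun _ => sq_nonneg _
  have hC0 : 0 ≤ C := Finset.sum_nonneg fun m _ => h.meanStale_nonneg m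
  have sum_bound : ∀ k : ℝ, ∑ m ∈ Finset.range (c.R / c.P),
      k * K * (9 * s + 8 * c.meanStale μ m + c.meanGrad μ m) = k * K * (9 * s * W + 8 * C + g) := by
    intro k
    rw [← Finset.mul_sum, Finset.sum_add_distrib, Finset.sum_add_distrib,
      ← Finset.mul_sum (Finset.range (c.R / c.P)) _ 8, Finset.sum_const, Finset.card_range,
      nsmul_eq_mul]
    ring
  have T_le : ∑ m ∈ Finset.range (c.R / c.P), T m ≤ 32 * K * (9 * s * W + 8 * C + g) := by
    rw [← sum_bound]
    refine Finset.sum_le_sum fun m hm => ?_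
    have hm := Finset.mem_range.1 hm
    have h1 := h.integral_totalDrift_le hm hsmall
    have h2 := h.mean_ctrlDev_le hm.le
    have h3 : c.σ ^ 2 / c.I + 1 / (N : ℝ) * ∑ i, ∫ ω, ‖c.ctrlDev m i ω‖ ^ 2 ∂μ +
        ∫ ω, ‖c.dF (c.X m ω)‖ ^ 2 ∂μ ≤ 9 * s + 8 * c.meanStale μ m + c.meanGrad μ m := by
      rw [meanGrad]; linarith
    calc T m ≤ c.L ^ 2 / (c.P * c.I) * (32 * c.η ^ 2 * c.P ^ 3 * c.I ^ 3 *
          (9 * s + 8 * c.meanStale μ m + c.meanGrad μ m)) :=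
          mul_le_mul_of_nonneg_left (h1.trans (mul_le_mul_of_nonneg_left h3 (by positivity)))
            (by positivity)
      _ = _ := by rw [hK]; field_simp
  have T'_le : ∑ m ∈ Finset.range (c.R / c.P), T' m ≤ 48 * K * (9 * s * W + 8 * C + g) := by
    rw [← sum_bound]
    refine Finset.sum_le_sum fun m hm => ?_
    have hm := Finset.mem_range.1 hm
    have h1 := h.integral_partDrift_le hm hsmall
    have h2 := h.mean_ctrlDev_le hm.le
    have h3 : c.σ ^ 2 / c.I + 1 / (N : ℝ) * ∑ i, ∫ ω, ‖c.ctrlDev m i ω‖ ^ 2 ∂μ +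
        ∫ ω, ‖c.dF (c.X m ω)‖ ^ 2 ∂μ ≤ 9 * s + 8 * c.meanStale μ m + c.meanGrad μ m := by
      rw [meanGrad]; linarith
    calc T' m ≤ c.L ^ 2 / c.I * (48 * c.η ^ 2 * c.P ^ 2 * c.I ^ 3 *
          (9 * s + 8 * c.meanStale μ m + c.meanGrad μ m)) :=
          mul_le_mul_of_nonneg_left (h1.trans (mul_le_mul_of_nonneg_left h3 (by positivity)))
            (by positivity)
      _ = _ := by rw [hK]; field_simp
  have S_le : ∑ m ∈ Finset.range (c.R / c.P), S m ≤
      5 * (g + ∑ m ∈ Finset.range (c.R / c.P), T m + 2 * ν * W + 4 * C) := by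
    refine (Finset.sum_le_sum fun m hm => h.integral_sq_dir_le (Finset.mem_range.1 hm)).trans
      (le_of_eq ?_)
    rw [← Finset.mul_sum, Finset.sum_add_distrib, Finset.sum_add_distrib, Finset.sum_add_distrib,
      ← Finset.mul_sum (Finset.range (c.R / c.P)) _ 4, Finset.sum_const, Finset.card_range,
      nsmul_eq_mul]
    ring
  have descent_le : c.stepSize * (1 / 2 * g - 1 / 2 * ∑ m ∈ Finset.range (c.R / c.P), T m) ≤
      c.Δ + c.L / 2 * c.stepSize ^ 2 * ∑ m ∈ Finset.range (c.R / c.P), S m := by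
    refine le_trans (mul_le_mul_of_nonneg_left ?_ hα.le) h.sum_integral_inner_dir_le
    rw [hg, Finset.mul_sum, Finset.mul_sum, ← Finset.sum_sub_distrib]
    exact Finset.sum_le_sum fun m hm => h.le_integral_inner_dir (Finset.mem_range.1 hm)
  have stale_le : c.p / 2 * C ≤ 3 / 2 * ∑ m ∈ Finset.range (c.R / c.P), T' m +
      3 / c.p * (c.L ^ 2 * (c.stepSize ^ 2 * ∑ m ∈ Finset.range (c.R / c.P), S m)) := by
    refine h.sum_meanStale_le.trans (le_of_eq ?_)
    rw [Finset.sum_add_distrib]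
    simp only [hT', hS, Finset.mul_sum]
  have hT0 : 0 ≤ ∑ m ∈ Finset.range (c.R / c.P), T m :=
    Finset.sum_nonneg fun m hm => mul_nonneg (by positivity)
      (integral_nonneg_of_ae (h.good_ae.mono fun ω hω =>
        (h.dynamics (Finset.mem_range.1 hm) hω).wsum_nonneg fun s _ i =>
          WindowDynamics.localDrift_nonneg s i))
  have hS0 : 0 ≤ ∑ m ∈ Finset.range (c.R / c.P), S m :=
    Finset.sum_nonneg fun m _ => integral_nonneg fun _ => sq_nonneg _
  exact resolve_bounds hp hp1 hL hα hW0 hA hB hg0 hC0 hT0 hS0 hdrift hdrift_noise hstep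
    hstep_noise hgap T_le T'_le S_le descent_le stale_le

end Valid

end Experiment

/-! ### Arithmetic of the step sizes -/

section StepSizes

variable {P I R Δ L σ ρ p η : ℝ}

/-- Consequences of the bound on the local step size. -/
lemma sq_localStep_le (hP : 0 < P) (hI : 0 < I) (hR : 0 < R) (hΔ : 0 < Δ) (hL : 0 < L)
    (hσ : 0 < σ) (hρ : 0 < ρ) (hp : 0 < p) (hη : 0 < η)
    (h : η ≤ 1 / (264 * √P) *
      min (Δ ^ (1 / 4 : ℝ) * ρ ^ (1 / 2 : ℝ) /
            (L ^ (3 / 4 : ℝ) * I ^ (3 / 4 : ℝ) * R ^ (1 / 4 : ℝ) * P ^ (1 / 2 : ℝ) *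
              σ ^ (1 / 2 : ℝ)))
          (ρ * √p / (L * I * P))) :
    η ^ 2 ≤ √Δ * ρ / (69696 * P ^ 2 * (L * √L) * (I * √I) * √R * σ) ∧
      η ^ 2 ≤ ρ ^ 2 * p / (69696 * P ^ 3 * L ^ 2 * I ^ 2) := by
  have hc : 0 ≤ 1 / (264 * √P) := by positivity
  -- After squaring, the fractional powers become products with square roots, and 264² = 69696.
  have half : ∀ {x : ℝ}, 0 < x → (x ^ (1 / 2 : ℝ)) ^ 2 = x := fun hx => by
    rw [← Real.sqrt_eq_rpow, Real.sq_sqrt hx.le]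
  have quarter : ∀ {x : ℝ}, 0 < x → (x ^ (1 / 4 : ℝ)) ^ 2 = √x := fun hx => by
    rw [← Real.rpow_mul_natCast hx.le, Real.sqrt_eq_rpow]; norm_num
  have three : ∀ {x : ℝ}, 0 < x → (x ^ (3 / 4 : ℝ)) ^ 2 = x * √x := fun {x} hx => by
    rw [← Real.rpow_mul_natCast hx.le, Real.sqrt_eq_rpow]
    nth_rewrite 2 [← Real.rpow_one x]
    rw [← Real.rpow_add hx]
    norm_num
  constructor
  · have h1 := pow_le_pow_left₀ hη.le (h.trans (mul_le_mul_of_nonneg_left (min_le_left _ _) hc)) 2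
    refine h1.trans (le_of_eq ?_)
    simp only [mul_pow, div_pow, half hρ, half hP, half hσ, quarter hΔ, quarter hR, three hL,
      three hI, Real.sq_sqrt hP.le]
    field_simp
    norm_num
  · have h1 := pow_le_pow_left₀ hη.le (h.trans (mul_le_mul_of_nonneg_left (min_le_right _ _) hc)) 2
    refine h1.trans (le_of_eq ?_)
    simp only [mul_pow, div_pow, Real.sq_sqrt hP.le, Real.sq_sqrt hp.le]
    field_simp
    norm_num

/-- The two terms of the minimum defining η serve separate purposes: the second makes the drift
feedback a small multiple of p (with ρ²/P ≤ 1 to spare), the first bounds the drift noise by exactly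
A/69696. -/
lemma drift_bounds (hP : 1 ≤ P) (hI : 0 < I) (hR : 0 < R) (hL : 0 < L)
    (hσ : 0 < σ) (hρ : 0 < ρ) (hρ1 : ρ ≤ 1) (hp : 0 < p)
    (h1 : η ^ 2 ≤ √Δ * ρ / (69696 * P ^ 2 * (L * √L) * (I * √I) * √R * σ))
    (h2 : η ^ 2 ≤ ρ ^ 2 * p / (69696 * P ^ 3 * L ^ 2 * I ^ 2)) :
    η ^ 2 * P ^ 2 * I ^ 2 * L ^ 2 ≤ p / 69696 ∧
      η ^ 2 * P ^ 2 * I ^ 2 * L ^ 2 * (σ ^ 2 / I) ≤ √Δ * √L * ρ * σ / (√I * √R) / 69696 := by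
  have hP0 : 0 < P := by linarith
  constructor
  · have e : ρ ^ 2 * p / (69696 * P ^ 3 * L ^ 2 * I ^ 2) * (P ^ 2 * I ^ 2 * L ^ 2) =
        ρ ^ 2 / P * (p / 69696) := by field_simp
    have h3 := mul_le_mul_of_nonneg_right h2 (by positivity : 0 ≤ P ^ 2 * I ^ 2 * L ^ 2)
    rw [e] at h3
    have h4 : ρ ^ 2 / P ≤ 1 := by
      rw [div_le_one hP0]
      exact (pow_le_one₀ hρ.le hρ1).trans hP
    have h5 := mul_le_mul_of_nonneg_right h4 (by positivity : 0 ≤ p / 69696)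
    linarith
  · have e : √Δ * ρ / (69696 * P ^ 2 * (L * √L) * (I * √I) * √R * σ) *
        (P ^ 2 * I ^ 2 * L ^ 2 * (σ ^ 2 / I)) = √Δ * √L * ρ * σ / (√I * √R) / 69696 := by
      have : 0 < √L := Real.sqrt_pos.2 hL
      field_simp
      rw [Real.sq_sqrt hL.le]
    have h3 := mul_le_mul_of_nonneg_right h1
      (by positivity : 0 ≤ P ^ 2 * I ^ 2 * L ^ 2 * (σ ^ 2 / I))
    rw [e] at h3
    linarith

/-- Consequences of the choice of the effective step size. -/
lemma stepSize_bounds {α : ℝ} (hP : 0 < P) (hI : 0 < I) (hR : 0 < R) (hΔ : 0 < Δ) (hL : 0 < L)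
    (hσ : 0 < σ) (hρ : 0 < ρ) (hp : 0 < p)
    (hα : α = P * I * min (√Δ / (60 * √(L * I * R) * ρ * σ)) (p / (60 * L * I * P))) :
    0 < α ∧ L * α ≤ p / 60 ∧
      L * α * (ρ ^ 2 * σ ^ 2 / (P * I)) ≤ √Δ * √L * ρ * σ / (√I * √R) / 60 ∧
      Δ ≤ α * (R / P) * (60 * (√Δ * √L * ρ * σ / (√I * √R)) + 60 * (Δ * L * P / (p * R))) := by
  have hsΔ : 0 < √Δ := Real.sqrt_pos.2 hΔ
  have hsL : 0 < √L := Real.sqrt_pos.2 hL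
  have hsI : 0 < √I := Real.sqrt_pos.2 hI
  have hsR : 0 < √R := Real.sqrt_pos.2 hR
  have eL := Real.mul_self_sqrt hL.le
  have eΔ := Real.mul_self_sqrt hΔ.le
  have eI := Real.mul_self_sqrt hI.le
  have eR := Real.mul_self_sqrt hR.le
  have e : √(L * I * R) = √L * √I * √R := by
    rw [Real.sqrt_mul (by positivity), Real.sqrt_mul hL.le]
  rw [e] at hα
  set a := √Δ / (60 * (√L * √I * √R) * ρ * σ) with ha
  set b := p / (60 * L * I * P) with hb
  have ha0 : 0 < a := by positivity
  have hb0 : 0 < b := by positivity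
  have hα0 : 0 < α := by rw [hα]; have := lt_min ha0 hb0; positivity
  have hle : α ≤ P * I * a := hα.le.trans (by gcongr; exact min_le_left _ _)
  have hle' : α ≤ P * I * b := hα.le.trans (by gcongr; exact min_le_right _ _)
  refine ⟨hα0, ?_, ?_, ?_⟩
  · calc L * α ≤ L * (P * I * b) := by gcongr
      _ = p / 60 := by rw [hb]; field_simp
  · calc L * α * (ρ ^ 2 * σ ^ 2 / (P * I)) ≤ L * (P * I * a) * (ρ ^ 2 * σ ^ 2 / (P * I)) := by gcongr
      _ = (√L * √L) * (a * (ρ ^ 2 * σ ^ 2)) := by rw [eL]; field_simp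
      _ = _ := by rw [ha]; field_simp
  · have hA : P * I * a * (R / P) * (60 * (√Δ * √L * ρ * σ / (√I * √R))) = Δ := by
      calc P * I * a * (R / P) * (60 * (√Δ * √L * ρ * σ / (√I * √R)))
          = (√I * √I) * (√R * √R) * a * (60 * (√Δ * √L * ρ * σ / (√I * √R))) := by
            rw [eI, eR]; field_simp
        _ = √Δ * √Δ := by rw [ha]; field_simp
        _ = Δ := eΔ
    have hB : P * I * b * (R / P) * (60 * (Δ * L * P / (p * R))) = Δ := by
      rw [hb]; field_simp
    -- Whichever term attains the minimum, the matching one of A and B alone already recovers Δ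
    -- exactly.
    rcases min_choice a b with hm | hm <;> rw [hm] at hα <;> rw [hα]
    · have : 0 ≤ P * I * a * (R / P) * (60 * (Δ * L * P / (p * R))) := by positivity
      linarith
    · have : 0 ≤ P * I * b * (R / P) * (60 * (√Δ * √L * ρ * σ / (√I * √R))) := by positivity
      linarith

/-- Consequences of the lower bound on the number of rounds. -/
lemma error_bounds {ε : ℝ} (hP : 0 < P) (hI : 0 < I) (hΔ : 0 < Δ) (hL : 0 < L)
    (hσ : 0 < σ) (hρ : 0 < ρ) (hp : 0 < p) (hε : 0 < ε)
    (h : R ≥ Δ * L * ρ ^ 2 * σ ^ 2 / (I * ε ^ 4) + 300 * Δ * L * P / (p * ε ^ 2)) :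
    √Δ * √L * ρ * σ / (√I * √R) ≤ ε ^ 2 ∧ Δ * L * P / (p * R) ≤ ε ^ 2 / 300 := by
  have h1 : 0 < Δ * L * ρ ^ 2 * σ ^ 2 / (I * ε ^ 4) := by positivity
  have h2 : 0 < 300 * Δ * L * P / (p * ε ^ 2) := by positivity
  have hR : 0 < R := by linarith
  constructor
  · refine (sq_le_sq₀ (by positivity) (by positivity)).1 ?_
    simp only [mul_pow, div_pow, Real.sq_sqrt hΔ.le, Real.sq_sqrt hL.le, Real.sq_sqrt hI.le,
      Real.sq_sqrt hR.le]
    have h3 : Δ * L * ρ ^ 2 * σ ^ 2 / (I * ε ^ 4) ≤ R := by linarith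
    rw [div_le_iff₀ (by positivity)] at h3 ⊢
    linarith
  · have h3 : 300 * Δ * L * P / (p * ε ^ 2) ≤ R := by linarith
    rw [div_le_iff₀ (by positivity)] at h3 ⊢
    linarith

end StepSizes

end AmplifiedScaffold

end

/-! ### The convergence theorem -/

theorem corollary1 {d N : ℕ} {Ω Ξ : Type*} [MeasurableSpace Ω] [MeasurableSpace Ξ]
    (μ : Measure Ω) [IsProbabilityMeasure μ]
    (D : Fin N → Measure Ξ) [∀ i, IsProbabilityMeasure (D i)]
    (F : Fin N → Vec d → Ξ → ℝ) (x₀ : Vec d)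
    (q : ℕ → Fin N → Ω → ℝ) (ξ₀ ξ : ℕ → ℕ → Fin N → Ω → Ξ)
    (R I P : ℕ) (Δ L σ ρ p ε η γ : ℝ)
    (hN : 0 < N) (hI : 1 ≤ I) (hP : 1 ≤ P) (hPR : P ∣ R)
    (hΔ : 0 < Δ) (hL : 0 < L) (hσ : 0 < σ) (hρ : 0 < ρ) (hρ1 : ρ ≤ 1)
    (hp : 0 < p) (hp1 : p ≤ 1) (hε : 0 < ε)
    (hobj : ObjAssumption F D x₀ Δ L σ)
    (hsamp : SampleAssumption μ D R I P ξ₀ ξ)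
    (hpart : ParticipationAssumption μ R I P ρ p q ξ₀ ξ)
    (hreg : RegularityCondition μ R P ρ q)
    (hη : 0 < η)
    (hη_le : η ≤ 1 / (264 * √(P : ℝ)) *
      min (Δ ^ (1 / 4 : ℝ) * ρ ^ (1 / 2 : ℝ) /
            (L ^ (3 / 4 : ℝ) * (I : ℝ) ^ (3 / 4 : ℝ) * (R : ℝ) ^ (1 / 4 : ℝ) *
              (P : ℝ) ^ (1 / 2 : ℝ) * σ ^ (1 / 2 : ℝ)))
          (ρ * √p / (L * I * P)))
    (hγ : γ = 1 / η * min (√Δ / (60 * √(L * I * R) * ρ * σ)) (p / (60 * L * I * P))) :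
    ((R : ℝ) ≥ Δ * L * ρ ^ 2 * σ ^ 2 / (I * ε ^ 4) + 300 * Δ * L * P / (p * ε ^ 2) →
      AvgGradBound μ (globalObj F D) (model F I P η γ x₀ q ξ₀ ξ) R P (302 * ε ^ 2)) ∧
    ((I : ℝ) ≥ ρ ^ 2 * σ ^ 2 * p / (P * ε ^ 2) → (R : ℝ) ≥ 301 * Δ * L * P / (p * ε ^ 2) →
      AvgGradBound μ (globalObj F D) (model F I P η γ x₀ q ξ₀ ξ) R P (302 * ε ^ 2)) := by
  have hP1 : (1 : ℝ) ≤ P := Nat.one_le_cast.2 hP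
  have hP0 : (0 : ℝ) < P := by linarith
  have hI0 : (0 : ℝ) < I := Nat.cast_pos.2 hI
  have main : (R : ℝ) ≥ Δ * L * ρ ^ 2 * σ ^ 2 / (I * ε ^ 4) + 300 * Δ * L * P / (p * ε ^ 2) →
      AvgGradBound μ (globalObj F D) (model F I P η γ x₀ q ξ₀ ξ) R P (302 * ε ^ 2) := by
    intro hR
    have hR0 : (0 : ℝ) < R := by
      have h1 : 0 < Δ * L * ρ ^ 2 * σ ^ 2 / (I * ε ^ 4) := by positivity
      have h2 : 0 < 300 * Δ * L * P / (p * ε ^ 2) := by positivity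
      linarith
    let c : Experiment d N Ω Ξ :=
      { D := D, F := F, x₀ := x₀, q := q, ξ₀ := ξ₀, ξ := ξ, R := R, I := I, P := P, Δ := Δ, L := L,
        σ := σ, ρ := ρ, p := p, η := η, γ := γ }
    have h : c.Valid μ :=
      { prob := inferInstance, N_pos := hN, I_pos := hI, P_pos := hP, dvd := hPR, L_pos := hL,
        p_pos := hp, p_le := hp1, obj := hobj, samp := hsamp, part := hpart, reg := hreg.v_le }
    -- The factor 1/η in γ cancels: the effective step does not depend on η, which can be small
    -- enough to suppress the drift.
    have hα : c.stepSize = P * I *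
        min (√Δ / (60 * √(L * I * R) * ρ * σ)) (p / (60 * L * I * P)) := by
      show γ * η * P * I = _
      rw [hγ]
      field_simp
    have hW : ((R / P : ℕ) : ℝ) = (R : ℝ) / P := Nat.cast_div hPR hP0.ne'
    obtain ⟨b1, b2⟩ := sq_localStep_le hP0 hI0 hR0 hΔ hL hσ hρ hp hη hη_le
    obtain ⟨b3, b4⟩ := drift_bounds hP1 hI0 hR0 hL hσ hρ hρ1 hp b1 b2
    obtain ⟨b5, b6, b7, b8⟩ := stepSize_bounds hP0 hI0 hR0 hΔ hL hσ hρ hp hα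
    obtain ⟨b9, b10⟩ := error_bounds hP0 hI0 hΔ hL hσ hρ hp hε hR
    rw [← hW] at b8
    have key := h.sum_meanGrad_le (by positivity) (by positivity) b5 b3 b4 b6 b7 b8
    refine ⟨fun m hm => (h.memLp_dF_X (m := m) hm.le).integrable_norm_pow (by norm_num), ?_⟩
    calc (P : ℝ) / R * ∑ m ∈ Finset.range (R / P),
          ∫ ω, ‖gradient (globalObj F D) (model F I P η γ x₀ q ξ₀ ξ (m * P) ω)‖ ^ 2 ∂μ
        ≤ P / R * (135 * ((R / P : ℕ) : ℝ) * (√Δ * √L * ρ * σ / (√I * √R) +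
            Δ * L * P / (p * R))) := mul_le_mul_of_nonneg_left key (by positivity)
      _ = 135 * (√Δ * √L * ρ * σ / (√I * √R) + Δ * L * P / (p * R)) := by
        rw [hW]; field_simp
      -- In fact 135(1 + 1/300) < 136.
      _ ≤ 302 * ε ^ 2 := by linarith [sq_nonneg ε]
  refine ⟨main, fun hI' hR => main ?_⟩
  -- For I this large the statistical term of the required R is at most ΔLP/(pε²), one unit on top
  -- of the 300.
  have h1 : Δ * L * ρ ^ 2 * σ ^ 2 / (I * ε ^ 4) ≤ Δ * L * P / (p * ε ^ 2) := by
    rw [ge_iff_le, div_le_iff₀ (by positivity)] at hI'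
    rw [div_le_div_iff₀ (by positivity) (by positivity)]
    have := mul_le_mul_of_nonneg_left hI' (by positivity : 0 ≤ Δ * L * ε ^ 2)
    linarith
  have h2 : 301 * Δ * L * P / (p * ε ^ 2) =
      Δ * L * P / (p * ε ^ 2) + 300 * Δ * L * P / (p * ε ^ 2) := by ring
  linarith
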